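/- Let $\mathcal M$ be a compact, path-connected space that is semi-locally simply connected (every point has a neighbourhood in which every loop is null-homotopic in $\mathcal M$). Let $\mathcal M_1\subseteq\mathcal M$ carry the subspace topology, and let $f:\mathcal M_1\to\mathcal M$ be a covering map of finite degree $d=\deg f\ge 2$ (a partial self-covering). Let $f^n:\mathcal M_n\to\mathcal M$ be its iterations, where $\mathcal M_0=\mathcal M$ and $\mathcal M_{n+1}=f^{-1}(\mathcal M_n)$. Suppose that $f$ is expanding: there are a metric $|x-y|$ on $\mathcal M$ inducing its topology, $L>1$, $\epsilon>0$ and $n\ge 1$ such that $|f^n(x)-f^n(y)|\ge L|x-y|$ for all $x,y\in\mathcal M_n$ with $|x-y|<\epsilon$. For $t\in\mathcal M$ let $T_t$ be the rooted tree of preimages of $t$, whose $n$th level is $f^{-n}(t)$ and in which $v\in f^{-(n+1)}(t)$ is joined to $f(v)\in f^{-n}(t)$, and let $\partial T_t=\varprojlim f^{-n}(t)$ be its boundary (the levels being discrete). For a vertex $v$ of $T_t$, identify $\partial T_v$ with the set of elements of $\partial T_t$ passing through $v$. A path $\gamma$ in $\mathcal M$ from $v$ to $u$ defines a homeomorphism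 $S_\gamma:\partial T_v\to\partial T_u$, which acts on the $k$th level by sending $z\in f^{-k}(v)$ to the end of the lift of $\gamma$ by $f^k$ that starts at $z$. Let $\mathcal V_f$ be the group of all homeomorphisms $\partial T_t\to\partial T_t$ that are locally equal to homeomorphisms $S_\gamma:\partial T_v\to\partial T_u$, where $v,u$ are vertices of $T_t$ and $\gamma$ is a path in $\mathcal M$ from $v$ to $u$. Let $\mathcal V_f'$ be its commutator subgroup. Let $H_1$ denote first integral singular homology, let $\iota:\mathcal M_1\to\mathcal M$ be the inclusion, and let $f^!:H_1(\mathcal M)\to H_1(\mathcal M_1)$ be the transfer map, induced by sending a singular simplex to the sum of all its lifts by $f$. Then for every $t\in\mathcal M$ the following holds. 1. If $d$ is even, then $\mathcal V_f/\mathcal V_f'$ is isomorphic to the quotient of $H_1(\mathcal M)$ by the range of $1-\iota_*\circ f^!$. 2. If $d$ is odd, then there is a unique homomorphism $\mathrm{sign}:H_1(\mathcal M)\to\mathbb Z/2\mathbb Z$ whose value on the class of each loop $\gamma$ is the parity of the monodromy permutation of $\gamma$ on the fibre of $f$ over the base point of $\gamma$, and $\mathcal V_f/\mathcal V_f'$ is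 isomorphic to the quotient of $\mathbb Z/2\mathbb Z\oplus H_1(\mathcal M)$ by the range of $1-\sigma_1$, where $\sigma_1(t,c)=(t+\mathrm{sign}(c),\ \iota_*f^!(c))$. -/

import Mathlib

open scoped unitInterval Topology

noncomputable section

namespace ExpandingMaps

universe u

section Dynamics

/-- Every point of `X` has a neighbourhood in which every loop is null-homotopic in `X`. -/
def IsSemilocallySimplyConnected (X : Type u) [TopologicalSpace X] : Prop :=
  ∀ x : X, ∃ U ∈ 𝓝 x, ∀ (y : X) (γ : Path y y), (∀ s, γ s ∈ U) →
    γ.Homotopic (Path.refl y)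

variable {M : Type u} {M₁ : Set M}

/-- A partial self-covering of degree `d`: a covering map `f : M₁ → M`, where `M₁ ⊆ M` carries
the subspace topology, all of whose fibres are finite with `d` elements. -/
structure IsPartialSelfCovering [TopologicalSpace M] (f : M₁ → M) (d : ℕ) : Prop where
  isCoveringMap : IsCoveringMap f
  finite_fiber : ∀ x, Finite (f ⁻¹' {x})
  card_fiber : ∀ x, Nat.card (f ⁻¹' {x}) = d

/-- The domain `Mₙ` of the `n`-th iteration of `f : M₁ → M`: `M₀ = M`, `Mₙ₊₁ = f⁻¹(Mₙ)`. -/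
def iterDomain (f : M₁ → M) : ℕ → Set M
  | 0 => Set.univ
  | n + 1 => {x | ∃ h : x ∈ M₁, f ⟨x, h⟩ ∈ iterDomain f n}

/-- The `n`-th iteration `fⁿ : Mₙ → M` of `f : M₁ → M`. -/
def iter (f : M₁ → M) : (n : ℕ) → iterDomain f n → M
  | 0, x => x
  | n + 1, x => iter f n ⟨f ⟨x, x.2.1⟩, x.2.2⟩

/-- `f : M₁ → M` is expanding: `M` is compact and there are a metric on `M` (inducing
its topology), `L > 1`, `ε > 0` and `n ≥ 1` with `|fⁿ(x) - fⁿ(y)| ≥ L |x - y|` for all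
`x, y ∈ Mₙ` with `|x - y| < ε`. -/
def IsExpanding [T : TopologicalSpace M] (f : M₁ → M) : Prop :=
  CompactSpace M ∧ ∃ μ : MetricSpace M, μ.toUniformSpace.toTopologicalSpace = T ∧
    ∃ L : ℝ, 1 < L ∧ ∃ ε : ℝ, 0 < ε ∧ ∃ n : ℕ, 0 < n ∧
      ∀ x y : iterDomain f n, μ.dist (x : M) (y : M) < ε →
        L * μ.dist (x : M) (y : M) ≤ μ.dist (iter f n x) (iter f n y)

/-- The boundary `∂T_t` of the tree of preimages of `t`: the set of sequences
`t = w₀, w₁, w₂, …` with `wₙ₊₁ ∈ M₁` and `f wₙ₊₁ = wₙ`, i.e. the inverse limit of the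
sets `f⁻ⁿ(t)`. -/
@[ext]
structure Boundary (f : M₁ → M) (t : M) where
  vertex : ℕ → M
  vertex_zero : vertex 0 = t
  mem : ∀ n, vertex (n + 1) ∈ M₁
  map_succ : ∀ n, f ⟨vertex (n + 1), mem n⟩ = vertex n

/-- The inverse limit topology, the levels `f⁻ⁿ(t)` being discrete. -/
instance (f : M₁ → M) (t : M) : TopologicalSpace (Boundary f t) :=
  ⨅ n : ℕ, TopologicalSpace.induced (fun w => w.vertex n) ⊥

namespace Boundary

variable {f : M₁ → M} {t : M}

/-- The identification of `{w ∈ ∂T_t : w passes through the vertex v of level n}` with `∂T_v`. -/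
def tail (w : Boundary f t) (n : ℕ) {v : M} (h : w.vertex n = v) : Boundary f v where
  vertex k := w.vertex (n + k)
  vertex_zero := h
  mem k := w.mem (n + k)
  map_succ k := w.map_succ (n + k)

theorem vertex_eq_of_succ {w w' : Boundary f t} {n : ℕ}
    (h : w.vertex (n + 1) = w'.vertex (n + 1)) : w.vertex n = w'.vertex n := by
  rw [← w.map_succ, ← w'.map_succ]
  congr 1
  exact Subtype.ext h

theorem ext_of_tail {w w' : Boundary f t} (m : ℕ)
    (h : ∀ k, w.vertex (m + k) = w'.vertex (m + k)) : w = w' := by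
  induction m with
  | zero => exact Boundary.ext (funext fun k => by simpa using h k)
  | succ m ih =>
    refine ih fun k => vertex_eq_of_succ ?_
    have := h k
    rwa [Nat.add_right_comm] at this

/-- The element of `∂T_t` that follows `w` up to level `n` and then `z`. -/
def glue (w : Boundary f t) (n : ℕ) (z : Boundary f (w.vertex n)) : Boundary f t where
  vertex j := if j ≤ n then w.vertex j else z.vertex (j - n)
  vertex_zero := by simp [w.vertex_zero]
  mem j := by
    split_ifs with h
    · exact w.mem j
    · obtain ⟨i, rfl⟩ : ∃ i, j = n + i := ⟨j - n, by omega⟩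
      have := z.mem i
      rwa [show n + i + 1 - n = i + 1 by omega]
  map_succ j := by
    by_cases h : j + 1 ≤ n
    · simp only [h, if_true, show j ≤ n by omega]
      exact w.map_succ j
    · obtain ⟨i, rfl⟩ : ∃ i, j = n + i := ⟨j - n, by omega⟩
      have h1 := z.map_succ i
      simp only [h, if_false, show n + i + 1 - n = i + 1 by omega, h1]
      split_ifs with h2
      · obtain rfl : i = 0 := by omega
        exact z.vertex_zero
      · congr 1
        omega

theorem glue_vertex (w : Boundary f t) (n : ℕ) (z : Boundary f (w.vertex n)) (k : ℕ) :
    (w.glue n z).vertex (n + k) = z.vertex k := by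
  by_cases hk : k = 0
  · subst hk
    simp [glue, z.vertex_zero]
  · simp [glue, hk]

end Boundary

variable [TopologicalSpace M] {f : M₁ → M}

/-- For `w ∈ ∂T_x` and a path `γ` starting at `x`, the lift of `γ` by `fᵏ` starting at the
`k`-th vertex of `w`; the `(k+1)`-st one is the lift by `f` of the `k`-th one. -/
def liftTower (hf : IsCoveringMap f) {x y : M} (γ : Path x y) (w : Boundary f x) :
    (k : ℕ) → {Γ : C(I, M) // Γ 0 = w.vertex k}
  | 0 => ⟨γ, γ.source.trans w.vertex_zero.symm⟩
  | k + 1 =>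
    let Γ := liftTower hf γ w k
    let h : Γ.1 0 = f ⟨w.vertex (k + 1), w.mem k⟩ := Γ.2.trans (w.map_succ k).symm
    ⟨⟨fun s => (hf.liftPath Γ.1 ⟨w.vertex (k + 1), w.mem k⟩ h s : M), by fun_prop⟩,
      congrArg Subtype.val (hf.liftPath_zero Γ.1 _ h)⟩

/-- `Γ'` is a lift of `Γ` by `f`. -/
def IsLift (f : M₁ → M) (Γ' Γ : C(I, M)) : Prop :=
  ∀ s, ∃ h : Γ' s ∈ M₁, f ⟨Γ' s, h⟩ = Γ s

theorem IsLift.unique (hf : IsCoveringMap f) {Γ Γ₁ Γ₂ : C(I, M)} (h₁ : IsLift f Γ₁ Γ)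
    (h₂ : IsLift f Γ₂ Γ) (h : Γ₁ 0 = Γ₂ 0) : Γ₁ = Γ₂ := by
  choose m₁ e₁ using h₁
  choose m₂ e₂ using h₂
  have := hf.eq_of_comp_eq (g₁ := fun s => ⟨Γ₁ s, m₁ s⟩) (g₂ := fun s => ⟨Γ₂ s, m₂ s⟩)
    (by fun_prop) (by fun_prop) (funext fun s => (e₁ s).trans (e₂ s).symm) 0 (Subtype.ext h)
  ext s
  exact congrArg Subtype.val (congrFun this s)

theorem liftTower_isLift (hf : IsCoveringMap f) {x y : M} (γ : Path x y) (w : Boundary f x)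
    (k : ℕ) : IsLift f (liftTower hf γ w (k + 1)).1 (liftTower hf γ w k).1 := fun s =>
  ⟨Subtype.coe_prop _, congrFun (hf.liftPath_lifts (liftTower hf γ w k).1
    ⟨w.vertex (k + 1), w.mem k⟩ ((liftTower hf γ w k).2.trans (w.map_succ k).symm)) s⟩

/-- The map `S_γ : ∂T_x → ∂T_y` defined by a path `γ` from `x` to `y`: the `k`-th vertex of
`S_γ(w)` is the end of the lift of `γ` by `fᵏ` starting at the `k`-th vertex of `w`. -/
def S (hf : IsCoveringMap f) {x y : M} (γ : Path x y) (w : Boundary f x) : Boundary f y where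
  vertex k := (liftTower hf γ w k).1 1
  vertex_zero := γ.target
  mem k := (liftTower_isLift hf γ w k 1).1
  map_succ k := (liftTower_isLift hf γ w k 1).2

theorem liftTower_eq (hf : IsCoveringMap f) {x y : M} (γ : Path x y) (w : Boundary f x)
    (Γ : ℕ → C(I, M)) (h₀ : Γ 0 = γ) (hl : ∀ k, IsLift f (Γ (k + 1)) (Γ k))
    (hs : ∀ k, Γ k 0 = w.vertex k) (k : ℕ) : (liftTower hf γ w k).1 = Γ k := by
  induction k with
  | zero => exact h₀.symm
  | succ k ih =>
    refine (liftTower_isLift hf γ w k).unique hf ?_ ((liftTower hf γ w (k + 1)).2.trans (hs _).symm)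
    rw [ih]
    exact hl k

theorem S_vertex_eq (hf : IsCoveringMap f) {x y : M} (γ : Path x y) (w : Boundary f x)
    (Γ : ℕ → C(I, M)) (h₀ : Γ 0 = γ) (hl : ∀ k, IsLift f (Γ (k + 1)) (Γ k))
    (hs : ∀ k, Γ k 0 = w.vertex k) (k : ℕ) : (S hf γ w).vertex k = Γ k 1 := by
  rw [← liftTower_eq hf γ w Γ h₀ hl hs k]
  rfl

/-- The lift of `γ` by `fᵏ` as a path. -/
def liftedPath (hf : IsCoveringMap f) {x y : M} (γ : Path x y) (w : Boundary f x) (k : ℕ) :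
    Path (w.vertex k) ((S hf γ w).vertex k) :=
  ⟨(liftTower hf γ w k).1, (liftTower hf γ w k).2, rfl⟩

theorem S_refl (hf : IsCoveringMap f) {x : M} (w : Boundary f x) : S hf (Path.refl x) w = w := by
  ext k
  refine S_vertex_eq hf _ w (fun k => ContinuousMap.const I (w.vertex k)) ?_
    (fun k s => ⟨w.mem k, w.map_succ k⟩) (fun _ => rfl) k
  ext s
  exact w.vertex_zero

theorem S_trans (hf : IsCoveringMap f) {x y z : M} (γ : Path x y) (δ : Path y z)
    (w : Boundary f x) : S hf (γ.trans δ) w = S hf δ (S hf γ w) := by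
  ext k
  refine (S_vertex_eq hf _ w (fun k => ((liftedPath hf γ w k).trans
    (liftedPath hf δ (S hf γ w) k)).toContinuousMap) ?_ ?_ ?_ k).trans ?_
  · ext s
    simp only [ContinuousMap.coe_coe, Path.coe_toContinuousMap, Path.trans_apply]
    rfl
  · intro k s
    have h₁ := liftTower_isLift hf γ w k
    have h₂ := liftTower_isLift hf δ (S hf γ w) k
    simp only [Path.coe_toContinuousMap, Path.trans_apply]
    split_ifs
    · exact h₁ _
    · exact h₂ _
  · intro k
    simp
  · simp

theorem S_symm (hf : IsCoveringMap f) {x y : M} (γ : Path x y) (w : Boundary f y) :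
    S hf γ (S hf γ.symm w) = w := by
  ext k
  refine (S_vertex_eq hf _ _ (fun k => (liftedPath hf γ.symm w k).symm.toContinuousMap)
    ?_ ?_ ?_ k).trans ?_
  · ext s
    change γ.symm (σ s) = γ s
    simp
  · intro k s
    exact liftTower_isLift hf γ.symm w k (σ s)
  · intro k
    simp
  · simp

/-- Near `w`, namely on the set of all `w'` passing through the vertex `v = wₙ` of level `n`,
the map `g` coincides with `S_γ : ∂T_v → ∂T_u` for a path `γ` from `v` to the
vertex `u` of level `m` on `g w`. -/
def IsLocallyS (hf : IsCoveringMap f) {t : M} (g : Boundary f t → Boundary f t)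
    (w : Boundary f t) (n m : ℕ) : Prop :=
  ∃ γ : Path (w.vertex n) ((g w).vertex m), ∀ (w' : Boundary f t)
    (h : w'.vertex n = w.vertex n),
    ∀ k, (g w').vertex (m + k) = (S hf γ (w'.tail n h)).vertex k

theorem IsLocallyS.succ {hf : IsCoveringMap f} {t : M} {g : Boundary f t → Boundary f t}
    {w : Boundary f t} {n m : ℕ} (h : IsLocallyS hf g w n m) :
    IsLocallyS hf g w (n + 1) (m + 1) := by
  obtain ⟨γ, hγ⟩ := h
  refine ⟨(liftedPath hf γ (w.tail n rfl) 1).cast rfl (hγ w rfl 1), fun w' h k => ?_⟩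
  have h' := Boundary.vertex_eq_of_succ h
  refine Eq.trans ?_ (S_vertex_eq hf _ (w'.tail (n + 1) h)
    (fun k => (liftTower hf γ (w'.tail n h') (k + 1)).1) ?_
    (fun k => liftTower_isLift hf γ _ _) (fun k => ?_) k).symm
  · rw [Nat.add_assoc, Nat.add_comm 1 k]
    exact hγ w' h' (k + 1)
  · refine (liftTower_isLift hf γ (w'.tail n h') 0).unique hf
      (liftTower_isLift hf γ (w.tail n rfl) 0) ?_
    exact (liftTower hf γ (w'.tail n h') 1).2.trans
      (h.trans (liftTower hf γ (w.tail n rfl) 1).2.symm)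
  · refine (liftTower hf γ (w'.tail n h') (k + 1)).2.trans ?_
    change w'.vertex (n + (k + 1)) = w'.vertex (n + 1 + k)
    congr 1
    omega

theorem IsLocallyS.add {hf : IsCoveringMap f} {t : M} {g : Boundary f t → Boundary f t}
    {w : Boundary f t} {n m : ℕ} (h : IsLocallyS hf g w n m) (a : ℕ) :
    IsLocallyS hf g w (n + a) (m + a) := by
  induction a with
  | zero => exact h
  | succ a ih => exact ih.succ

/-- The group `V_f`: all homeomorphisms `∂T_t → ∂T_t` that are locally equal to
homeomorphisms of the form `S_γ : ∂T_v → ∂T_u`, where `v, u` are vertices of `T_t`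
and `γ` is a path in `M` from `v` to `u`. -/
def Vgroup (hf : IsCoveringMap f) (t : M) : Subgroup (Boundary f t ≃ₜ Boundary f t) where
  carrier := {g | ∀ w, ∃ n m, IsLocallyS hf g w n m}
  one_mem' w := ⟨0, 0, Path.refl _, fun w' h k => by
    refine Eq.trans ?_ (congrArg (fun z => z.vertex k) (S_refl hf (w'.tail 0 h))).symm
    rfl⟩
  mul_mem' {g h} hg hh w := by
    obtain ⟨n, m, h₁⟩ := hh w
    obtain ⟨n', m', h₂⟩ := hg (h w)
    obtain ⟨γ, hγ⟩ := h₁.add n'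
    have h₃ := h₂.add m
    rw [Nat.add_comm n' m] at h₃
    obtain ⟨δ, hδ⟩ := h₃
    refine ⟨n + n', m' + m, γ.trans δ, fun w' hw k => ?_⟩
    have h₄ : (h w').vertex (m + n') = (h w).vertex (m + n') :=
      (hγ w' hw 0).trans (S hf γ _).vertex_zero
    refine (hδ (h w') h₄ k).trans ?_
    refine Eq.trans ?_ (congrArg (fun z => z.vertex k) (S_trans hf γ δ (w'.tail _ hw))).symm
    congr 2
    ext i
    exact hγ w' hw i
  inv_mem' {g} hg w := by
    obtain ⟨n, m, γ, hγ⟩ := hg (g.symm w)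
    have e : g (g.symm w) = w := g.apply_symm_apply w
    refine ⟨m, n, γ.symm.cast (by rw [e]) rfl, fun w' hw k => ?_⟩
    have hw' : w'.vertex m = (g (g.symm w)).vertex m := by rw [e, hw]
    let z : Boundary f ((g.symm w).vertex n) := S hf γ.symm (w'.tail m hw')
    have hz : g ((g.symm w).glue n z) = w' := by
      refine Boundary.ext_of_tail m fun i => ?_
      have h₁ : ((g.symm w).glue n z).vertex n = (g.symm w).vertex n :=
        ((g.symm w).glue_vertex n z 0).trans z.vertex_zero
      refine (hγ _ h₁ i).trans ?_
      have h₂ : ((g.symm w).glue n z).tail n h₁ = z :=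
        Boundary.ext (funext fun j => (g.symm w).glue_vertex n z j)
      rw [h₂, S_symm]
      rfl
    have hz' : g⁻¹ w' = (g.symm w).glue n z := by
      rw [← hz]
      exact g.symm_apply_apply _
    rw [hz']
    refine ((g.symm w).glue_vertex n z k).trans ?_
    refine (S_vertex_eq hf _ _ (fun k => (liftTower hf γ.symm (w'.tail m hw') k).1) ?_
      (fun k => liftTower_isLift hf _ _ _) (fun k => ?_) k).symm
    · rfl
    · exact (liftTower hf γ.symm (w'.tail m hw') k).2

end Dynamics

section Homology

open CategoryTheory CategoryTheory.Limits AlgebraicTopology Simplicial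

/-- The integers, as a coefficient group in the universe `u`. -/
abbrev integers : AddCommGrpCat.{u} := AddCommGrpCat.of (ULift.{u} ℤ)

/-- The singular chain complex with integer coefficients; it is
`((singularChainComplexFunctor AddCommGrpCat).obj integers).obj X` unfolded. -/
abbrev singularChains (X : TopCat.{u}) : ChainComplex AddCommGrpCat.{u} ℕ :=
  (TopCat.toSSet.obj X).chainComplex integers.{u}

/-- First integral singular homology. -/
abbrev H1 (X : TopCat.{u}) : AddCommGrpCat.{u} :=
  ((singularHomologyFunctor AddCommGrpCat.{u} 1).obj integers.{u}).obj X

/-- The homomorphism induced on `H₁` by a continuous map. -/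
abbrev H1map {X Y : TopCat.{u}} (g : X ⟶ Y) : H1 X ⟶ H1 Y :=
  ((singularHomologyFunctor AddCommGrpCat.{u} 1).obj integers.{u}).map g

instance simplex_simplyConnected (n : ℕ) :
    SimplyConnectedSpace (SimplexCategory.toTop.{u}.obj ⦋n⦌) := by
  have h : ContractibleSpace (stdSimplex ℝ (Fin (n + 1))) :=
    (convex_stdSimplex ℝ (Fin (n + 1))).contractibleSpace ⟨_, (stdSimplex.vertex 0).2⟩
  have : ContractibleSpace (ULift.{u} (stdSimplex ℝ (Fin (n + 1)))) :=
    Homeomorph.ulift.contractibleSpace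
  exact inferInstanceAs (SimplyConnectedSpace (ULift.{u} (stdSimplex ℝ (Fin (n + 1)))))

instance simplex_locallyPathConnected (n : ℕ) :
    LocallyPathConnectedSpace (SimplexCategory.toTop.{u}.obj ⦋n⦌) := by
  have h : LocallyPathConnectedSpace (stdSimplex ℝ (Fin (n + 1))) :=
    (convex_stdSimplex ℝ (Fin (n + 1))).locallyPathConnectedSpace
  have : LocallyPathConnectedSpace (ULift.{u} (stdSimplex ℝ (Fin (n + 1)))) :=
    Homeomorph.ulift.symm.isQuotientMap.locallyPathConnectedSpace
  exact this

variable {E X : TopCat.{u}} (p : E ⟶ X)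

/-- A singular simplex as a map from the topological standard simplex. -/
def simplexMap {Y : TopCat.{u}} {n : ℕ} (s : TopCat.toSSet.obj Y _⦋n⦌) :
    SimplexCategory.toTop.{u}.obj ⦋n⦌ ⟶ Y := s.down

/-- The lifts of a singular simplex `s` of `X` along `p : E ⟶ X`. -/
abbrev SimplexLift {n : ℕ} (s : TopCat.toSSet.obj X _⦋n⦌) : Type u :=
  {s' : TopCat.toSSet.obj E _⦋n⦌ // (TopCat.toSSet.map p).app _ s' = s}

variable {p} in
theorem existsUnique_simplexLift (hp : IsCoveringMap p) {n : ℕ} (s : TopCat.toSSet.obj X _⦋n⦌)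
    (a : SimplexCategory.toTop.{u}.obj ⦋n⦌) (e : E) (he : p e = (simplexMap s) a) :
    ∃! s' : SimplexLift p s, (simplexMap s'.1) a = e := by
  obtain ⟨F, ⟨h1, h2⟩, h3⟩ := hp.existsUnique_continuousMap_lifts (simplexMap s).hom a e he
  refine ⟨⟨⟨TopCat.ofHom F⟩, ?_⟩, h1, ?_⟩
  · apply ULift.ext
    change TopCat.ofHom F ≫ p = simplexMap s
    ext x
    exact congrFun h2 x
  · rintro ⟨⟨G⟩, rfl⟩ hG
    apply Subtype.ext
    apply ULift.ext
    have := h3 G.hom ⟨hG, rfl⟩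
    subst this
    rfl

variable {p} in
theorem finite_simplexLift (hp : IsCoveringMap p) (hfin : ∀ x, Finite (p ⁻¹' {x})) {n : ℕ}
    (s : TopCat.toSSet.obj X _⦋n⦌) : Finite (SimplexLift p s) := by
  let a : SimplexCategory.toTop.{u}.obj ⦋n⦌ := Classical.arbitrary _
  have := hfin ((simplexMap s) a)
  refine Finite.of_injective (β := p ⁻¹' {(simplexMap s) a}) (fun s' => ⟨(simplexMap s'.1) a, ?_⟩) ?_
  · obtain ⟨s', rfl⟩ := s'
    rfl
  · intro s' s'' h
    have h' : (simplexMap s'.1) a = (simplexMap s''.1) a := congrArg Subtype.val h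
    refine (existsUnique_simplexLift hp s a ((simplexMap s''.1) a) ?_).unique h' rfl
    obtain ⟨s'', rfl⟩ := s''
    rfl

variable {p} in
theorem faceLift_bijective (hp : IsCoveringMap p) {n : ℕ} (s : TopCat.toSSet.obj X _⦋n + 1⦌)
    (i : Fin (n + 2)) :
    Function.Bijective (fun s' : SimplexLift p s =>
      (⟨(TopCat.toSSet.obj E).δ i s'.1, by obtain ⟨s', rfl⟩ := s'; rfl⟩ :
        SimplexLift p ((TopCat.toSSet.obj X).δ i s))) := by
  let a : SimplexCategory.toTop.{u}.obj ⦋n⦌ := Classical.arbitrary _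
  let b : SimplexCategory.toTop.{u}.obj ⦋n + 1⦌ :=
    SimplexCategory.toTop.{u}.map (SimplexCategory.δ i) a
  constructor
  · intro s' s'' h
    have h' : (simplexMap s'.1) b = (simplexMap s''.1) b :=
      congrArg (fun t : SimplexLift p ((TopCat.toSSet.obj X).δ i s) => (simplexMap t.1) a) h
    refine (existsUnique_simplexLift hp s b ((simplexMap s''.1) b) ?_).unique h' rfl
    obtain ⟨s'', rfl⟩ := s''
    rfl
  · intro t
    have ht : p ((simplexMap t.1) a) = simplexMap ((TopCat.toSSet.obj X).δ i s) a :=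
      congrArg (fun z : TopCat.toSSet.obj X _⦋n⦌ => (simplexMap z) a) t.2
    obtain ⟨s', hs', -⟩ := existsUnique_simplexLift hp s b ((simplexMap t.1) a) ht
    exact ⟨s', (existsUnique_simplexLift hp _ a ((simplexMap t.1) a) ht).unique hs' rfl⟩

variable {p}

/-- The full preimage of a singular chain: each singular simplex is sent to
the sum of its lifts. -/
def transferX (hp : IsCoveringMap p) (hfin : ∀ x, Finite (p ⁻¹' {x})) (n : ℕ) :
    (singularChains X).X n ⟶ (singularChains E).X n :=
  Cofan.IsColimit.desc ((TopCat.toSSet.obj X).isColimitChainComplexXCofan _ n)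
    (fun s =>
      letI := @Fintype.ofFinite _ (finite_simplexLift hp hfin s)
      ∑ s' : SimplexLift p s, (TopCat.toSSet.obj E).ιChainComplex s'.1)

theorem ι_transferX (hp : IsCoveringMap p) (hfin : ∀ x, Finite (p ⁻¹' {x})) {n : ℕ}
    (s : TopCat.toSSet.obj X _⦋n⦌) [Fintype (SimplexLift p s)] :
    (TopCat.toSSet.obj X).ιChainComplex (R := integers.{u}) s ≫ transferX hp hfin n =
      ∑ s' : SimplexLift p s, (TopCat.toSSet.obj E).ιChainComplex s'.1 := by
  refine (Cofan.IsColimit.fac ((TopCat.toSSet.obj X).isColimitChainComplexXCofan _ n) _ s).trans ?_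
  have : @Fintype.ofFinite _ (finite_simplexLift hp hfin s) = ‹_› := Subsingleton.elim _ _
  rw [← this]

/-- The transfer chain map of a covering with finite fibres. -/
def transferChain (hp : IsCoveringMap p) (hfin : ∀ x, Finite (p ⁻¹' {x})) :
    singularChains X ⟶ singularChains E where
  f := transferX hp hfin
  comm' := by
    rintro _ n rfl
    apply SSet.chainComplex_hom_ext
    intro s
    have (m : ℕ) (s : TopCat.toSSet.obj X _⦋m⦌) : Finite (SimplexLift p s) :=
      finite_simplexLift hp hfin s
    have (m : ℕ) (s : TopCat.toSSet.obj X _⦋m⦌) : Fintype (SimplexLift p s) :=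
      Fintype.ofFinite _
    rw [← Category.assoc, ← Category.assoc, ι_transferX, SSet.ιChainComplex_d,
      Preadditive.sum_comp, Preadditive.sum_comp]
    simp_rw [SSet.ιChainComplex_d, Preadditive.zsmul_comp, ι_transferX]
    rw [Finset.sum_comm]
    refine Finset.sum_congr rfl fun i _ => ?_
    rw [← Finset.smul_sum]
    congr 1
    exact (faceLift_bijective hp s i).sum_comp
      (fun t : SimplexLift p ((TopCat.toSSet.obj X).δ i s) =>
        (TopCat.toSSet.obj E).ιChainComplex t.1)

/-- The transfer map `p^! : H₁(X) → H₁(E)`. -/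
def H1transfer (hp : IsCoveringMap p) (hfin : ∀ x, Finite (p ⁻¹' {x})) : H1 X ⟶ H1 E :=
  HomologicalComplex.homologyMap (transferChain hp hfin) 1

/-- The singular 1-simplex of a path. -/
def pathSimplex {x y : X} (γ : Path x y) : TopCat.toSSet.obj X _⦋1⦌ :=
  TopCat.toSSetObj₁Equiv.symm (TopCat.pathEquiv.symm γ).hom

theorem loop_d {x : X} (γ : Path x x) :
    (TopCat.toSSet.obj X).ιChainComplex (R := integers.{u}) (pathSimplex γ) ≫ (singularChains X).d 1 0 = 0 := by
  refine (SSet.ιChainComplex_d (n := 0) _ _ _).trans ?_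
  rw [Fin.sum_univ_two]
  simp [pathSimplex]

/-- The class in `H₁(X)` of a loop. -/
def loopClass {x : X} (γ : Path x x) : H1 X :=
  ((singularChains X).liftCycles ((TopCat.toSSet.obj X).ιChainComplex (pathSimplex γ)) 0
    (by simp) (loop_d γ) ≫ (singularChains X).homologyπ 1) ⟨1⟩

/-- The parity of the monodromy action of a loop on the fibre: `0` for even permutations and
`1` for odd ones. -/
def monodromyParity (hp : IsCoveringMap p) (hfin : ∀ x, Finite (p ⁻¹' {x})) {x : X}
    (γ : Path x x) : ZMod 2 :=
  letI := Classical.decEq (p ⁻¹' {x})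
  letI := @Fintype.ofFinite _ (hfin x)
  if Equiv.Perm.sign (hp.monodromyPerm x
    (FundamentalGroup.fromPath (Path.Homotopic.Quotient.mk γ))) = 1 then 0 else 1

/-- `sign : H₁(X) → ℤ/2` is the homomorphism that sends the class of each loop to the parity of
its monodromy action on the fibre. -/
def IsMonodromySign (hp : IsCoveringMap p) (hfin : ∀ x, Finite (p ⁻¹' {x}))
    (sign : H1 X →+ ZMod 2) : Prop :=
  ∀ (x : X) (γ : Path x x), sign (loopClass γ) = monodromyParity hp hfin γ

end Homology

section PartialSelfCovering

open CategoryTheory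

variable {M : Type u} [TopologicalSpace M] {M₁ : Set M} {f : M₁ → M} {d : ℕ}

/-- A partial self-covering as a morphism of topological spaces. -/
def IsPartialSelfCovering.hom (hf : IsPartialSelfCovering f d) : TopCat.of M₁ ⟶ TopCat.of M :=
  TopCat.ofHom ⟨f, hf.isCoveringMap.continuous⟩

/-- The embedding `ι : M₁ → M`. -/
def inclusion (M₁ : Set M) : TopCat.of M₁ ⟶ TopCat.of M :=
  TopCat.ofHom ⟨Subtype.val, continuous_subtype_val⟩

/-- The endomorphism `ι_* ∘ f^!` of `H₁(M)`. -/
def sigma (hf : IsPartialSelfCovering f d) : H1 (TopCat.of M) →+ H1 (TopCat.of M) :=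
  (H1map (inclusion M₁)).hom.comp
    (H1transfer (p := hf.hom) hf.isCoveringMap hf.finite_fiber).hom

/-- The endomorphism `σ₁(t, c) = (t + sign c, ι_* f^! c)` of `ℤ/2 ⊕ H₁(M)`. -/
def sigma₁ (hf : IsPartialSelfCovering f d) (sign : H1 (TopCat.of M) →+ ZMod 2) :
    ZMod 2 × H1 (TopCat.of M) →+ ZMod 2 × H1 (TopCat.of M) :=
  (AddMonoidHom.fst _ _ + sign.comp (AddMonoidHom.snd _ _)).prod
    ((sigma hf).comp (AddMonoidHom.snd _ _))

end PartialSelfCovering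

end ExpandingMaps

end

/-!
The fundamental group `G = π₁(M, t)` acts on the boundary `∂T_t` of the tree of preimages. The fibre
of `f` over `t` divides `∂T_t` into `d` pieces, and connecting paths from `t` to the points of the
fibre identify each piece with `∂T_t`. With respect to this subdivision the action is self-similar
(`selfSimilar`): a loop permutes the pieces by its monodromy, and acts on each of them by a loop, its
section. Pieces of higher level are indexed by words in `d` letters, and `V_f` consists of the
bijections that map the cylinders of some level to cylinders by elements of `G`
(`nonempty_Vgroup_equiv`; compactness gives a common level).

For every self-similar action the abelianization of such a group `V` can be computed by hand. Let
`A` be an abelian group, `c : G → A` a homomorphism and `τ ∈ A` an element with `τ² = 1`, `τ^d = τ`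
such that `c g` is the product of the values of `c` at the sections of `g`, times `τ` if `g`
permutes the pieces oddly (`SelfSimilar.Cocycle`). For `h ∈ V` choose a partition into cylinders on
each of which `h` acts by an element of `G`; multiply the values of `c` at these elements by one
factor `τ` for each pair of cylinders whose lexicographic order is reversed. Subdividing a cylinder
does not change the result, by the condition on `c`, and so this defines a homomorphism `V → A`,
as soon as `c` vanishes on the elements of `G` acting trivially (`Cocycle.hom`).
Conversely `V` is generated by swaps of disjoint cylinders and by copies of elements of `G` acting
on one cylinder. All swaps of cylinders are equal in the abelianization of `V`, and so are all
copies of a given `g`; their classes form a cocycle with values in the abelianization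
(`cocycleOf`). Therefore the abelianization of `V` is the universal recipient of a cocycle
(`Cocycle.nonempty_abelianization_equiv`). If `d` is even then `τ² = 1` and `τ^d = τ` give `τ = 1`,
and if `d` is odd then the second condition follows from the first.

Homomorphisms from `π₁(M, t)` to abelian groups are homomorphisms from `H₁(M)`: the inverse of the
Hurewicz homomorphism is constructed on singular 1-chains modulo boundaries
(`exists_comp_loopHom`, `loopHom_surjective`). The transfer of the class of a loop is the sum of
its lifts, hence `ι_* ∘ f^!` maps the class of a loop to the sum of the classes of its sections
(`sigma_loopClass`), and cocycles are the same as homomorphisms `q` on `H₁(M)` together with `τ`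
such that `q c = q (ι_* f^! c) + sign(c) τ`. The universal such pair is the quotient of the theorem.

It remains to see that `q` vanishes on the loops that act trivially on `∂T_t`. This is where the
expansion enters: the lifts of a loop by `fⁿ` are arbitrarily small for large `n`, so those of them
that are loops are null-homotopic (`exists_forall_tower_homotopic_refl`). If the loop
acts trivially then all of its lifts are loops, its monodromy is trivial, and its class is mapped by
`q` to the sum of the images of the classes of its lifts; by induction all of these are zero
(`IsTransferInvariant.map_eq_one`).
-/

noncomputable section

namespace ExpandingMaps

/-! ### Self-similar actions -/

/-- A self-similar action: a group `G` acting on a set `Ω` that is identified with `d` copies of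
itself, such that every `g` permutes the copies and acts on each of them through the action of a
further element `sec g x` of `G`. The empty word, one-letter words, … address the copies,
the copies of copies, …; for the boundary of a rooted tree they address the cylinder sets. -/
structure SelfSimilar (d : ℕ) (G Ω : Type*) [Group G] [MulAction G Ω] where
  /-- The identification of `Ω` with `d` copies of itself. -/
  e : Fin d × Ω ≃ Ω
  /-- The permutation of the copies. -/
  perm : G → Equiv.Perm (Fin d)
  /-- The section of `g` at a letter. -/
  sec : G → Fin d → G
  smul_e : ∀ g x w, g • e (x, w) = e (perm g x, sec g x • w)

/-- Two words are incomparable: neither is a prefix of the other. -/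
def Incomp {α : Type*} (u v : List α) : Prop := ¬ u <+: v ∧ ¬ v <+: u

namespace Incomp

variable {α : Type*} {u v : List α}

theorem symm (h : Incomp u v) : Incomp v u := ⟨h.2, h.1⟩

theorem ne (h : Incomp u v) : u ≠ v := fun e => h.1 (e ▸ List.prefix_rfl)

theorem append (h : Incomp u v) (s t : List α) : Incomp (u ++ s) (v ++ t) := by
  constructor
  · intro h'
    rcases List.prefix_or_prefix_of_prefix ((List.prefix_append u s).trans h')
      (List.prefix_append v t) with h'' | h''
    exacts [h.1 h'', h.2 h'']
  · intro h'
    rcases List.prefix_or_prefix_of_prefix ((List.prefix_append v t).trans h')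
      (List.prefix_append u s) with h'' | h''
    exacts [h.2 h'', h.1 h'']

theorem append_left (h : Incomp u v) (s : List α) : Incomp (u ++ s) v := by
  simpa using h.append s []

theorem append_right (h : Incomp u v) (t : List α) : Incomp u (v ++ t) := by
  simpa using h.append [] t

theorem of_ne {x y : α} (h : x ≠ y) (u : List α) : Incomp (u ++ [x]) (u ++ [y]) := by
  constructor <;> intro h' <;> simp at h' <;> simp_all

theorem of_length_eq (h : u ≠ v) (hl : u.length = v.length) : Incomp u v :=
  ⟨fun h' => h (h'.eq_of_length hl), fun h' => h (h'.eq_of_length hl.symm).symm⟩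

theorem lt_append_iff [LinearOrder α] (h : Incomp u v) (s t : List α) :
    u ++ s < v ++ t ↔ u < v := by
  induction u generalizing v with
  | nil => exact absurd List.nil_prefix h.1
  | cons x u ih =>
    cases v with
    | nil => exact absurd List.nil_prefix h.2
    | cons y v =>
      simp only [List.cons_append, List.cons_lt_cons_iff]
      refine or_congr_right (and_congr_right fun hxy => ih ?_)
      subst hxy
      exact ⟨fun h' => h.1 (by simpa using h'), fun h' => h.2 (by simpa using h')⟩

end Incomp

theorem append_singleton_lt {α : Type*} [LinearOrder α] (u : List α) (x y : α) :
    u ++ [x] < u ++ [y] ↔ x < y := by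
  induction u with
  | nil => simp [List.cons_lt_cons_iff]
  | cons a u ih => simpa [List.cons_lt_cons_iff] using ih

namespace SelfSimilar

variable {d : ℕ} {G Ω : Type*} [Group G] [MulAction G Ω] (s : SelfSimilar d G Ω)

/-- The embedding of `Ω` onto the cylinder addressed by a word. -/
def pre : List (Fin d) → Ω → Ω
  | [], w => w
  | x :: v, w => s.e (x, pre v w)

@[simp] theorem pre_nil (w : Ω) : s.pre [] w = w := rfl

@[simp] theorem pre_cons (x : Fin d) (v : List (Fin d)) (w : Ω) :
    s.pre (x :: v) w = s.e (x, s.pre v w) := rfl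

theorem pre_append (u v : List (Fin d)) (w : Ω) : s.pre (u ++ v) w = s.pre u (s.pre v w) := by
  induction u with
  | nil => rfl
  | cons x u ih => simp [ih]

theorem pre_injective (v : List (Fin d)) : Function.Injective (s.pre v) := by
  induction v with
  | nil => exact fun _ _ h => h
  | cons x v ih =>
    intro a b h
    have := s.e.injective h
    simp only [Prod.mk.injEq, true_and] at this
    exact ih this

variable {s} in
theorem comparable_of_pre_eq {u v : List (Fin d)} {a b : Ω} (h : s.pre u a = s.pre v b) :
    u <+: v ∨ v <+: u := by
  induction u generalizing v with
  | nil => exact Or.inl List.nil_prefix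
  | cons x u ih =>
    cases v with
    | nil => exact Or.inr List.nil_prefix
    | cons y v =>
      have := s.e.injective h
      simp only [Prod.mk.injEq] at this
      obtain ⟨rfl, h'⟩ := this
      simpa using ih h'

variable {s} in
theorem pre_ne {u v : List (Fin d)} (h : Incomp u v) (a b : Ω) : s.pre u a ≠ s.pre v b :=
  fun e => (comparable_of_pre_eq e).elim h.1 h.2

variable {s} in
theorem eq_of_pre_eq {u v : List (Fin d)} {a b : Ω} (h : s.pre u a = s.pre v b)
    (hl : u.length = v.length) : u = v := by
  rcases comparable_of_pre_eq h with h | h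
  exacts [h.eq_of_length hl, (h.eq_of_length hl.symm).symm]

theorem exists_pre (n : ℕ) (w : Ω) : ∃ v : List (Fin d), v.length = n ∧ ∃ a, s.pre v a = w := by
  induction n generalizing w with
  | zero => exact ⟨[], rfl, w, rfl⟩
  | succ n ih =>
    obtain ⟨⟨x, b⟩, rfl⟩ := s.e.surjective w
    obtain ⟨v, hv, a, rfl⟩ := ih b
    exact ⟨x :: v, by simp [hv], a, rfl⟩

/-- On the cylinder of `v`, the map `h` is the transport of `γ` to the cylinder of `u`. -/
def Germ (h : Equiv.Perm Ω) (v u : List (Fin d)) (γ : G) : Prop :=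
  ∀ w, h (s.pre v w) = s.pre u (γ • w)

variable {s}

namespace Germ

variable {h h' : Equiv.Perm Ω} {u v v' : List (Fin d)} {γ γ' : G}

theorem snoc (H : s.Germ h v u γ) (x : Fin d) :
    s.Germ h (v ++ [x]) (u ++ [s.perm γ x]) (s.sec γ x) := by
  intro w
  rw [pre_append, H, pre_append]
  simp [s.smul_e]

theorem append (H : s.Germ h v u γ) (t : List (Fin d)) :
    ∃ t' γ', t'.length = t.length ∧ s.Germ h (v ++ t) (u ++ t') γ' := by
  induction t using List.reverseRecOn with
  | nil => exact ⟨[], γ, rfl, by simpa using H⟩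
  | append_singleton t x ih =>
    obtain ⟨t', γ', hl, H'⟩ := ih
    refine ⟨t' ++ [s.perm γ' x], s.sec γ' x, by simp [hl], ?_⟩
    rw [← List.append_assoc, ← List.append_assoc]
    exact H'.snoc x

theorem mul (H' : s.Germ h' v v' γ') (H : s.Germ h u v γ) : s.Germ (h' * h) u v' (γ' * γ) := by
  intro w
  rw [Equiv.Perm.mul_apply, H, H', mul_smul]

theorem inv (H : s.Germ h v u γ) : s.Germ h⁻¹ u v γ⁻¹ := by
  intro w
  rw [Equiv.Perm.inv_eq_iff_eq, H, smul_inv_smul]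

theorem one (v : List (Fin d)) : s.Germ 1 v v 1 := fun w => by simp

end Germ

variable (s) in
/-- The group of the permutations of `Ω` that are, on all cylinders of some level, given by
elements of `G`. -/
def V : Subgroup (Equiv.Perm Ω) where
  carrier := {h | ∃ n, ∀ v : List (Fin d), v.length = n → ∃ u γ, s.Germ h v u γ}
  one_mem' := ⟨0, fun v _ => ⟨v, 1, Germ.one v⟩⟩
  mul_mem' {a b} := by
    rintro ⟨m, ha⟩ ⟨n, hb⟩
    refine ⟨n + m, fun v hv => ?_⟩
    obtain ⟨u, γ, H⟩ := hb (v.take n) (by simp [hv])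
    obtain ⟨t, γ', ht, H'⟩ := H.append (v.drop n)
    rw [List.take_append_drop] at H'
    have hl : m ≤ (u ++ t).length := by simp [ht, hv]
    obtain ⟨u', δ, K⟩ := ha ((u ++ t).take m) (by simpa using hl)
    obtain ⟨t', δ', -, K'⟩ := K.append ((u ++ t).drop m)
    rw [List.take_append_drop] at K'
    exact ⟨_, _, K'.mul H'⟩
  inv_mem' {h} := by
    rintro ⟨n, hh⟩
    choose! u γ H using hh
    obtain ⟨N, hN⟩ : ∃ N, ∀ v : List (Fin d), v.length = n → (u v).length ≤ N := by
      obtain ⟨N, hN⟩ := ((List.finite_length_eq (Fin d) n).image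
        (fun v => (u v).length)).bddAbove
      exact ⟨N, fun v hv => hN ⟨v, hv, rfl⟩⟩
    refine ⟨N, fun v hv => ?_⟩
    rcases isEmpty_or_nonempty Ω with hΩ | ⟨⟨w⟩⟩
    · exact ⟨[], 1, fun w => isEmptyElim w⟩
    obtain ⟨v', hv', a, ha⟩ := s.exists_pre n (h⁻¹ (s.pre v w))
    have h₁ : s.pre (u v') (γ v' • a) = s.pre v w := by
      rw [← H v' hv', ha]
      exact h.apply_symm_apply _
    have h₂ : u v' <+: v := by
      rcases comparable_of_pre_eq h₁ with h₂ | h₂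
      · exact h₂
      · exact (h₂.eq_of_length_le (by have := hN v' hv'; omega)) ▸ List.prefix_rfl
    obtain ⟨t, rfl⟩ := h₂
    obtain ⟨t', γ', -, K⟩ := (H v' hv').inv.append t
    exact ⟨_, _, K⟩

theorem exists_germ_of_le {h : Equiv.Perm Ω} {n : ℕ}
    (H : ∀ v : List (Fin d), v.length = n → ∃ u γ, s.Germ h v u γ) {v : List (Fin d)}
    (hv : n ≤ v.length) : ∃ u γ, s.Germ h v u γ := by
  obtain ⟨u, γ, K⟩ := H (v.take n) (by simpa using hv)
  obtain ⟨t, γ', -, K'⟩ := K.append (v.drop n)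
  rw [List.take_append_drop] at K'
  exact ⟨_, _, K'⟩

/-- A bijection carries disjoint cylinders to disjoint cylinders. -/
theorem Germ.incomp [Nonempty Ω] {h : Equiv.Perm Ω} {v v' u u' : List (Fin d)} {γ γ' : G}
    (H : s.Germ h v u γ) (H' : s.Germ h v' u' γ') (hv : Incomp v v') : Incomp u u' := by
  have key : ∀ {v v' u u' : List (Fin d)} {γ γ' : G}, s.Germ h v u γ → s.Germ h v' u' γ' →
      Incomp v v' → ¬ u <+: u' := by
    rintro v v' u _ γ γ' H H' hv ⟨t, rfl⟩
    let w : Ω := Classical.arbitrary Ω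
    refine pre_ne (s := s) hv (γ⁻¹ • s.pre t (γ' • w)) w (h.injective ?_)
    rw [H, H', smul_inv_smul, pre_append]
  exact ⟨key H H' hv, key H' H hv.symm⟩

/-- A germ determines its target cylinder, and its group element up to the kernel of the
action. -/
theorem Germ.unique [Nonempty Ω] (hd : 2 ≤ d) {h : Equiv.Perm Ω} {v u u' : List (Fin d)}
    {γ γ' : G} (H : s.Germ h v u γ) (H' : s.Germ h v u' γ') :
    u = u' ∧ ∀ w : Ω, γ • w = γ' • w := by
  have key : ∀ {u u' : List (Fin d)} {γ γ' : G}, s.Germ h v u γ → s.Germ h v u' γ' →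
      u <+: u' → u = u' := by
    rintro u _ γ γ' H H' ⟨t, rfl⟩
    cases t with
    | nil => simp
    | cons x t =>
      exfalso
      have : Nontrivial (Fin d) := Fin.nontrivial_iff_two_le.2 hd
      obtain ⟨y, hy⟩ := exists_ne x
      let w : Ω := Classical.arbitrary Ω
      have h₁ := (H (γ⁻¹ • s.pre [y] w)).symm.trans (H' _)
      rw [smul_inv_smul, pre_append] at h₁
      have h₂ := s.e.injective (s.pre_injective u h₁)
      simp only [Prod.mk.injEq] at h₂
      exact hy h₂.1
  have hu : u = u' := by
    let w : Ω := Classical.arbitrary Ω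
    rcases comparable_of_pre_eq (s := s) ((H w).symm.trans (H' w)) with h₁ | h₁
    exacts [key H H' h₁, (key H' H h₁).symm]
  subst hu
  exact ⟨rfl, fun w => s.pre_injective u ((H w).symm.trans (H' w))⟩

end SelfSimilar

/-! ### Products over unordered pairs, and signs -/

section Pairs

variable {α β A : Type*} [LinearOrder α] [LinearOrder β] [CommGroup A]

/-- The product of `j v v'` over the pairs `v < v'` of elements of `P`. -/
def pairProd (P : Finset α) (j : α → α → A) : A :=
  ∏ v ∈ P, ∏ v' ∈ P, if v < v' then j v v' else 1

theorem pairProd_insert [DecidableEq α] {P : Finset α} {a : α} (ha : a ∉ P) {j : α → α → A}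
    (hj : ∀ v ∈ P, j v a = j a v) :
    pairProd (insert a P) j = pairProd P j * ∏ v ∈ P, j a v := by
  unfold pairProd
  rw [Finset.prod_insert ha, Finset.prod_insert ha]
  simp only [lt_irrefl, if_false, one_mul]
  rw [Finset.prod_congr rfl fun v _ => Finset.prod_insert ha, Finset.prod_mul_distrib,
    ← mul_assoc, ← Finset.prod_mul_distrib, mul_comm]
  congr 1
  refine Finset.prod_congr rfl fun v hv => ?_
  have hne : a ≠ v := fun e => ha (e ▸ hv)
  rcases lt_or_gt_of_ne hne with h | h
  · rw [if_pos h, if_neg h.not_gt, mul_one]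
  · rw [if_pos h, if_neg h.not_gt, one_mul, hj v hv]

theorem pairProd_congr {P : Finset α} {j j' : α → α → A}
    (h : ∀ v ∈ P, ∀ v' ∈ P, v ≠ v' → j v v' = j' v v') : pairProd P j = pairProd P j' := by
  refine Finset.prod_congr rfl fun v hv => Finset.prod_congr rfl fun v' hv' => ?_
  split_ifs with hlt
  · exact h v hv v' hv' hlt.ne
  · rfl

theorem pairProd_mul (P : Finset α) (j j' : α → α → A) :
    pairProd P (fun v v' => j v v' * j' v v') = pairProd P j * pairProd P j' := by
  simp only [pairProd, ← Finset.prod_mul_distrib]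
  refine Finset.prod_congr rfl fun v hv => Finset.prod_congr rfl fun v' hv' => ?_
  split_ifs <;> simp

theorem pairProd_union [DecidableEq α] {P Q : Finset α} (hPQ : Disjoint P Q) {j : α → α → A}
    (hj : ∀ v v', v ≠ v' → j v v' = j v' v) :
    pairProd (P ∪ Q) j = pairProd P j * pairProd Q j * ∏ v ∈ P, ∏ v' ∈ Q, j v v' := by
  induction Q using Finset.induction_on with
  | empty => simp [pairProd]
  | insert a Q ha ih =>
    rw [Finset.disjoint_insert_right] at hPQ
    rw [Finset.union_insert, pairProd_insert (by simp [hPQ.1, ha])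
        (fun v hv => hj v a fun e => by subst e; simp [hPQ.1, ha] at hv), ih hPQ.2,
      pairProd_insert ha (fun v hv => hj v a fun e => ha (e ▸ hv)),
      Finset.prod_union hPQ.2, Finset.prod_congr rfl fun v _ => Finset.prod_insert ha,
      Finset.prod_mul_distrib,
      Finset.prod_congr rfl fun v hv => hj a v fun e => hPQ.1 (e ▸ hv)]
    simp only [mul_assoc, mul_left_comm, mul_comm]

/-- A product over unordered pairs can be computed in any order of the index set. -/
theorem pairProd_image [DecidableEq α] [DecidableEq β] {P : Finset α} {U : α → β}
    (hU : Set.InjOn U P) {j : β → β → A} (hj : ∀ v v', v ≠ v' → j v v' = j v' v) :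
    pairProd (P.image U) j = pairProd P fun v v' => j (U v) (U v') := by
  induction P using Finset.induction_on with
  | empty => simp [pairProd]
  | insert a P ha ih =>
    have hU' : Set.InjOn U P := hU.mono (by simp)
    have hne : ∀ v ∈ P, U v ≠ U a := fun v hv e =>
      ha (hU (by simp [hv]) (by simp) e ▸ hv)
    rw [Finset.image_insert, pairProd_insert (by simpa using hne)
        (fun v hv => hj v _ fun e => by
          obtain ⟨v', hv', rfl⟩ := Finset.mem_image.1 hv
          exact hne v' hv' e), ih hU',
      pairProd_insert ha fun v hv => hj _ _ (hne v hv), Finset.prod_image hU']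

/-- The image of the sign of a permutation under the homomorphism `-1 ↦ τ`, for an element `τ`
with `τ² = 1`. -/
def sgn {X : Type*} [Fintype X] [DecidableEq X] (τ : A) (π : Equiv.Perm X) : A :=
  if Equiv.Perm.sign π = 1 then 1 else τ

/-- The sign of a permutation is the parity of the number of its inversions. -/
theorem sgn_eq_pairProd {d : ℕ} {τ : A} (hτ : τ * τ = 1) (π : Equiv.Perm (Fin d)) :
    sgn τ π = pairProd Finset.univ fun x y => if π x < π y then 1 else τ := by
  let φ : ℤˣ →* A :=
    { toFun := fun u => if u = 1 then 1 else τ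
      map_one' := by simp
      map_mul' := fun u v => by
        rcases Int.units_eq_one_or u with rfl | rfl <;>
          rcases Int.units_eq_one_or v with rfl | rfl <;> simp [hτ] }
  change φ (Equiv.Perm.sign π) = _
  rw [Equiv.Perm.sign_eq_prod_prod_Ioi, map_prod]
  unfold pairProd
  refine Finset.prod_congr rfl fun x _ => ?_
  rw [map_prod, ← Finset.prod_filter]
  refine Finset.prod_congr (by ext; simp) fun y _ => ?_
  rw [apply_ite φ, map_one]
  simp [φ]

end Pairs

namespace SelfSimilar

variable {d : ℕ} {G Ω : Type*} [Group G] [MulAction G Ω] {s : SelfSimilar d G Ω}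

variable (s) in
/-- A homomorphism `c` from `G` to an abelian group together with an element `τ` of order at most
two that are compatible with the subdivision of `Ω` into `d` copies: `c g` is the product of the
values of `c` on the sections of `g`, times `τ` if `g` permutes the copies oddly. -/
structure Cocycle (A : Type*) [CommGroup A] where
  /-- The homomorphism. -/
  c : G →* A
  /-- The value of an odd permutation. -/
  τ : A
  τ_mul : τ * τ = 1
  τ_pow : τ ^ d = τ
  c_eq : ∀ g, c g = (∏ x, c (s.sec g x)) * sgn τ (s.perm g)

/-- The cocycle takes the same value on all elements of `G` acting in the same way. -/
def Cocycle.IsFaithful {A : Type*} [CommGroup A] (C : s.Cocycle A) : Prop :=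
  ∀ g : G, (∀ w : Ω, g • w = w) → C.c g = 1

/-- The word `u` such that `h` maps the cylinder of `v` to that of `u` by an element of `G`. -/
def target (s : SelfSimilar d G Ω) (h : Equiv.Perm Ω) (v : List (Fin d)) : List (Fin d) :=
  open Classical in if H : ∃ u γ, s.Germ h v u γ then H.choose else []

/-- The value of a cocycle on the germ of `h` on the cylinder of `v`. -/
def Cocycle.germVal {A : Type*} [CommGroup A] (C : s.Cocycle A) (h : Equiv.Perm Ω)
    (v : List (Fin d)) : A :=
  open Classical in if H : ∃ u γ, s.Germ h v u γ then C.c H.choose_spec.choose else 1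

/-- `τ` if `h` reverses the lexicographic order of the cylinders of `v` and `v'`, and `1`
otherwise. -/
def Cocycle.inversion {A : Type*} [CommGroup A] (C : s.Cocycle A) (h : Equiv.Perm Ω)
    (v v' : List (Fin d)) : A :=
  if v < v' ↔ s.target h v < s.target h v' then 1 else C.τ

theorem Cocycle.inversion_pow {A : Type*} [CommGroup A] {C : s.Cocycle A}
    (h : Equiv.Perm Ω) (v v' : List (Fin d)) :
    C.inversion h v v' ^ d = C.inversion h v v' := by
  unfold inversion
  split_ifs
  · exact one_pow d
  · exact C.τ_pow

/-- The value of a cocycle on the bijection `h`, computed with a partition `P` into cylinders: the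
product of its values on the germs of `h`, times `τ` to the number of pairs of cylinders whose
lexicographic order is reversed by `h`. -/
def Cocycle.total {A : Type*} [CommGroup A] (C : s.Cocycle A) (h : Equiv.Perm Ω)
    (P : Finset (List (Fin d))) : A :=
  (∏ v ∈ P, C.germVal h v) * pairProd P (C.inversion h)

/-- The cylinders of the words in `P` are disjoint and cover `Ω`. -/
structure IsPartition (s : SelfSimilar d G Ω) (P : Finset (List (Fin d))) : Prop where
  incomp : ∀ u ∈ P, ∀ v ∈ P, u ≠ v → Incomp u v
  cover : ∀ w, ∃ v ∈ P, ∃ a, s.pre v a = w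

variable [Nonempty Ω]

theorem Germ.target_eq (hd : 2 ≤ d) {h : Equiv.Perm Ω} {v u : List (Fin d)} {γ : G}
    (H : s.Germ h v u γ) : s.target h v = u := by
  classical
  have H' : ∃ u γ, s.Germ h v u γ := ⟨u, γ, H⟩
  rw [target, dif_pos H']
  exact (H'.choose_spec.choose_spec.unique hd H).1

variable {A : Type*} [CommGroup A] {C : s.Cocycle A}

theorem Germ.germVal_eq (hd : 2 ≤ d) (hC : C.IsFaithful) {h : Equiv.Perm Ω}
    {v u : List (Fin d)} {γ : G} (H : s.Germ h v u γ) : C.germVal h v = C.c γ := by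
  classical
  have H' : ∃ u γ, s.Germ h v u γ := ⟨u, γ, H⟩
  rw [Cocycle.germVal, dif_pos H']
  have h₁ := (H'.choose_spec.choose_spec.unique hd H).2
  have h₂ := hC (γ⁻¹ * H'.choose_spec.choose) fun w => by rw [mul_smul, h₁, inv_smul_smul]
  rw [map_mul, map_inv, inv_mul_eq_one] at h₂
  exact h₂.symm

namespace Cocycle

theorem germVal_mul (hd : 2 ≤ d) (hC : C.IsFaithful) {h h' : Equiv.Perm Ω}
    {u v v' : List (Fin d)} {γ γ' : G} (H' : s.Germ h' v v' γ') (H : s.Germ h u v γ) :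
    C.germVal (h' * h) u = C.germVal h' v * C.germVal h u := by
  rw [H.germVal_eq hd hC, H'.germVal_eq hd hC, (H'.mul H).germVal_eq hd hC, map_mul]

theorem inversion_symm (hd : 2 ≤ d) {h : Equiv.Perm Ω} {v v' u u' : List (Fin d)} {γ γ' : G}
    (H : s.Germ h v u γ) (H' : s.Germ h v' u' γ') (hv : Incomp v v') :
    C.inversion h v v' = C.inversion h v' v := by
  have hu := (H.incomp H' hv).ne
  have hv := hv.ne
  unfold inversion
  rw [H.target_eq hd, H'.target_eq hd]
  congr 1
  rw [← not_iff_not (a := v < v'), not_lt, not_lt, hv.symm.le_iff_lt, hu.symm.le_iff_lt]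

theorem inversion_mul (hd : 2 ≤ d) {h h' : Equiv.Perm Ω} {u₁ v₁ w₁ u₂ v₂ w₂ : List (Fin d)}
    {γ₁ γ₁' γ₂ γ₂' : G} (H₁ : s.Germ h u₁ v₁ γ₁) (H₁' : s.Germ h' v₁ w₁ γ₁')
    (H₂ : s.Germ h u₂ v₂ γ₂) (H₂' : s.Germ h' v₂ w₂ γ₂') :
    C.inversion (h' * h) u₁ u₂ = C.inversion h' v₁ v₂ * C.inversion h u₁ u₂ := by
  unfold inversion
  rw [(H₁'.mul H₁).target_eq hd, (H₂'.mul H₂).target_eq hd, H₁.target_eq hd, H₂.target_eq hd,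
    H₁'.target_eq hd, H₂'.target_eq hd]
  have := C.τ_mul
  by_cases h₁ : u₁ < u₂ <;> by_cases h₂ : v₁ < v₂ <;> by_cases h₃ : w₁ < w₂ <;>
    simp [h₁, h₂, h₃, this]

theorem inversion_append (hd : 2 ≤ d) {h : Equiv.Perm Ω} {v v' u u' : List (Fin d)} {γ γ' : G}
    (H : s.Germ h v u γ) (H' : s.Germ h v' u' γ') (hv : Incomp v v') (x : Fin d) :
    C.inversion h v (v' ++ [x]) = C.inversion h v v' := by
  unfold inversion
  rw [H.target_eq hd, H'.target_eq hd, (H'.snoc x).target_eq hd]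
  have h₁ := hv.lt_append_iff [] [x]
  have h₂ := (H.incomp H' hv).lt_append_iff [] [s.perm γ' x]
  rw [List.append_nil] at h₁ h₂
  simp only [h₁, h₂]

/-- Subdividing one cylinder of a partition does not change the total value of a cocycle. -/
theorem total_refine (hd : 2 ≤ d) (hC : C.IsFaithful) {h : Equiv.Perm Ω}
    {Q : Finset (List (Fin d))} {a : List (Fin d)} (ha : a ∉ Q)
    (hQ : ∀ u ∈ insert a Q, ∀ v ∈ insert a Q, u ≠ v → Incomp u v)
    (hgood : ∀ v ∈ insert a Q, ∃ u γ, s.Germ h v u γ) :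
    C.total h (Q ∪ Finset.univ.image fun x => a ++ [x]) = C.total h (insert a Q) := by
  obtain ⟨u, γ, H⟩ := hgood a (by simp)
  have hinc : ∀ v ∈ Q, Incomp a v := fun v hv =>
    hQ a (by simp) v (by simp [hv]) fun e => ha (e ▸ hv)
  have hinj : Function.Injective fun x : Fin d => a ++ [x] := fun x y hxy => by simpa using hxy
  have hdisj : Disjoint Q (Finset.univ.image fun x : Fin d => a ++ [x]) := by
    rw [Finset.disjoint_left]
    intro v hv hv'
    obtain ⟨x, -, rfl⟩ := Finset.mem_image.1 hv'
    exact (hinc _ hv).1 (List.prefix_append a [x])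
  -- the inversions are symmetric only between cylinders on which `h` has a germ
  let j : List (Fin d) → List (Fin d) → A := fun v v' =>
    if v < v' then C.inversion h v v' else C.inversion h v' v
  have hjs : ∀ v v', v ≠ v' → j v v' = j v' v := by
    intro v v' hne
    rcases lt_or_gt_of_ne hne with hlt | hlt <;> simp [j, hlt, hlt.not_gt]
  have hpj : ∀ P, pairProd P (C.inversion h) = pairProd P j := by
    intro P
    refine Finset.prod_congr rfl fun v _ => Finset.prod_congr rfl fun v' _ => ?_
    split_ifs with hlt
    · simp [j, hlt]
    · rfl
  have hj : ∀ v v', Incomp v v' → (∃ u γ, s.Germ h v u γ) → (∃ u γ, s.Germ h v' u γ) →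
      j v v' = C.inversion h v v' := by
    rintro v v' hv ⟨_, _, K⟩ ⟨_, _, K'⟩
    simp only [j]
    split_ifs
    · rfl
    · exact inversion_symm hd K' K hv.symm
  unfold total
  rw [hpj, hpj, pairProd_union hdisj hjs, Finset.prod_union hdisj, Finset.prod_insert ha,
    pairProd_insert ha fun v hv => hjs v a fun e => ha (e ▸ hv), Finset.prod_image hinj.injOn,
    pairProd_image hinj.injOn hjs, H.germVal_eq hd hC, C.c_eq γ, sgn_eq_pairProd C.τ_mul]
  have e₁ : ∏ x, C.germVal h (a ++ [x]) = ∏ x, C.c (s.sec γ x) :=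
    Finset.prod_congr rfl fun x _ => (H.snoc x).germVal_eq hd hC
  have e₂ : pairProd Finset.univ (fun x y => j (a ++ [x]) (a ++ [y])) =
      pairProd Finset.univ fun x y => if s.perm γ x < s.perm γ y then 1 else C.τ := by
    refine Finset.prod_congr rfl fun x _ => Finset.prod_congr rfl fun y _ => ?_
    by_cases hxy : x < y
    · have hxy' := (append_singleton_lt a x y).2 hxy
      simp only [j, if_pos hxy', inversion, (H.snoc x).target_eq hd,
        (H.snoc y).target_eq hd, append_singleton_lt, hxy, true_iff]
    · rw [if_neg hxy, if_neg hxy]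
  have e₃ : ∏ v ∈ Q, ∏ v' ∈ Finset.univ.image (fun x => a ++ [x]), j v v' =
      ∏ v ∈ Q, j a v := by
    refine Finset.prod_congr rfl fun v hv => ?_
    obtain ⟨u', γ', K⟩ := hgood v (by simp [hv])
    rw [Finset.prod_image hinj.injOn, hjs a v (hinc v hv).ne,
      hj v a (hinc v hv).symm ⟨_, _, K⟩ ⟨_, _, H⟩]
    rw [Finset.prod_congr rfl fun x _ => (hj v (a ++ [x]) ((hinc v hv).append_left [x]).symm
      ⟨_, _, K⟩ ⟨_, _, H.snoc x⟩).trans (inversion_append hd K H (hinc v hv).symm x)]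
    simp [inversion_pow]
  rw [e₁, e₂, e₃]
  simp only [mul_assoc, mul_left_comm, mul_comm]

end Cocycle

end SelfSimilar

namespace SelfSimilar

variable {d : ℕ} {G Ω : Type*} [Group G] [MulAction G Ω] {s : SelfSimilar d G Ω}

/-! ### The homomorphism defined by a cocycle -/

/-- The words of length `n`. -/
def level (d n : ℕ) : Finset (List (Fin d)) := (List.finite_length_eq (Fin d) n).toFinset

@[simp] theorem mem_level {n : ℕ} {v : List (Fin d)} : v ∈ level d n ↔ v.length = n := by
  simp [level]

theorem isPartition_level (n : ℕ) : s.IsPartition (level d n) where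
  incomp u hu v hv h := Incomp.of_length_eq h (by simp_all)
  cover w := by
    obtain ⟨v, hv, a, ha⟩ := s.exists_pre n w
    exact ⟨v, by simpa, a, ha⟩

/-- The image of a partition into cylinders by a bijection that maps cylinders to cylinders. -/
theorem IsPartition.image [Nonempty Ω] (hd : 2 ≤ d) {P : Finset (List (Fin d))}
    (hP : s.IsPartition P) {h : Equiv.Perm Ω} (hgood : ∀ v ∈ P, ∃ u γ, s.Germ h v u γ) :
    s.IsPartition (P.image (s.target h)) ∧ Set.InjOn (s.target h) P := by
  have key : ∀ u ∈ P, ∀ v ∈ P, u ≠ v → Incomp (s.target h u) (s.target h v) := by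
    intro u hu v hv hne
    obtain ⟨u', γ, H⟩ := hgood u hu
    obtain ⟨v', γ', H'⟩ := hgood v hv
    rw [H.target_eq hd, H'.target_eq hd]
    exact H.incomp H' (hP.incomp u hu v hv hne)
  refine ⟨⟨?_, fun w => ?_⟩, fun u hu v hv e => ?_⟩
  · simp only [Finset.mem_image, forall_exists_index, and_imp, forall_apply_eq_imp_iff₂]
    exact fun u hu v hv hne => key u hu v hv fun e => hne (e ▸ rfl)
  · obtain ⟨v, hv, a, ha⟩ := hP.cover (h.symm w)
    obtain ⟨u, γ, H⟩ := hgood v hv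
    refine ⟨u, Finset.mem_image.2 ⟨v, hv, H.target_eq hd⟩, γ • a, ?_⟩
    rw [← H, ha, Equiv.apply_symm_apply]
  · by_contra hne
    exact (key u hu v hv hne).ne e

theorem IsPartition.refine {Q : Finset (List (Fin d))} {a : List (Fin d)}
    (ha : a ∉ Q) (hP : s.IsPartition (insert a Q)) :
    s.IsPartition (Q ∪ Finset.univ.image fun x => a ++ [x]) where
  incomp := by
    have hinc : ∀ v ∈ Q, Incomp a v := fun v hv =>
      hP.incomp a (by simp) v (by simp [hv]) fun e => ha (e ▸ hv)
    intro u hu v hv hne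
    simp only [Finset.mem_union, Finset.mem_image, Finset.mem_univ, true_and] at hu hv
    rcases hu with hu | ⟨x, rfl⟩ <;> rcases hv with hv | ⟨y, rfl⟩
    · exact hP.incomp u (by simp [hu]) v (by simp [hv]) hne
    · exact ((hinc u hu).append_left _).symm
    · exact (hinc v hv).append_left _
    · exact Incomp.of_ne (fun e => hne (by rw [e])) a
  cover w := by
    obtain ⟨v, hv, b, rfl⟩ := hP.cover w
    rcases Finset.mem_insert.1 hv with rfl | hv
    · obtain ⟨⟨x, b⟩, rfl⟩ := s.e.surjective b
      exact ⟨v ++ [x], by simp, b, by rw [pre_append]; rfl⟩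
    · exact ⟨v, by simp [hv], b, rfl⟩

theorem IsPartition.eq_level [Nonempty Ω] {P : Finset (List (Fin d))} (hP : s.IsPartition P)
    {N : ℕ} (hN : ∀ v ∈ P, v.length = N) : P = level d N := by
  ext v
  refine ⟨fun hv => by simpa using hN v hv, fun hv => ?_⟩
  obtain ⟨u, hu, a, ha⟩ := hP.cover (s.pre v (Classical.arbitrary Ω))
  rw [← eq_of_pre_eq ha (by rw [hN u hu, mem_level.1 hv])]
  exact hu

theorem exists_level {h : Equiv.Perm Ω} (hh : h ∈ s.V) :
    ∃ n, ∀ v ∈ level d n, ∃ u γ, s.Germ h v u γ := by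
  obtain ⟨n, hn⟩ := hh
  exact ⟨n, fun v hv => hn v (by simpa using hv)⟩

variable [Nonempty Ω] {A : Type*} [CommGroup A] {C : s.Cocycle A}

namespace Cocycle

/-- The total value of a cocycle does not depend on the partition it is computed with. -/
theorem total_eq_level (hd : 2 ≤ d) (hC : C.IsFaithful) {h : Equiv.Perm Ω}
    {P : Finset (List (Fin d))} (hP : s.IsPartition P)
    (hgood : ∀ v ∈ P, ∃ u γ, s.Germ h v u γ) {N : ℕ} (hN : ∀ v ∈ P, v.length ≤ N) :
    C.total h P = C.total h (level d N) := by
  -- the weight decreases when a word shorter than `N` is replaced by its `d` extensions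
  induction hk : ∑ v ∈ P, (d + 1) ^ (N - v.length) using Nat.strong_induction_on
    generalizing P with
  | _ k ih =>
    by_cases hall : ∀ v ∈ P, v.length = N
    · rw [hP.eq_level hall]
    push Not at hall
    obtain ⟨a, haP, haN⟩ := hall
    have haN : a.length < N := lt_of_le_of_ne (hN a haP) haN
    obtain ⟨Q, ha, rfl⟩ : ∃ Q, a ∉ Q ∧ insert a Q = P :=
      ⟨P.erase a, by simp, Finset.insert_erase haP⟩
    have hlen : ∀ v ∈ Q ∪ Finset.univ.image (fun x => a ++ [x]), v.length ≤ N := by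
      intro v hv
      simp only [Finset.mem_union, Finset.mem_image, Finset.mem_univ, true_and] at hv
      rcases hv with hv | ⟨x, rfl⟩
      · exact hN v (by simp [hv])
      · simpa using haN
    rw [← total_refine hd hC ha hP.incomp hgood]
    refine ih _ ?_ (hP.refine ha) ?_ hlen rfl
    · rw [← hk, Finset.sum_insert ha, add_comm ((d + 1) ^ (N - a.length))]
      refine ((Nat.le_add_right _ _).trans_eq Finset.sum_union_inter).trans_lt ?_
      refine Nat.add_lt_add_left ?_ _
      rw [Finset.sum_image fun x _ y _ hxy => by simpa using hxy]
      obtain ⟨m, hm⟩ : ∃ m, N - a.length = m + 1 := ⟨N - a.length - 1, by omega⟩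
      simp only [List.length_append, List.length_singleton, ← Nat.sub_sub, hm,
        Nat.add_sub_cancel, Finset.sum_const, Finset.card_univ, Fintype.card_fin, smul_eq_mul]
      rw [pow_succ, mul_comm]
      exact Nat.mul_lt_mul_of_pos_left (Nat.lt_succ_self d) (by positivity)
    · intro v hv
      simp only [Finset.mem_union, Finset.mem_image, Finset.mem_univ, true_and] at hv
      rcases hv with hv | ⟨x, rfl⟩
      · exact hgood v (by simp [hv])
      · obtain ⟨u, γ, H⟩ := hgood a (by simp)
        exact ⟨_, _, H.snoc x⟩

theorem total_eq (hd : 2 ≤ d) (hC : C.IsFaithful) {h : Equiv.Perm Ω}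
    {P P' : Finset (List (Fin d))} (hP : s.IsPartition P) (hP' : s.IsPartition P')
    (hgood : ∀ v ∈ P, ∃ u γ, s.Germ h v u γ) (hgood' : ∀ v ∈ P', ∃ u γ, s.Germ h v u γ) :
    C.total h P = C.total h P' := by
  obtain ⟨N, hN⟩ := ((P ∪ P').finite_toSet.image List.length).bddAbove
  rw [total_eq_level hd hC hP hgood fun v hv => hN ⟨v, by simp [hv], rfl⟩,
    total_eq_level hd hC hP' hgood' fun v hv => hN ⟨v, by simp [hv], rfl⟩]

theorem total_mul (hd : 2 ≤ d) (hC : C.IsFaithful) {h h' : Equiv.Perm Ω}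
    {P : Finset (List (Fin d))} (hP : s.IsPartition P)
    (hgood : ∀ v ∈ P, ∃ u γ, s.Germ h v u γ)
    (hgood' : ∀ v ∈ P.image (s.target h), ∃ u γ, s.Germ h' v u γ) :
    C.total (h' * h) P = C.total h' (P.image (s.target h)) * C.total h P := by
  have hinj := (hP.image hd hgood).2
  have hg : ∀ v ∈ P, ∃ γ u γ', s.Germ h v (s.target h v) γ ∧ s.Germ h' (s.target h v) u γ' := by
    intro v hv
    obtain ⟨u, γ, H⟩ := hgood v hv
    obtain ⟨u', γ', H'⟩ := hgood' (s.target h v) (Finset.mem_image_of_mem _ hv)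
    exact ⟨γ, u', γ', by rwa [H.target_eq hd], H'⟩
  unfold total
  rw [Finset.prod_image hinj, mul_mul_mul_comm, ← Finset.prod_mul_distrib]
  congr 1
  · refine Finset.prod_congr rfl fun v hv => ?_
    obtain ⟨γ, u, γ', H, H'⟩ := hg v hv
    exact germVal_mul hd hC H' H
  · -- replace the inversions of `h'` by a function that is symmetric everywhere
    let j : List (Fin d) → List (Fin d) → A := fun v v' =>
      if v < v' then C.inversion h' v v' else C.inversion h' v' v
    have hjs : ∀ v v', v ≠ v' → j v v' = j v' v := by
      intro v v' hne
      rcases lt_or_gt_of_ne hne with hlt | hlt <;> simp [j, hlt, hlt.not_gt]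
    have hj : pairProd (P.image (s.target h)) (C.inversion h') =
        pairProd (P.image (s.target h)) j := by
      refine Finset.prod_congr rfl fun v _ => Finset.prod_congr rfl fun v' _ => ?_
      split_ifs with hlt
      · simp [j, hlt]
      · rfl
    rw [hj, pairProd_image hinj hjs, ← pairProd_mul]
    refine pairProd_congr fun v hv v' hv' hne => ?_
    obtain ⟨γ₁, u₁, γ₁', H₁, H₁'⟩ := hg v hv
    obtain ⟨γ₂, u₂, γ₂', H₂, H₂'⟩ := hg v' hv'
    rw [inversion_mul hd H₁ H₁' H₂ H₂']
    congr 1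
    simp only [j]
    split_ifs
    · rfl
    · exact inversion_symm hd H₁' H₂' (H₁.incomp H₂ (hP.incomp v hv v' hv' hne))

/-- The homomorphism from the group `V` defined by a cocycle. -/
def hom (hd : 2 ≤ d) (C : s.Cocycle A) (hC : C.IsFaithful) : s.V →* A :=
  MonoidHom.mk' (fun h => C.total h (level d (exists_level h.2).choose)) (by
    intro h' h
    obtain ⟨m, hm⟩ := h'.2
    obtain ⟨n, hn⟩ := h.2
    have hgood : ∀ v ∈ level d (n + m), ∃ u γ, s.Germ (h : Equiv.Perm Ω) v u γ := fun v hv =>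
      exists_germ_of_le hn (by rw [mem_level.1 hv]; omega)
    have hgood' : ∀ v ∈ (level d (n + m)).image (s.target (h : Equiv.Perm Ω)),
        ∃ u γ, s.Germ (h' : Equiv.Perm Ω) v u γ := by
      intro v hv
      obtain ⟨u, hu, rfl⟩ := Finset.mem_image.1 hv
      rw [mem_level] at hu
      obtain ⟨u', γ, H⟩ := hn (u.take n) (by simp [hu])
      obtain ⟨t, γ', ht, H'⟩ := H.append (u.drop n)
      rw [List.take_append_drop] at H'
      rw [H'.target_eq hd]
      exact exists_germ_of_le hm (by simp [ht, hu])
    have hP := isPartition_level (s := s) (n + m)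
    have hmul : ∀ v ∈ level d (n + m), ∃ u γ, s.Germ ((h' * h : s.V) : Equiv.Perm Ω) v u γ := by
      intro v hv
      obtain ⟨u, γ, H⟩ := hgood v hv
      obtain ⟨u', γ', H'⟩ := hgood' u (Finset.mem_image.2 ⟨v, hv, H.target_eq hd⟩)
      exact ⟨_, _, H'.mul H⟩
    rw [total_eq hd hC (isPartition_level _) hP (exists_level (h' * h).2).choose_spec hmul,
      total_eq hd hC (isPartition_level _) hP (exists_level h.2).choose_spec hgood,
      total_eq hd hC (isPartition_level _) (hP.image hd hgood).1
        (exists_level h'.2).choose_spec hgood']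
    exact total_mul hd hC hP hgood hgood')

theorem hom_eq (hd : 2 ≤ d) (hC : C.IsFaithful) (h : s.V) {P : Finset (List (Fin d))}
    (hP : s.IsPartition P) (hgood : ∀ v ∈ P, ∃ u γ, s.Germ (h : Equiv.Perm Ω) v u γ) :
    hom hd C hC h = C.total h P :=
  total_eq hd hC (isPartition_level _) hP (exists_level h.2).choose_spec hgood

end Cocycle
end SelfSimilar

namespace SelfSimilar

variable {d : ℕ} {G Ω : Type*} [Group G] [MulAction G Ω] {s : SelfSimilar d G Ω}

/-! ### Swaps of cylinders and elements supported on one cylinder -/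

theorem prefix_or_incomp {α : Type*} {u v : List α} (h : u.length ≤ v.length) :
    u <+: v ∨ Incomp u v := by
  by_cases h₁ : u <+: v
  · exact Or.inl h₁
  · exact Or.inr ⟨h₁, fun h₂ => h₁ (h₂.eq_of_length_le h ▸ List.prefix_rfl)⟩

theorem Germ.eq_of_forall {h h' : Equiv.Perm Ω} (n : ℕ)
    (H : ∀ v : List (Fin d), v.length = n → ∃ u γ, s.Germ h v u γ ∧ s.Germ h' v u γ) :
    h = h' := by
  ext w
  obtain ⟨v, hv, a, rfl⟩ := s.exists_pre n w
  obtain ⟨u, γ, K, K'⟩ := H v hv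
  rw [K, K']

open Classical in
variable (s) in
/-- The involution exchanging the cylinders of two incomparable words. -/
def swapPerm {u v : List (Fin d)} (h : Incomp u v) : Equiv.Perm Ω :=
  Function.Involutive.toPerm
    (fun w => if H : ∃ a, s.pre u a = w then s.pre v H.choose
      else if H : ∃ a, s.pre v a = w then s.pre u H.choose else w) (by
    have hu (a : Ω) (H : ∃ b, s.pre u b = s.pre u a) : H.choose = a :=
      s.pre_injective u H.choose_spec
    have hv (a : Ω) (H : ∃ b, s.pre v b = s.pre v a) : H.choose = a :=
      s.pre_injective v H.choose_spec
    intro w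
    by_cases h₁ : ∃ a, s.pre u a = w
    · obtain ⟨a, rfl⟩ := h₁
      have h₂ : ¬ ∃ b, s.pre u b = s.pre v a := fun ⟨b, hb⟩ => pre_ne h b a hb
      simp [hu, hv, h₂]
    · by_cases h₂ : ∃ a, s.pre v a = w
      · obtain ⟨a, rfl⟩ := h₂
        simp [h₁, hv, hu]
      · simp [h₁, h₂])

section swapPerm

variable {u v : List (Fin d)} (h : Incomp u v)

theorem swapPerm_left (a : Ω) : s.swapPerm h (s.pre u a) = s.pre v a := by
  have H : ∃ b, s.pre u b = s.pre u a := ⟨a, rfl⟩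
  refine (dif_pos H).trans ?_
  rw [s.pre_injective u H.choose_spec]

theorem swapPerm_right (a : Ω) : s.swapPerm h (s.pre v a) = s.pre u a := by
  have H : ∃ b, s.pre v b = s.pre v a := ⟨a, rfl⟩
  have H' : ¬ ∃ b, s.pre u b = s.pre v a := fun ⟨b, hb⟩ => pre_ne h b a hb
  refine (dif_neg H').trans ((dif_pos H).trans ?_)
  rw [s.pre_injective v H.choose_spec]

theorem swapPerm_of_not {w : Ω} (hu : ∀ a, s.pre u a ≠ w) (hv : ∀ a, s.pre v a ≠ w) :
    s.swapPerm h w = w :=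
  (dif_neg fun ⟨a, ha⟩ => hu a ha).trans (dif_neg fun ⟨a, ha⟩ => hv a ha)

theorem swapPerm_germ_left : s.Germ (s.swapPerm h) u v 1 := fun a => by
  rw [swapPerm_left, one_smul]

theorem swapPerm_germ_right : s.Germ (s.swapPerm h) v u 1 := fun a => by
  rw [swapPerm_right, one_smul]

theorem swapPerm_germ_of_incomp {z : List (Fin d)} (hu : Incomp u z) (hv : Incomp v z) :
    s.Germ (s.swapPerm h) z z 1 := fun a => by
  rw [one_smul]
  exact swapPerm_of_not h (fun b => pre_ne hu b a) (fun b => pre_ne hv b a)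

theorem germ_one_append {h : Equiv.Perm Ω} {u v : List (Fin d)} (H : s.Germ h v u 1)
    (t : List (Fin d)) : s.Germ h (v ++ t) (u ++ t) 1 := fun a => by
  rw [pre_append, H, pre_append, one_smul, one_smul]

variable (s) in
/-- The exchange of two cylinders, as an element of `V`. -/
def swap : s.V := ⟨s.swapPerm h, by
  refine ⟨max u.length v.length, fun z hz => ?_⟩
  rcases prefix_or_incomp (u := u) (v := z) (by omega) with ⟨t, rfl⟩ | h₁
  · exact ⟨_, _, germ_one_append (swapPerm_germ_left h) t⟩
  rcases prefix_or_incomp (u := v) (v := z) (by omega) with ⟨t, rfl⟩ | h₂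
  · exact ⟨_, _, germ_one_append (swapPerm_germ_right h) t⟩
  exact ⟨z, 1, swapPerm_germ_of_incomp h h₁ h₂⟩⟩

theorem swap_symm : s.swap h.symm = s.swap h := by
  apply Subtype.ext
  ext w
  by_cases hu : ∃ a, s.pre u a = w
  · obtain ⟨a, rfl⟩ := hu
    exact (swapPerm_right h.symm a).trans (swapPerm_left h a).symm
  by_cases hv : ∃ a, s.pre v a = w
  · obtain ⟨a, rfl⟩ := hv
    exact (swapPerm_left h.symm a).trans (swapPerm_right h a).symm
  push Not at hu hv
  exact (swapPerm_of_not h.symm hv hu).trans (swapPerm_of_not h hu hv).symm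

theorem swap_mul_self : s.swap h * s.swap h = 1 := by
  apply Subtype.ext
  ext w
  exact (s.swapPerm h).symm_apply_apply w

/-- Conjugating a swap by an element that moves its two cylinders. -/
theorem mul_swap {u' v' : List (Fin d)} (h' : Incomp u' v') (g : s.V)
    (hu : s.Germ (g : Equiv.Perm Ω) u u' 1) (hv : s.Germ (g : Equiv.Perm Ω) v v' 1) :
    g * s.swap h = s.swap h' * g := by
  apply Subtype.ext
  ext w
  change (g : Equiv.Perm Ω) (s.swapPerm h w) = s.swapPerm h' ((g : Equiv.Perm Ω) w)
  by_cases hu₁ : ∃ a, s.pre u a = w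
  · obtain ⟨a, rfl⟩ := hu₁
    rw [swapPerm_left, hv, hu, one_smul, swapPerm_left]
  by_cases hv₁ : ∃ a, s.pre v a = w
  · obtain ⟨a, rfl⟩ := hv₁
    rw [swapPerm_right, hv, hu, one_smul, swapPerm_right]
  push Not at hu₁ hv₁
  rw [swapPerm_of_not h hu₁ hv₁, swapPerm_of_not h']
  · intro a ha
    refine hu₁ a ((g : Equiv.Perm Ω).injective ?_)
    rw [hu, one_smul, ha]
  · intro a ha
    refine hv₁ a ((g : Equiv.Perm Ω).injective ?_)
    rw [hv, one_smul, ha]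

end swapPerm

open Classical in
variable (s) in
/-- The copy on the cylinder of `v` of a permutation of `Ω`; it is the identity elsewhere. -/
def localPerm (v : List (Fin d)) : Equiv.Perm Ω →* Equiv.Perm Ω :=
  Equiv.Perm.extendDomainHom (Equiv.ofInjective _ (s.pre_injective v))

theorem localPerm_pre (v : List (Fin d)) (k : Equiv.Perm Ω) (a : Ω) :
    s.localPerm v k (s.pre v a) = s.pre v (k a) := by
  classical
  exact Equiv.Perm.extendDomain_apply_image k (Equiv.ofInjective _ (s.pre_injective v)) a

theorem localPerm_of_not {v : List (Fin d)} (k : Equiv.Perm Ω) {w : Ω}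
    (hw : ∀ a, s.pre v a ≠ w) : s.localPerm v k w = w := by
  classical
  exact Equiv.Perm.extendDomain_apply_not_subtype k _ fun ⟨a, ha⟩ => hw a ha

theorem localPerm_germ {v t u : List (Fin d)} {k : Equiv.Perm Ω} {γ : G} (H : s.Germ k t u γ) :
    s.Germ (s.localPerm v k) (v ++ t) (v ++ u) γ := fun a => by
  rw [pre_append, localPerm_pre, H, pre_append]

theorem localPerm_germ_of_incomp {v z : List (Fin d)} (h : Incomp v z) (k : Equiv.Perm Ω) :
    s.Germ (s.localPerm v k) z z 1 := fun a => by
  rw [localPerm_of_not k fun b => pre_ne h b a, one_smul]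

variable (s) in
/-- The copy on the cylinder of `v` of an element of `V`. -/
def localHom (v : List (Fin d)) : s.V →* s.V :=
  ((s.localPerm v).comp s.V.subtype).codRestrict s.V fun k => by
    obtain ⟨n, hn⟩ := k.2
    refine ⟨v.length + n, fun z hz => ?_⟩
    rcases prefix_or_incomp (u := v) (v := z) (by omega) with ⟨t, rfl⟩ | h
    · obtain ⟨u, γ, H⟩ := hn t (by simpa using hz)
      exact ⟨_, _, localPerm_germ H⟩
    · exact ⟨z, 1, localPerm_germ_of_incomp h _⟩

@[simp] theorem coe_localHom (v : List (Fin d)) (k : s.V) :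
    (s.localHom v k : Equiv.Perm Ω) = s.localPerm v k := rfl

theorem localHom_append (u v : List (Fin d)) (k : s.V) :
    s.localHom (u ++ v) k = s.localHom u (s.localHom v k) := by
  apply Subtype.ext
  ext w
  rw [coe_localHom, coe_localHom, coe_localHom]
  by_cases hu : ∃ a, s.pre u a = w
  · obtain ⟨a, rfl⟩ := hu
    rw [localPerm_pre]
    by_cases hv : ∃ b, s.pre v b = a
    · obtain ⟨b, rfl⟩ := hv
      rw [← pre_append, localPerm_pre, localPerm_pre, pre_append]
    · push Not at hv
      rw [localPerm_of_not _ hv, localPerm_of_not]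
      intro b hb
      rw [pre_append] at hb
      exact hv b (s.pre_injective u hb)
  · push Not at hu
    rw [localPerm_of_not _ hu, localPerm_of_not]
    intro b hb
    rw [pre_append] at hb
    exact hu _ hb

theorem mul_localHom {v v' : List (Fin d)} (k g : s.V)
    (hv : s.Germ (g : Equiv.Perm Ω) v v' 1) :
    g * s.localHom v k = s.localHom v' k * g := by
  apply Subtype.ext
  ext w
  change (g : Equiv.Perm Ω) (s.localPerm v k w) = s.localPerm v' k ((g : Equiv.Perm Ω) w)
  by_cases hv₁ : ∃ a, s.pre v a = w
  · obtain ⟨a, rfl⟩ := hv₁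
    rw [localPerm_pre, hv, hv, one_smul, one_smul, localPerm_pre]
  push Not at hv₁
  rw [localPerm_of_not _ hv₁, localPerm_of_not]
  intro a ha
  refine hv₁ a ((g : Equiv.Perm Ω).injective ?_)
  rw [hv, one_smul, ha]

variable (s) in
/-- The action of `G` on `Ω`, as a homomorphism to `V`. -/
def actHom : G →* s.V :=
  (MulAction.toPermHom G Ω).codRestrict s.V fun g => ⟨0, fun v hv => by
    rw [List.length_eq_zero_iff] at hv
    subst hv
    exact ⟨[], g, fun _ => rfl⟩⟩

theorem actHom_germ (g : G) : s.Germ (s.actHom g : Equiv.Perm Ω) [] [] g := fun _ => rfl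

variable (s) in
/-- The permutations of the `d` copies of `Ω`, as elements of `V`. -/
def rootHom : Equiv.Perm (Fin d) →* s.V :=
  MonoidHom.codRestrict
    (MonoidHom.mk' (fun π => s.e.permCongr (π.prodCongr (Equiv.refl Ω))) fun π π' => by
      ext w
      simp [Equiv.permCongr_apply, Prod.map]) s.V fun π => ⟨1, fun v hv => by
        obtain ⟨x, rfl⟩ := List.length_eq_one_iff.1 hv
        exact ⟨[π x], 1, fun w => by simp [Equiv.permCongr_apply]⟩⟩

theorem rootHom_e (π : Equiv.Perm (Fin d)) (x : Fin d) (a : Ω) :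
    (s.rootHom π : Equiv.Perm Ω) (s.e (x, a)) = s.e (π x, a) := by
  change s.e.permCongr (π.prodCongr (Equiv.refl Ω)) (s.e (x, a)) = _
  simp [Equiv.permCongr_apply]

theorem rootHom_germ (π : Equiv.Perm (Fin d)) (x : Fin d) :
    s.Germ (s.rootHom π : Equiv.Perm Ω) [x] [π x] 1 := fun a => by
  simp [rootHom_e]

/-- A transposition of two of the copies of `Ω` inside a cylinder is a swap of cylinders. -/
theorem localHom_rootHom_swap (v : List (Fin d)) {x y : Fin d} (hxy : x ≠ y) :
    s.localHom v (s.rootHom (Equiv.swap x y)) = s.swap (Incomp.of_ne hxy v) := by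
  apply Subtype.ext
  refine Germ.eq_of_forall (s := s) (v.length + 1) fun z hz => ?_
  rcases prefix_or_incomp (u := v) (v := z) (by omega) with ⟨t, rfl⟩ | h
  · obtain ⟨a, rfl⟩ := List.length_eq_one_iff.1 (show t.length = 1 by simpa using hz)
    refine ⟨_, _, localPerm_germ (rootHom_germ _ a), ?_⟩
    rcases eq_or_ne a x with rfl | hx
    · rw [Equiv.swap_apply_left]
      exact swapPerm_germ_left (Incomp.of_ne hxy v)
    rcases eq_or_ne a y with rfl | hy
    · rw [Equiv.swap_apply_right]
      exact swapPerm_germ_right (Incomp.of_ne hxy v)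
    · rw [Equiv.swap_apply_of_ne_of_ne hx hy]
      exact swapPerm_germ_of_incomp (Incomp.of_ne hxy v) (Incomp.of_ne hx.symm v)
        (Incomp.of_ne hy.symm v)
  · exact ⟨z, 1, localPerm_germ_of_incomp h _,
      swapPerm_germ_of_incomp (Incomp.of_ne hxy v) (h.append_left _) (h.append_left _)⟩

/-- The wreath recursion: an element of `G` is the product of its action on the `d` copies of `Ω`
and of its sections. -/
theorem actHom_eq (g : G) :
    s.actHom g = s.rootHom (s.perm g) *
      ((List.finRange d).map fun x => s.localHom [x] (s.actHom (s.sec g x))).prod := by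
  have key : ∀ L : List (Fin d), L.Nodup → ∀ (x : Fin d) (a : Ω),
      ((L.map fun x => s.localHom [x] (s.actHom (s.sec g x))).prod : Equiv.Perm Ω)
        (s.e (x, a)) = if x ∈ L then s.e (x, s.sec g x • a) else s.e (x, a) := by
    intro L
    induction L with
    | nil => simp
    | cons y L ih =>
      intro hL x a
      rw [List.nodup_cons] at hL
      rw [List.map_cons, List.prod_cons, Subgroup.coe_mul, Equiv.Perm.mul_apply, ih hL.2]
      have hloc (b : Ω) : s.localPerm [y] (s.actHom (s.sec g y)) (s.e (x, b)) =
          if x = y then s.e (x, s.sec g x • b) else s.e (x, b) := by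
        split_ifs with hxy
        · subst hxy
          exact localPerm_pre [x] _ b
        · refine localPerm_of_not _ fun c hc => hxy ?_
          have := s.e.injective hc
          simp only [Prod.mk.injEq] at this
          exact this.1.symm
      rw [coe_localHom]
      by_cases hxy : x = y
      · subst hxy
        rw [if_neg hL.1, hloc]
        simp
      · by_cases hx : x ∈ L <;> simp [hx, hloc, hxy]
  apply Subtype.ext
  ext w
  obtain ⟨⟨x, a⟩, rfl⟩ := s.e.surjective w
  rw [Subgroup.coe_mul, Equiv.Perm.mul_apply, key _ (List.nodup_finRange d),
    if_pos (List.mem_finRange x), rootHom_e]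
  exact s.smul_e g x a

/-- A swap of two cylinders is the product of the swaps of their parts. -/
theorem swap_eq_prod {u v : List (Fin d)} (h : Incomp u v) :
    s.swap h = ((List.finRange d).map fun x => s.swap (h.append [x] [x])).prod := by
  have key : ∀ L : List (Fin d), L.Nodup →
      (∀ (x : Fin d) (a : Ω),
        ((L.map fun x => s.swap (h.append [x] [x])).prod : Equiv.Perm Ω)
          (s.pre (u ++ [x]) a) = if x ∈ L then s.pre (v ++ [x]) a else s.pre (u ++ [x]) a) ∧
      (∀ (x : Fin d) (a : Ω),
        ((L.map fun x => s.swap (h.append [x] [x])).prod : Equiv.Perm Ω)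
          (s.pre (v ++ [x]) a) = if x ∈ L then s.pre (u ++ [x]) a else s.pre (v ++ [x]) a) ∧
      ∀ w, (∀ a, s.pre u a ≠ w) → (∀ a, s.pre v a ≠ w) →
        ((L.map fun x => s.swap (h.append [x] [x])).prod : Equiv.Perm Ω) w = w := by
    intro L
    induction L with
    | nil => simp
    | cons y L ih =>
      intro hL
      rw [List.nodup_cons] at hL
      obtain ⟨h₁, h₂, h₃⟩ := ih hL.2
      rw [List.map_cons, List.prod_cons, Subgroup.coe_mul]
      have e : ((s.swap (h.append [y] [y]) : s.V) : Equiv.Perm Ω) =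
        s.swapPerm (h.append [y] [y]) := rfl
      rw [e]
      refine ⟨fun x a => ?_, fun x a => ?_, fun w hu hv => ?_⟩
      · rw [Equiv.Perm.mul_apply, h₁]
        by_cases hxy : x = y
        · subst hxy
          rw [if_neg hL.1, swapPerm_left]
          simp
        · have i₁ := Incomp.of_ne (Ne.symm hxy) u
          have i₂ := Incomp.of_ne (Ne.symm hxy) v
          have g₁ := swapPerm_germ_of_incomp (s := s) (h.append [y] [y]) i₁
            (h.symm.append [y] [x]) a
          have g₂ := swapPerm_germ_of_incomp (s := s) (h.append [y] [y]) (h.append [y] [x]) i₂ a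
          rw [one_smul] at g₁ g₂
          by_cases hx : x ∈ L <;> simp [hx, hxy, g₁, g₂]
      · rw [Equiv.Perm.mul_apply, h₂]
        by_cases hxy : x = y
        · subst hxy
          rw [if_neg hL.1, swapPerm_right]
          simp
        · have i₁ := Incomp.of_ne (Ne.symm hxy) u
          have i₂ := Incomp.of_ne (Ne.symm hxy) v
          have g₁ := swapPerm_germ_of_incomp (s := s) (h.append [y] [y]) i₁
            (h.symm.append [y] [x]) a
          have g₂ := swapPerm_germ_of_incomp (s := s) (h.append [y] [y]) (h.append [y] [x]) i₂ a
          rw [one_smul] at g₁ g₂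
          by_cases hx : x ∈ L <;> simp [hx, hxy, g₁, g₂]
      · rw [Equiv.Perm.mul_apply, h₃ w hu hv, swapPerm_of_not]
        · intro a
          rw [pre_append]
          exact hu _
        · intro a
          rw [pre_append]
          exact hv _
  obtain ⟨h₁, h₂, h₃⟩ := key _ (List.nodup_finRange d)
  apply Subtype.ext
  ext w
  change s.swapPerm h w = _
  by_cases hu : ∃ a, s.pre u a = w
  · obtain ⟨a, rfl⟩ := hu
    obtain ⟨⟨x, a⟩, rfl⟩ := s.e.surjective a
    have := h₁ x a
    rw [if_pos (List.mem_finRange x), pre_append, pre_append] at this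
    rw [swapPerm_left]
    exact this.symm
  by_cases hv : ∃ a, s.pre v a = w
  · obtain ⟨a, rfl⟩ := hv
    obtain ⟨⟨x, a⟩, rfl⟩ := s.e.surjective a
    have := h₂ x a
    rw [if_pos (List.mem_finRange x), pre_append, pre_append] at this
    rw [swapPerm_right]
    exact this.symm
  push Not at hu hv
  rw [swapPerm_of_not h hu hv, h₃ w hu hv]

end SelfSimilar

namespace SelfSimilar

variable {d : ℕ} {G Ω : Type*} [Group G] [MulAction G Ω] {s : SelfSimilar d G Ω}

/-! ### Homomorphisms from `V` to abelian groups -/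

section Classes

variable {B : Type*} [CommGroup B] (q : s.V →* B)

theorem map_swap_eq_of_germ {u v u' v' : List (Fin d)} (h : Incomp u v) (h' : Incomp u' v')
    (g : s.V) (hu : s.Germ (g : Equiv.Perm Ω) u u' 1) (hv : s.Germ (g : Equiv.Perm Ω) v v' 1) :
    q (s.swap h) = q (s.swap h') := by
  have := congrArg q (mul_swap h h' g hu hv)
  rwa [map_mul, map_mul, mul_comm, mul_right_cancel_iff] at this

theorem map_swap_right {u v z : List (Fin d)} (h : Incomp u v) (h' : Incomp u z)
    (hvz : Incomp v z) : q (s.swap h) = q (s.swap h') :=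
  map_swap_eq_of_germ q h h' (s.swap hvz) (swapPerm_germ_of_incomp hvz h.symm h'.symm)
    (swapPerm_germ_left hvz)

/-- Two swaps of disjoint supports have the same image in an abelian group. -/
theorem map_swap_of_incomp {u v u' v' : List (Fin d)} (h : Incomp u v) (h' : Incomp u' v')
    (huu : Incomp u u') (huv : Incomp u v') (hvv : Incomp v v') :
    q (s.swap h) = q (s.swap h') := by
  rw [map_swap_right q h huv hvv, ← swap_symm, map_swap_right q huv.symm h'.symm huu,
    swap_symm]

/-- A swap whose support is not all of `Ω` has the same image as a swap inside one of its two
cylinders. -/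
theorem map_swap_eq_inside {u v z : List (Fin d)} (h : Incomp u v) (hu : Incomp u z)
    (hv : Incomp v z) {x y : Fin d} (hxy : x ≠ y) :
    q (s.swap h) = q (s.swap (Incomp.of_ne hxy u)) := by
  rw [map_swap_of_incomp q h (Incomp.of_ne hxy z) (hu.append_right _) (hu.append_right _)
    (hv.append_right _)]
  exact map_swap_of_incomp q _ _ (hu.symm.append _ _) (hu.symm.append _ _) (hu.symm.append _ _)

theorem map_swap_inside_eq {u v : List (Fin d)} (h : Incomp u v) {x y : Fin d} (hxy : x ≠ y) :
    q (s.swap (Incomp.of_ne hxy u)) = q (s.swap (Incomp.of_ne hxy v)) :=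
  map_swap_of_incomp q _ _ (h.append _ _) (h.append _ _) (h.append _ _)

/-- All swaps whose support is not all of `Ω` have the same image in an abelian group. -/
theorem map_swap_eq_of_free {u v z u' v' z' : List (Fin d)} (h : Incomp u v) (hu : Incomp u z)
    (hv : Incomp v z) (h' : Incomp u' v') (hu' : Incomp u' z') (hv' : Incomp v' z')
    {x y : Fin d} (hxy : x ≠ y) : q (s.swap h) = q (s.swap h') := by
  -- one of the two cylinders of the first swap is disjoint from one of those of the second
  by_cases huu : Incomp u u'
  · rw [map_swap_eq_inside q h hu hv hxy, map_swap_eq_inside q h' hu' hv' hxy,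
      map_swap_inside_eq q huu hxy]
  by_cases hp : u <+: u'
  · obtain ⟨t, rfl⟩ := hp
    rw [← swap_symm, map_swap_eq_inside q h.symm hv hu hxy, map_swap_eq_inside q h' hu' hv' hxy,
      map_swap_inside_eq q (h.symm.append_right t) hxy]
  · have hp' : u' <+: u := by
      by_contra hp'
      exact huu ⟨hp, hp'⟩
    obtain ⟨t, rfl⟩ := hp'
    rw [map_swap_eq_inside q h hu hv hxy, ← swap_symm (h := h'),
      map_swap_eq_inside q h'.symm hv' hu' hxy, map_swap_inside_eq q (h'.append_left t) hxy]

variable (hd : 2 ≤ d)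

/-- The image of the swaps of cylinders under a homomorphism to an abelian group. -/
def swapVal : B :=
  q (s.swap (Incomp.of_ne (x := (⟨0, by omega⟩ : Fin d)) (y := ⟨1, by omega⟩) (by simp)
    [⟨0, by omega⟩]))

/-- All swaps of cylinders have the same image in an abelian group. It equals its own `d`-th
power, as a swap is the product of `d` swaps of smaller cylinders. -/
theorem map_swap_and_pow : (∀ {u v : List (Fin d)} (h : Incomp u v), q (s.swap h) =
    swapVal q hd) ∧ swapVal q hd ^ d = swapVal q hd := by
  let x : Fin d := ⟨0, by omega⟩
  let y : Fin d := ⟨1, by omega⟩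
  have hxy : x ≠ y := by simp [x, y]
  have hfree : ∀ {u v z : List (Fin d)} (h : Incomp u v), Incomp u z → Incomp v z →
      q (s.swap h) = swapVal q hd := fun h hu hv =>
    map_swap_eq_of_free q h hu hv _ (z' := [y])
      ((Incomp.of_ne hxy []).append_left [x]) ((Incomp.of_ne hxy []).append_left [y]) hxy
  have hpow : ∀ {u v : List (Fin d)} (h : Incomp u v), q (s.swap h) = swapVal q hd ^ d := by
    intro u v h
    rw [swap_eq_prod, map_list_prod, List.map_map, List.prod_eq_pow_card _ (swapVal q hd)]
    · simp
    · simp only [List.mem_map, List.mem_finRange, true_and, Function.comp_apply,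
        forall_exists_index, forall_apply_eq_imp_iff]
      intro a
      obtain ⟨b, hb⟩ : ∃ b : Fin d, a ≠ b := by
        have : Nontrivial (Fin d) := Fin.nontrivial_iff_two_le.2 hd
        obtain ⟨b, hb⟩ := exists_ne a
        exact ⟨b, hb.symm⟩
      exact hfree _ (z := u ++ [b]) (Incomp.of_ne hb u) (h.symm.append _ _)
  have h₁ := hpow (Incomp.of_ne hxy [x])
  have h₂ := hfree (Incomp.of_ne hxy [x]) (z := [y])
      ((Incomp.of_ne hxy []).append_left [x]) ((Incomp.of_ne hxy []).append_left [y])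
  exact ⟨fun h => (hpow h).trans (h₁.symm.trans h₂), h₁.symm.trans h₂⟩

theorem swapVal_mul_self : swapVal q hd * swapVal q hd = 1 := by
  rw [swapVal, ← map_mul, swap_mul_self, map_one]

theorem map_localHom_of_incomp {u v : List (Fin d)} (h : Incomp u v) (k : s.V) :
    q (s.localHom u k) = q (s.localHom v k) := by
  have := congrArg q (mul_localHom k (s.swap h) (swapPerm_germ_left h))
  rwa [map_mul, map_mul, mul_comm, mul_right_cancel_iff] at this

/-- The copies of an element on any two proper cylinders have the same image in an abelian
group. -/
theorem map_localHom_eq (hd : 2 ≤ d) {u v : List (Fin d)} (hu : u ≠ []) (hv : v ≠ [])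
    (k : s.V) : q (s.localHom u k) = q (s.localHom v k) := by
  have key : ∀ {u : List (Fin d)}, u ≠ [] → ∀ t, q (s.localHom (u ++ t) k) =
      q (s.localHom u k) := by
    intro u hu t
    obtain ⟨x, u, rfl⟩ := List.exists_cons_of_ne_nil hu
    have : Nontrivial (Fin d) := Fin.nontrivial_iff_two_le.2 hd
    obtain ⟨y, hy⟩ := exists_ne x
    have h : Incomp (x :: u) [y] := (Incomp.of_ne hy.symm []).append_left u
    rw [map_localHom_of_incomp q h, map_localHom_of_incomp q (h.append_left t)]
  by_cases h : Incomp u v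
  · exact map_localHom_of_incomp q h k
  by_cases hp : u <+: v
  · obtain ⟨t, rfl⟩ := hp
    exact (key hu t).symm
  · have hp' : v <+: u := by
      by_contra hp'
      exact h ⟨hp, hp'⟩
    obtain ⟨t, rfl⟩ := hp'
    exact key hv t

theorem sgn_mul {X : Type*} [Fintype X] [DecidableEq X] {τ : B} (hτ : τ * τ = 1)
    (π π' : Equiv.Perm X) : sgn τ (π * π') = sgn τ π * sgn τ π' := by
  unfold sgn
  rw [map_mul]
  rcases Int.units_eq_one_or (Equiv.Perm.sign π) with h | h <;>
    rcases Int.units_eq_one_or (Equiv.Perm.sign π') with h' | h' <;> simp [h, h', hτ]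

theorem map_localHom_rootHom (v : List (Fin d)) (π : Equiv.Perm (Fin d)) :
    q (s.localHom v (s.rootHom π)) = sgn (swapVal q hd) π := by
  induction π using Equiv.Perm.swap_induction_on with
  | one => simp [sgn]
  | swap_mul π x y hxy ih =>
    rw [map_mul, map_mul, map_mul, ih, sgn_mul (swapVal_mul_self q hd),
      localHom_rootHom_swap v hxy, (map_swap_and_pow q hd).1]
    simp [sgn, Equiv.Perm.sign_swap hxy]

/-- Every homomorphism from `V` to an abelian group restricts to a cocycle: its values on the
elements supported on proper cylinders and on the swaps of cylinders. -/
def cocycleOf : s.Cocycle B where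
  c := q.comp ((s.localHom [⟨0, by omega⟩]).comp s.actHom)
  τ := swapVal q hd
  τ_mul := swapVal_mul_self q hd
  τ_pow := (map_swap_and_pow q hd).2
  c_eq g := by
    simp only [MonoidHom.comp_apply]
    conv_lhs => rw [actHom_eq]
    rw [map_mul, map_mul, map_localHom_rootHom q hd, mul_comm, Fin.prod_univ_def]
    congr 1
    rw [map_list_prod, map_list_prod, List.map_map, List.map_map]
    congr 1
    refine List.map_congr_left fun x _ => ?_
    simp only [Function.comp_apply]
    rw [← localHom_append]
    exact map_localHom_eq q hd (by simp) (by simp) _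

end Classes

variable [Nonempty Ω]

/-! ### Generation by swaps and elements supported on one cylinder -/

theorem card_level (n : ℕ) : (level d n).card = d ^ n := by
  rw [← Set.ncard_coe_finset, ← Nat.card_coe_set_eq]
  have e : ((level d n : Finset (List (Fin d))) : Set (List (Fin d))) ≃ List.Vector (Fin d) n :=
    Equiv.subtypeEquivRight fun v => by simp
  rw [Nat.card_congr e, Nat.card_eq_fintype_card, card_vector, Fintype.card_fin]

/-- Kraft's equality for a partition into cylinders. -/
theorem IsPartition.sum_pow {P : Finset (List (Fin d))} (hP : s.IsPartition P) {N : ℕ}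
    (hN : ∀ u ∈ P, u.length ≤ N) : ∑ u ∈ P, d ^ (N - u.length) = d ^ N := by
  have h : level d N = P.biUnion fun u => (level d (N - u.length)).image (u ++ ·) := by
    ext v
    simp only [mem_level, Finset.mem_biUnion, Finset.mem_image]
    constructor
    · rintro rfl
      obtain ⟨u, hu, a, ha⟩ := hP.cover (s.pre v (Classical.arbitrary Ω))
      have : u <+: v := by
        rcases comparable_of_pre_eq ha with h | h
        · exact h
        · exact h.eq_of_length_le (hN u hu) ▸ List.prefix_rfl
      obtain ⟨t, rfl⟩ := this
      exact ⟨u, hu, t, by simp, rfl⟩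
    · rintro ⟨u, hu, t, ht, rfl⟩
      have := hN u hu
      simp [ht]
      omega
  rw [← card_level, h, Finset.card_biUnion]
  · refine Finset.sum_congr rfl fun u _ => ?_
    rw [Finset.card_image_of_injective _ (List.append_right_injective u), card_level]
  · intro u hu v hv hne
    refine Finset.disjoint_left.2 ?_
    rintro _ hz hz'
    obtain ⟨t, -, rfl⟩ := Finset.mem_image.1 hz
    obtain ⟨t', -, e⟩ := Finset.mem_image.1 hz'
    exact ((hP.incomp u hu v hv hne).append t t').ne e.symm

/-- If all words of level `n` have targets of length at least `n`, or all have targets of length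
at most `n`, then all targets have length `n`. -/
theorem length_target_eq (hd : 2 ≤ d) {h : Equiv.Perm Ω} {n : ℕ}
    (hgood : ∀ v ∈ level d n, ∃ u γ, s.Germ h v u γ)
    (H : (∀ v ∈ level d n, n ≤ (s.target h v).length) ∨
      ∀ v ∈ level d n, (s.target h v).length ≤ n) {v : List (Fin d)} (hv : v ∈ level d n) :
    (s.target h v).length = n := by
  obtain ⟨hP, hinj⟩ := (isPartition_level (s := s) n).image hd hgood
  obtain ⟨N, hN⟩ := (((level d n).image (s.target h)).finite_toSet.image List.length).bddAbove
  have hN' : ∀ v ∈ level d n, (s.target h v).length ≤ max N n := fun v hv =>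
    le_max_of_le_left (hN ⟨_, Finset.mem_image_of_mem _ hv, rfl⟩)
  have h₁ : ∑ v ∈ level d n, d ^ (max N n - (s.target h v).length) =
      ∑ v ∈ level d n, d ^ (max N n - n) := by
    rw [← Finset.sum_image (f := fun u => d ^ (max N n - u.length)) hinj,
      hP.sum_pow (by simpa using hN'), Finset.sum_const, card_level, smul_eq_mul, ← pow_add]
    congr 1
    have := le_max_right N n
    omega
  have h₂ : d ^ (max N n - (s.target h v).length) = d ^ (max N n - n) := by
    rcases H with H | H
    · exact (Finset.sum_eq_sum_iff_of_le fun v hv => Nat.pow_le_pow_right (by omega)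
        (by have := H v hv; omega)).1 h₁ v hv
    · exact ((Finset.sum_eq_sum_iff_of_le fun v hv => Nat.pow_le_pow_right (by omega)
        (by have := H v hv; omega)).1 h₁.symm v hv).symm
  have h₃ := Nat.pow_right_injective hd h₂
  have h₄ := hN' v hv
  have h₅ := le_max_right N n
  omega

/-- An element of `V` that permutes the cylinders of some level lies in every subgroup containing
the swaps and the copies of the elements of `G`: by these it is made trivial on one cylinder after
another. -/
theorem mem_of_length_target_eq {K : Subgroup s.V}
    (hswap : ∀ {u v : List (Fin d)} (h : Incomp u v), s.swap h ∈ K)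
    (hlocal : ∀ v ≠ [], ∀ g, s.localHom v (s.actHom g) ∈ K) {n : ℕ} (hn : n ≠ 0) (h : s.V)
    (hgood : ∀ v ∈ level d n, ∃ u ∈ level d n, ∃ γ, s.Germ (h : Equiv.Perm Ω) v u γ) :
    h ∈ K := by
  classical
  induction hk : ((level d n).filter fun v => ¬ s.Germ (h : Equiv.Perm Ω) v v 1).card using
    Nat.strong_induction_on generalizing h with
  | _ k ih =>
    by_cases hall : ∀ v ∈ level d n, s.Germ (h : Equiv.Perm Ω) v v 1
    · have : h = 1 := Subtype.ext (Germ.eq_of_forall n fun v hv =>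
        ⟨v, 1, hall v (by simpa using hv), Germ.one v⟩)
      exact this ▸ K.one_mem
    push Not at hall
    obtain ⟨v₀, hv₀, hid⟩ := hall
    obtain ⟨u, hu, γ, H⟩ := hgood v₀ hv₀
    have hinc : ∀ v ∈ level d n, ∀ v' ∈ level d n, v ≠ v' → Incomp v v' :=
      (isPartition_level (s := s) n).incomp
    -- an element `r` of `K` such that `r * h` is the identity on the cylinder of `v₀`
    obtain ⟨r, hr, hr₀, hrs, hr'⟩ : ∃ r ∈ K, s.Germ ((r * h : s.V) : Equiv.Perm Ω) v₀ v₀ 1 ∧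
        (∀ v ∈ level d n, v ≠ v₀ → v ≠ u → s.Germ (r : Equiv.Perm Ω) v v 1) ∧
        ∀ v ∈ level d n, ∃ v' ∈ level d n, ∃ γ, s.Germ (r : Equiv.Perm Ω) v v' γ := by
      have hl : ∀ v ∈ level d n, v ≠ v₀ →
          s.Germ (s.localHom v₀ (s.actHom γ⁻¹) : Equiv.Perm Ω) v v 1 := fun v hv hne =>
        localPerm_germ_of_incomp (hinc v₀ hv₀ v hv hne.symm) _
      have hl₀ : s.Germ (s.localHom v₀ (s.actHom γ⁻¹) : Equiv.Perm Ω) v₀ v₀ γ⁻¹ := by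
        simpa using localPerm_germ (v := v₀) (actHom_germ (s := s) γ⁻¹)
      have hlK := hlocal v₀ (by rintro rfl; simp at hv₀; omega) γ⁻¹
      by_cases huv : u = v₀
      · subst huv
        refine ⟨_, hlK, ?_, fun v hv hne _ => hl v hv hne, fun v hv => ?_⟩
        · have := hl₀.mul H
          rwa [inv_mul_cancel] at this
        · by_cases hne : v = u
          · subst hne
            exact ⟨v, hu, _, hl₀⟩
          · exact ⟨v, hv, _, hl v hv hne⟩
      · have i := hinc u hu v₀ hv₀ huv
        refine ⟨s.localHom v₀ (s.actHom γ⁻¹) * s.swap i, K.mul_mem hlK (hswap i), ?_,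
          fun v hv hne hne' => ?_, fun v hv => ?_⟩
        · have := (hl₀.mul (swapPerm_germ_left i)).mul H
          rwa [mul_one, inv_mul_cancel] at this
        · have := (hl v hv hne).mul (swapPerm_germ_of_incomp i (hinc u hu v hv hne'.symm)
            (hinc v₀ hv₀ v hv hne.symm))
          rwa [mul_one] at this
        · by_cases hne : v = v₀
          · subst hne
            exact ⟨u, hu, _, (hl u hu huv).mul (swapPerm_germ_right i)⟩
          by_cases hne' : v = u
          · subst hne'
            exact ⟨v₀, hv₀, _, hl₀.mul (swapPerm_germ_left i)⟩
          · exact ⟨v, hv, _, (hl v hv hne).mul (swapPerm_germ_of_incomp i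
              (hinc u hu v hv (Ne.symm hne')) (hinc v₀ hv₀ v hv (Ne.symm hne)))⟩
    suffices r * h ∈ K by simpa using K.mul_mem (K.inv_mem hr) this
    refine ih _ ?_ (r * h) (fun v hv => ?_) rfl
    · rw [← hk]
      refine Finset.card_lt_card ⟨fun v hv => ?_, fun hsub => ?_⟩
      · rw [Finset.mem_filter] at hv ⊢
        refine ⟨hv.1, fun hv' => hv.2 ?_⟩
        have h₁ : v ≠ v₀ := by
          rintro rfl
          exact hid hv'
        have h₂ : v ≠ u := by
          rintro rfl
          exact (hv'.incomp H (hinc v hv.1 v₀ hv₀ h₁)).ne rfl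
        simpa using (hrs v hv.1 h₁ h₂).mul hv'
      · have := hsub (Finset.mem_filter.2 ⟨hv₀, hid⟩)
        exact (Finset.mem_filter.1 this).2 hr₀
    · obtain ⟨v', hv', γ', H'⟩ := hgood v hv
      obtain ⟨v'', hv'', γ'', H''⟩ := hr' v' hv'
      exact ⟨v'', hv'', _, H''.mul H'⟩

/-- The group `V` is generated by the swaps of cylinders and the copies of the elements of `G` on
proper cylinders. -/
theorem mem_of_swap_of_local (hd : 2 ≤ d) {K : Subgroup s.V}
    (hswap : ∀ {u v : List (Fin d)} (h : Incomp u v), s.swap h ∈ K)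
    (hlocal : ∀ v ≠ [], ∀ g, s.localHom v (s.actHom g) ∈ K) (h : s.V) : h ∈ K := by
  obtain ⟨n, hn, hgood⟩ : ∃ n, n ≠ 0 ∧ ∀ v ∈ level d n, ∃ u γ, s.Germ (h : Equiv.Perm Ω) v u γ := by
    obtain ⟨n, hn⟩ := h.2
    exact ⟨n + 1, by omega, fun v hv => exists_germ_of_le hn (by rw [mem_level.1 hv]; omega)⟩
  -- exchanging a cylinder that contains a long target with a short target decreases the sum
  induction hk : ∑ v ∈ level d n, 2 ^ (s.target (h : Equiv.Perm Ω) v).length using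
    Nat.strong_induction_on generalizing h with
  | _ k ih =>
    by_cases hlen : (∀ v ∈ level d n, n ≤ (s.target (h : Equiv.Perm Ω) v).length) ∨
        ∀ v ∈ level d n, (s.target (h : Equiv.Perm Ω) v).length ≤ n
    · refine mem_of_length_target_eq hswap hlocal hn h fun v hv => ?_
      obtain ⟨u, γ, H⟩ := hgood v hv
      refine ⟨u, ?_, γ, H⟩
      rw [mem_level, ← H.target_eq hd]
      exact length_target_eq hd hgood hlen hv
    push Not at hlen
    obtain ⟨⟨v₁, hv₁, hlt₁⟩, v₂, hv₂, hlt₂⟩ := hlen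
    obtain ⟨v₀, hv₀, hmax⟩ := (level d n).exists_max_image
      (fun v => (s.target (h : Equiv.Perm Ω) v).length) ⟨_, hv₁⟩
    have hlt₀ := hlt₂.trans_le (hmax v₂ hv₂)
    obtain ⟨u₀, γ₀, H₀⟩ := hgood v₀ hv₀
    obtain ⟨u₁, γ₁, H₁⟩ := hgood v₁ hv₁
    rw [H₀.target_eq hd] at hmax hlt₀
    rw [H₁.target_eq hd] at hlt₁
    have hne₀₁ : v₀ ≠ v₁ := by
      rintro rfl
      rw [← H₀.target_eq hd, H₁.target_eq hd] at hlt₀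
      omega
    have hinc : ∀ v ∈ level d n, ∀ v' ∈ level d n, v ≠ v' → Incomp v v' :=
      (isPartition_level (s := s) n).incomp
    have i₀₁ : Incomp u₀ u₁ := H₀.incomp H₁ (hinc v₀ hv₀ v₁ hv₁ hne₀₁)
    obtain ⟨p, x, rfl⟩ : ∃ p x, u₀ = p ++ [x] := by
      rcases List.eq_nil_or_concat' u₀ with rfl | ⟨p, x, e⟩
      · simp at hlt₀
      · exact ⟨p, x, e⟩
    rw [List.length_append, List.length_singleton] at hlt₀ hmax
    have i : Incomp p u₁ := by
      refine ⟨fun h' => ?_, fun h' => i₀₁.2 (h'.trans (List.prefix_append _ _))⟩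
      have := h'.length_le
      omega
    have hg' : ∀ v ∈ level d n, ∃ u γ u', s.Germ (h : Equiv.Perm Ω) v u γ ∧
        s.Germ ((s.swap i * h : s.V) : Equiv.Perm Ω) v u' γ ∧ (v ≠ v₁ → u'.length ≤ u.length) := by
      intro v hv
      obtain ⟨u, γ, H⟩ := hgood v hv
      by_cases hv' : v = v₁
      · subst hv'
        obtain rfl : u = u₁ := (H.target_eq hd).symm.trans (H₁.target_eq hd)
        exact ⟨_, γ, p, H, one_mul γ ▸ (swapPerm_germ_right i).mul H, fun h => absurd rfl h⟩
      have hu : Incomp u u₁ := H.incomp H₁ (hinc v hv v₁ hv₁ hv')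
      by_cases hpu : p <+: u
      · obtain ⟨t, rfl⟩ := hpu
        refine ⟨_, γ, u₁ ++ t, H, one_mul γ ▸ (germ_one_append (swapPerm_germ_left i) t).mul H,
          fun _ => ?_⟩
        simp only [List.length_append]
        omega
      · have hpu' : Incomp p u := by
          refine ⟨hpu, fun h' => ?_⟩
          by_cases hvv : v = v₀
          · subst hvv
            obtain rfl : u = p ++ [x] := (H.target_eq hd).symm.trans (H₀.target_eq hd)
            exact hpu (List.prefix_append _ _)
          · exact (H.incomp H₀ (hinc v hv v₀ hv₀ hvv)).1 (h'.trans (List.prefix_append _ _))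
        exact ⟨u, γ, u, H, one_mul γ ▸ (swapPerm_germ_of_incomp i hpu' hu.symm).mul H,
          fun _ => le_rfl⟩
    suffices s.swap i * h ∈ K by simpa using K.mul_mem (K.inv_mem (hswap i)) this
    refine ih _ ?_ (s.swap i * h) (fun v hv => ?_) rfl
    · have e₀ : s.target ((s.swap i * h : s.V) : Equiv.Perm Ω) v₀ = u₁ ++ [x] :=
        ((germ_one_append (swapPerm_germ_left i) [x]).mul H₀).target_eq hd
      have e₁ : s.target ((s.swap i * h : s.V) : Equiv.Perm Ω) v₁ = p :=
        ((swapPerm_germ_right i).mul H₁).target_eq hd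
      have hv₁' : v₁ ∈ (level d n).erase v₀ := Finset.mem_erase.2 ⟨hne₀₁.symm, hv₁⟩
      rw [← hk, ← Finset.add_sum_erase _ _ hv₀, ← Finset.add_sum_erase _ _ hv₀,
        ← Finset.add_sum_erase _ _ hv₁', ← Finset.add_sum_erase _ _ hv₁', e₀, e₁,
        H₀.target_eq hd, H₁.target_eq hd, ← add_assoc, ← add_assoc]
      refine add_lt_add_of_lt_of_le ?_ (Finset.sum_le_sum fun v hv => ?_)
      · have : 2 ^ u₁.length < 2 ^ p.length := Nat.pow_lt_pow_right (by norm_num) (by omega)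
        simp only [List.length_append, List.length_singleton, pow_succ]
        omega
      · simp only [Finset.mem_erase] at hv
        obtain ⟨u, γ, u', K₁, K₂, hle⟩ := hg' v hv.2.2
        rw [K₁.target_eq hd, K₂.target_eq hd]
        exact Nat.pow_le_pow_right (by norm_num) (hle hv.1)
    · obtain ⟨u, γ, u', K₁, K₂, -⟩ := hg' v hv
      exact ⟨_, _, K₂⟩

/-- A homomorphism from `V` to an abelian group is determined by its cocycle. -/
theorem hom_ext {B : Type*} [CommGroup B] (hd : 2 ≤ d) {q q' : s.V →* B}
    (hτ : swapVal q hd = swapVal q' hd)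
    (hc : (cocycleOf q hd).c = (cocycleOf q' hd).c) : q = q' := by
  ext h
  refine mem_of_swap_of_local (K := q.eqLocus q') hd (fun h => ?_) (fun v hv g => ?_) h
  · exact ((map_swap_and_pow q hd).1 h).trans (hτ.trans ((map_swap_and_pow q' hd).1 h).symm)
  · refine (map_localHom_eq q hd hv (v := [⟨0, by omega⟩]) (by simp) _).trans
      (Eq.trans (DFunLike.congr_fun hc g) (map_localHom_eq q' hd (by simp) hv _))

namespace Cocycle

variable {A : Type*} [CommGroup A] {C : s.Cocycle A}

theorem germVal_of_one (hd : 2 ≤ d) (hC : C.IsFaithful) {h : Equiv.Perm Ω}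
    {u v : List (Fin d)} (H : s.Germ h v u 1) : C.germVal h v = 1 := by
  rw [H.germVal_eq hd hC, map_one]

theorem swapVal_hom (hd : 2 ≤ d) (hC : C.IsFaithful) : swapVal (hom hd C hC) hd = C.τ := by
  have hne : (⟨0, by omega⟩ : Fin d) ≠ ⟨1, by omega⟩ := by simp
  -- compute with the transposition of two of the `d` copies of `Ω`
  rw [← (map_swap_and_pow (hom hd C hC) hd).1 (Incomp.of_ne hne []), ← localHom_rootHom_swap [] hne]
  have hloc (k : s.V) : s.localHom [] k = k := Subtype.ext (Equiv.ext fun w =>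
    localPerm_pre (s := s) [] (k : Equiv.Perm Ω) w)
  set π := Equiv.swap (⟨0, by omega⟩ : Fin d) ⟨1, by omega⟩ with hπ
  have hlev : level d 1 = Finset.univ.image fun x : Fin d => [x] := by
    ext v
    simp [List.length_eq_one_iff, eq_comm]
  have hinj : Function.Injective fun x : Fin d => [x] := fun x y h => by simpa using h
  rw [hloc, hom_eq hd hC _ (isPartition_level 1)]
  · have e : sgn C.τ π = C.τ := by simp [sgn, hπ, Equiv.Perm.sign_swap hne]
    rw [total, hlev, Finset.prod_image hinj.injOn]
    conv_rhs => rw [← e, sgn_eq_pairProd C.τ_mul]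
    rw [Finset.prod_congr rfl fun x _ => germVal_of_one hd hC (rootHom_germ π x),
      Finset.prod_const_one, one_mul]
    unfold pairProd
    rw [Finset.prod_image hinj.injOn]
    refine Finset.prod_congr rfl fun x _ => ?_
    rw [Finset.prod_image hinj.injOn]
    refine Finset.prod_congr rfl fun y _ => ?_
    have hlt (x y : Fin d) : [x] < [y] ↔ x < y := append_singleton_lt [] x y
    simp only [inversion, (rootHom_germ (s := s) π x).target_eq hd,
      (rootHom_germ (s := s) π y).target_eq hd, hlt]
    by_cases hxy : x < y <;> simp [hxy]
  · intro v hv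
    rw [hlev] at hv
    obtain ⟨x, -, rfl⟩ := Finset.mem_image.1 hv
    exact ⟨_, _, rootHom_germ π x⟩

theorem cocycleOf_hom_c (hd : 2 ≤ d) (hC : C.IsFaithful) :
    (cocycleOf (hom hd C hC) hd).c = C.c := by
  ext g
  change hom hd C hC (s.localHom [⟨0, by omega⟩] (s.actHom g)) = _
  have H₀ : s.Germ (s.localHom [⟨0, by omega⟩] (s.actHom g) : Equiv.Perm Ω) [⟨0, by omega⟩]
      [⟨0, by omega⟩] g := by
    simpa using localPerm_germ (v := [⟨0, by omega⟩]) (actHom_germ (s := s) g)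
  have H : ∀ v ∈ level d 1, v ≠ [⟨0, by omega⟩] →
      s.Germ (s.localHom [⟨0, by omega⟩] (s.actHom g) : Equiv.Perm Ω) v v 1 := fun v hv hne =>
    localPerm_germ_of_incomp ((isPartition_level (s := s) 1).incomp _ (by simp) v hv hne.symm) _
  have H' : ∀ v ∈ level d 1, ∃ γ,
      s.Germ (s.localHom [⟨0, by omega⟩] (s.actHom g) : Equiv.Perm Ω) v v γ := by
    intro v hv
    by_cases hne : v = [⟨0, by omega⟩]
    · exact ⟨g, hne ▸ H₀⟩
    · exact ⟨1, H v hv hne⟩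
  rw [hom_eq hd hC _ (isPartition_level 1) fun v hv => ⟨v, H' v hv⟩, total,
    Finset.prod_eq_single [⟨0, by omega⟩] (fun v hv hne => germVal_of_one hd hC (H v hv hne))
      (fun h => absurd (by simp) h), H₀.germVal_eq hd hC]
  have : pairProd (level d 1)
      (C.inversion (s.localHom [⟨0, by omega⟩] (s.actHom g) : Equiv.Perm Ω)) = 1 := by
    refine Finset.prod_eq_one fun v hv => Finset.prod_eq_one fun v' hv' => ?_
    obtain ⟨γ, K⟩ := H' v hv
    obtain ⟨γ', K'⟩ := H' v' hv'
    simp only [inversion, K.target_eq hd, K'.target_eq hd, if_true, ite_self]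
  rw [this, mul_one]

/-- The homomorphism defined by a cocycle that is universal, and whose values generate, is the
abelianization of `V`. -/
theorem nonempty_abelianization_equiv (hd : 2 ≤ d) (hC : C.IsFaithful)
    (huniv : ∀ D : s.Cocycle (Abelianization s.V), ∃ φ : A →* Abelianization s.V,
      φ.comp C.c = D.c ∧ φ C.τ = D.τ)
    (hext : ∀ φ φ' : A →* A, φ.comp C.c = φ'.comp C.c → φ C.τ = φ' C.τ → φ = φ') :
    Nonempty (Abelianization s.V ≃* A) := by
  let q : s.V →* Abelianization s.V := Abelianization.of
  let Φ : Abelianization s.V →* A := Abelianization.lift (hom hd C hC)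
  obtain ⟨φ, h₁, h₂⟩ := huniv (cocycleOf q hd)
  have hτ : swapVal (hom hd C hC) hd = C.τ := swapVal_hom hd hC
  have hc : (cocycleOf (hom hd C hC) hd).c = C.c := cocycleOf_hom_c hd hC
  have e₁ : φ.comp (hom hd C hC) = q := by
    refine hom_ext hd ?_ ?_
    · change φ (swapVal (hom hd C hC) hd) = _
      rw [hτ, h₂]
      rfl
    · change φ.comp (cocycleOf (hom hd C hC) hd).c = _
      rw [hc, h₁]
  have hΦ : ∀ h, Φ (q h) = hom hd C hC h := fun h => Abelianization.lift_apply_of _ h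
  refine ⟨MonoidHom.toMulEquiv Φ φ ?_ ?_⟩
  · refine Abelianization.hom_ext _ _ ?_
    ext h
    change φ (Φ (q h)) = q h
    rw [hΦ, ← e₁]
    rfl
  · refine hext _ _ ?_ ?_
    · ext g
      change Φ (φ (C.c g)) = C.c g
      have : φ (C.c g) = q (s.localHom [⟨0, by omega⟩] (s.actHom g)) := DFunLike.congr_fun h₁ g
      rw [this, hΦ]
      exact DFunLike.congr_fun hc g
    · change Φ (φ C.τ) = C.τ
      rw [h₂]
      exact (hΦ _).trans hτ

end Cocycle

end SelfSimilar

/-! ### The action of the fundamental groupoid on the boundaries of the trees -/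

section Boundary

universe u

variable {M : Type u} {M₁ : Set M} {f : M₁ → M}

/-- The element of `∂T_t` that begins with the edge from `t` to its preimage `p` and continues
as the given element of `∂T_p`. -/
def Boundary.cons {t : M} (p : M₁) (hp : f p = t) (z : Boundary f (p : M)) : Boundary f t where
  vertex
    | 0 => t
    | k + 1 => z.vertex k
  vertex_zero := rfl
  mem
    | 0 => by
      change z.vertex 0 ∈ M₁
      rw [z.vertex_zero]
      exact p.2
    | k + 1 => z.mem k
  map_succ
    | 0 => by
      rw [← hp]
      congr 1
      exact Subtype.ext z.vertex_zero
    | k + 1 => z.map_succ k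

@[simp] theorem Boundary.cons_vertex_succ {t : M} (p : M₁) (hp : f p = t)
    (z : Boundary f (p : M)) (k : ℕ) : (Boundary.cons p hp z).vertex (k + 1) = z.vertex k := rfl

theorem Boundary.cons_injective {t : M} (p : M₁) (hp : f p = t) :
    Function.Injective (Boundary.cons p hp) := fun _ _ h =>
  Boundary.ext (funext fun k => congrArg (fun w => w.vertex (k + 1)) h)

theorem Boundary.exists_cons {t : M} (w : Boundary f t) :
    ∃ (p : M₁) (hp : f p = t) (z : Boundary f (p : M)), Boundary.cons p hp z = w := by
  refine ⟨⟨w.vertex 1, w.mem 0⟩, (w.map_succ 0).trans w.vertex_zero, w.tail 1 rfl, ?_⟩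
  ext k
  cases k with
  | zero => exact w.vertex_zero.symm
  | succ k => exact congrArg w.vertex (Nat.add_comm 1 k)

variable [TopologicalSpace M]

theorem liftTower_homotopicRel (hf : IsCoveringMap f) {x y : M} {γ γ' : Path x y}
    (h : γ.Homotopic γ') (w : Boundary f x) (k : ℕ) :
    (liftTower hf γ w k).1.HomotopicRel (liftTower hf γ' w k).1 {0, 1} := by
  induction k with
  | zero => exact h
  | succ k ih =>
    exact (hf.homotopicRel_liftPath ih ⟨w.vertex (k + 1), w.mem k⟩ _ _).map fun H =>
      H.compContinuousMap ⟨Subtype.val, continuous_subtype_val⟩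

theorem S_homotopic (hf : IsCoveringMap f) {x y : M} {γ γ' : Path x y} (h : γ.Homotopic γ') :
    S hf γ = S hf γ' := by
  ext w k
  obtain ⟨H⟩ := liftTower_homotopicRel hf h w k
  exact (H.eq_fst 0 (x := 1) (by simp)).symm.trans (H.eq_snd 0 (by simp))

theorem S_symm' (hf : IsCoveringMap f) {x y : M} (γ : Path x y) (w : Boundary f x) :
    S hf γ.symm (S hf γ w) = w := by
  simpa using S_symm hf γ.symm w

theorem S_injective (hf : IsCoveringMap f) {x y : M} (γ : Path x y) :
    Function.Injective (S hf γ) :=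
  Function.LeftInverse.injective (S_symm' hf γ)

/-- The recursion satisfied by `S`: after the first edge, it is given by the lifts of the path. -/
theorem S_cons (hf : IsCoveringMap f) {x y : M} (γ : Path x y) (p p' : M₁) (hp : f p = x)
    (hp' : f p' = y) (δ : Path (p : M) (p' : M)) (hδ : IsLift f δ γ) (z : Boundary f (p : M)) :
    S hf γ (Boundary.cons p hp z) = Boundary.cons p' hp' (S hf δ z) := by
  ext k
  refine (S_vertex_eq hf γ _ (fun
    | 0 => γ
    | k + 1 => (liftTower hf δ z k).1) rfl ?_ ?_ k).trans ?_
  · rintro (_ | k)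
    · exact hδ
    · exact liftTower_isLift hf δ z k
  · rintro (_ | k)
    · exact γ.source
    · exact (liftTower hf δ z k).2
  · cases k with
    | zero => exact γ.target
    | succ k => rfl

theorem liftTower_congr (hf : IsCoveringMap f) {x y : M} (γ : Path x y) {w w' : Boundary f x}
    {k : ℕ} (h : w.vertex k = w'.vertex k) :
    (liftTower hf γ w k).1 = (liftTower hf γ w' k).1 := by
  induction k with
  | zero => rfl
  | succ k ih =>
    have ih := ih (Boundary.vertex_eq_of_succ h)
    refine (liftTower_isLift hf γ w k).unique hf (ih ▸ liftTower_isLift hf γ w' k) ?_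
    rw [(liftTower hf γ w (k + 1)).2, (liftTower hf γ w' (k + 1)).2, h]

/-- On the elements passing through a vertex `a` of level `n`, the map `S_γ` is given by the lift
of `γ` by `fⁿ` starting at `a`. -/
theorem exists_S_vertex_add (hf : IsCoveringMap f) {x y : M} (γ : Path x y) (n : ℕ) {a : M}
    (w₀ : Boundary f x) (h₀ : w₀.vertex n = a) :
    ∃ (b : M) (δ : Path a b), ∀ (w : Boundary f x) (h : w.vertex n = a) (k : ℕ),
      (S hf γ w).vertex (n + k) = (S hf δ (w.tail n h)).vertex k := by
  subst h₀
  refine ⟨_, liftedPath hf γ w₀ n, fun w h k => ?_⟩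
  refine (S_vertex_eq hf (liftedPath hf γ w₀ n) _ (fun k => (liftTower hf γ w (n + k)).1) ?_
    (fun k => liftTower_isLift hf γ w (n + k)) (fun k => (liftTower hf γ w (n + k)).2) k).symm
  exact liftTower_congr hf γ h

theorem S_cast_tail (hf : IsCoveringMap f) {t x y x' y' : M} (δ : Path x y) (hx : x' = x)
    (hy : y' = y) (w : Boundary f t) {n : ℕ} (h' : w.vertex n = x') (h : w.vertex n = x) (k : ℕ) :
    (S hf (δ.cast hx hy) (w.tail n h')).vertex k = (S hf δ (w.tail n h)).vertex k := by
  subst hx hy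
  rfl

end Boundary

/-! ### The self-similar action of the fundamental group -/

section Action

universe u

variable {M : Type u} [TopologicalSpace M] {M₁ : Set M} {f : M₁ → M} {d : ℕ}

/-- The boundary `∂T_t`, as a set on which the fundamental group acts. -/
def Ends (_ : IsPartialSelfCovering f d) (t : M) : Type u := Boundary f t

instance (hf : IsPartialSelfCovering f d) (t : M) :
    MulAction (FundamentalGroup M t) (Ends hf t) where
  smul g w := Quotient.lift (fun γ : Path t t => S hf.isCoveringMap γ w)
    (fun _ _ h => congrFun (S_homotopic hf.isCoveringMap h) w) g
  one_smul w := S_refl hf.isCoveringMap w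
  mul_smul g h w := by
    induction g using Quotient.inductionOn with | _ γ
    induction h using Quotient.inductionOn with | _ δ
    exact S_trans hf.isCoveringMap δ γ w

theorem mk_smul (hf : IsPartialSelfCovering f d) {t : M} (γ : Path t t) (w : Ends hf t) :
    (FundamentalGroup.fromPath (Path.Homotopic.Quotient.mk γ)) • w =
      S hf.isCoveringMap γ w := rfl

variable (hf : IsPartialSelfCovering f d)

/-- An enumeration of the fibre of `f` over `t`. -/
def fib (t : M) : Fin d ≃ f ⁻¹' {t} :=
  haveI := hf.finite_fiber t
  (Finite.equivFinOfCardEq (hf.card_fiber t)).symm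

theorem f_fib (t : M) (x : Fin d) : f (fib hf t x) = t := (fib hf t x).2

/-- The permutation of the indices of the fibre over `t` defined by monodromy. -/
def fibPerm (t : M) (g : FundamentalGroup M t) : Equiv.Perm (Fin d) :=
  (fib hf t).symm.permCongr (hf.isCoveringMap.monodromyPerm t g)

theorem fib_fibPerm (t : M) (g : FundamentalGroup M t) (x : Fin d) :
    fib hf t (fibPerm hf t g x) = hf.isCoveringMap.monodromyPerm t g (fib hf t x) := by
  simp [fibPerm, Equiv.permCongr_apply]

/-- Paths in the total space lift paths as continuous maps to `M`. -/
theorem exists_isLift (hf : IsCoveringMap f) {x y : M} (γ : Path x y) (p : f ⁻¹' {x}) :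
    ∃ δ : Path ((p : M₁) : M) ((hf.monodromy (Path.Homotopic.Quotient.mk γ) p : M₁) : M),
      IsLift f δ γ := by
  have hp : γ.toContinuousMap 0 = f p := γ.source.trans p.2.symm
  refine ⟨⟨⟨fun s => (hf.liftPath γ.toContinuousMap p hp s : M), by fun_prop⟩,
    congrArg Subtype.val (hf.liftPath_zero _ _ hp), rfl⟩, fun s => ⟨Subtype.coe_prop _, ?_⟩⟩
  exact congrFun (hf.liftPath_lifts _ _ hp) s

/-- The lift of a loop at `t` starting at a given point of the fibre. -/
def fibLift {t : M} (γ : Path t t) (x : Fin d) :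
    Path ((fib hf t x : M₁) : M)
      ((fib hf t (fibPerm hf t (FundamentalGroup.fromPath (.mk γ)) x) : M₁) : M) :=
  (exists_isLift hf.isCoveringMap γ (fib hf t x)).choose.cast rfl (by rw [fib_fibPerm]; rfl)

theorem fibLift_isLift {t : M} (γ : Path t t) (x : Fin d) : IsLift f (fibLift hf γ x) γ :=
  (exists_isLift hf.isCoveringMap γ (fib hf t x)).choose_spec

variable [PathConnectedSpace M]

/-- A path from `t` to a given point of the fibre over `t`. -/
def connecting (t : M) (x : Fin d) : Path t ((fib hf t x : M₁) : M) :=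
  PathConnectedSpace.somePath _ _

/-- The representative of the section of a loop `γ` at `t` at the letter `x`: a connecting path,
followed by a lift of `γ` and the inverse of a connecting path. -/
def sectionPath {t : M} (γ : Path t t) (x : Fin d) : Path t t :=
  ((connecting hf t x).trans (fibLift hf γ x)).trans (connecting hf t _).symm

/-- The identification of `∂T_t` with `d` copies of itself: `∂T_t` is the union of the `∂T_p`
for the points `p` of the fibre over `t`, and these are identified with `∂T_t` by the connecting
paths. -/
def splitting (t : M) : Fin d × Ends hf t ≃ Ends hf t :=
  Equiv.ofBijective
    (fun q => Boundary.cons (fib hf t q.1) (f_fib hf t q.1)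
      (S hf.isCoveringMap (connecting hf t q.1) q.2)) (by
    constructor
    · rintro ⟨x, w⟩ ⟨x', w'⟩ h
      have h₁ : x = x' := by
        have := congrArg (fun z : Boundary f t => z.vertex 1) h
        simp only [Boundary.cons_vertex_succ, Boundary.vertex_zero] at this
        exact (fib hf t).injective (Subtype.ext (Subtype.ext this))
      subst h₁
      have := S_injective hf.isCoveringMap _ (Boundary.cons_injective _ _ h)
      exact congrArg (Prod.mk x) this
    · intro w
      obtain ⟨p, hp, z, rfl⟩ := Boundary.exists_cons (f := f) w
      obtain ⟨x, hx⟩ := (fib hf t).surjective ⟨p, hp⟩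
      have hx : ((fib hf t x : f ⁻¹' {t}) : M₁) = p := congrArg Subtype.val hx
      subst hx
      refine ⟨⟨x, S hf.isCoveringMap (connecting hf t x).symm z⟩, ?_⟩
      dsimp only
      rw [S_symm])

/-- The self-similar action of the fundamental group on `∂T_t`. -/
def selfSimilar (t : M) : SelfSimilar d (FundamentalGroup M t) (Ends hf t) where
  e := splitting hf t
  perm := fibPerm hf t
  sec g x := FundamentalGroup.fromPath
    (.mk (sectionPath hf (Quotient.out (s := Path.Homotopic.setoid t t) g) x))
  smul_e g x w := by
    have hg : FundamentalGroup.fromPath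
        (.mk (Quotient.out (s := Path.Homotopic.setoid t t) g)) = g := Quotient.out_eq _
    generalize Quotient.out (s := Path.Homotopic.setoid t t) g = γ at hg ⊢
    subst hg
    rw [mk_smul, mk_smul]
    refine (S_cons hf.isCoveringMap γ _ _ (f_fib hf t x) (f_fib hf t _) (fibLift hf γ x)
      (fibLift_isLift hf γ x) _).trans ?_
    refine congrArg (Boundary.cons _ _) ?_
    have key (w : Boundary f t) : S hf.isCoveringMap (fibLift hf γ x)
        (S hf.isCoveringMap (connecting hf t x) w) = S hf.isCoveringMap (connecting hf t _)
          (S hf.isCoveringMap (sectionPath hf γ x) w) := by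
      rw [sectionPath, S_trans, S_trans, S_symm]
    exact key w

end Action

/-! ### Cylinders and vertices -/

section Cylinders

universe u

variable {M : Type u} [TopologicalSpace M] {M₁ : Set M} {f : M₁ → M} {d : ℕ}

theorem nonempty_boundary (hf : IsPartialSelfCovering f d) [NeZero d] (t : M) :
    Nonempty (Boundary f t) := by
  let p (a : M) : M₁ := fib hf a 0
  have hp (a : M) : f (p a) = a := f_fib hf a 0
  let a (n : ℕ) : M := Nat.rec t (fun _ a => (p a : M)) n
  exact ⟨⟨a, rfl, fun n => (p (a n)).2, fun n => hp (a n)⟩⟩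

/-- A bijection that is locally equal to maps `S_γ` is continuous. -/
theorem continuous_of_isLocallyS {hf : IsCoveringMap f} {t : M} {g : Boundary f t → Boundary f t}
    (h : ∀ w, ∃ n m, IsLocallyS hf g w n m) : Continuous g := by
  refine continuous_iInf_rng.2 fun k => @Continuous.mk _ _ _ (_) _ ?_
  rintro _ ⟨s, -, rfl⟩
  refine isOpen_iff_mem_nhds.2 fun w hw => ?_
  obtain ⟨n, m, hnm⟩ := h w
  obtain ⟨δ, hδ⟩ := hnm.add k
  have hopen : IsOpen {w' : Boundary f t | w'.vertex (n + k) = w.vertex (n + k)} :=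
    iInf_le (fun n => TopologicalSpace.induced (fun w : Boundary f t => w.vertex n) ⊥) (n + k) _
      ⟨{w.vertex (n + k)}, trivial, rfl⟩
  filter_upwards [hopen.mem_nhds rfl] with w' hw'
  have h₁ : (g w').vertex (m + k) = (g w).vertex (m + k) :=
    (hδ w' hw' 0).trans (Boundary.vertex_zero _)
  have hdown : ∀ j, (g w').vertex (k + j) = (g w).vertex (k + j) →
      (g w').vertex k = (g w).vertex k := by
    intro j
    induction j with
    | zero => exact id
    | succ j ih => exact fun e => ih (Boundary.vertex_eq_of_succ e)
  have h₂ : (g w').vertex k = (g w).vertex k := hdown m (by rwa [Nat.add_comm k m])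
  change (g w').vertex k ∈ s
  rw [h₂]
  exact hw

variable [PathConnectedSpace M] (hf : IsPartialSelfCovering f d)

/-- The embedding of `∂T_t` onto the cylinder of a word, as a map between boundaries of trees. -/
def cyl (t : M) (v : List (Fin d)) (w : Boundary f t) : Boundary f t :=
  (selfSimilar hf t).pre v w

theorem cyl_cons (t : M) (x : Fin d) (v : List (Fin d)) (w : Boundary f t) :
    cyl hf t (x :: v) w = Boundary.cons (fib hf t x : M₁) (f_fib hf t x)
      (S hf.isCoveringMap (connecting hf t x) (cyl hf t v w)) := rfl

/-- Every word is the address of a vertex of the tree: the elements in its cylinder pass through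
that vertex, and the cylinder is identified with `∂T_t` by a path from `t` to the vertex. -/
theorem exists_cyl_path [NeZero d] (t : M) (v : List (Fin d)) :
    ∃ (a : M) (l : Path t a), ∀ w : Boundary f t, (cyl hf t v w).vertex v.length = a ∧
      ∀ k, (cyl hf t v w).vertex (v.length + k) = (S hf.isCoveringMap l w).vertex k := by
  induction v with
  | nil =>
    refine ⟨t, Path.refl t, fun w => ⟨w.vertex_zero, fun k => ?_⟩⟩
    rw [S_refl, List.length_nil, Nat.zero_add]
    rfl
  | cons x v ih =>
    obtain ⟨a, l, ih⟩ := ih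
    obtain ⟨w₀⟩ := nonempty_boundary hf t
    obtain ⟨b, δ, hδ⟩ := exists_S_vertex_add hf.isCoveringMap (connecting hf t x) v.length
      (cyl hf t v w₀) (ih w₀).1
    have key : ∀ w k, (cyl hf t (x :: v) w).vertex ((x :: v).length + k) =
        (S hf.isCoveringMap (l.trans δ) w).vertex k := by
      intro w k
      rw [cyl_cons, List.length_cons, Nat.add_right_comm, Boundary.cons_vertex_succ,
        hδ _ (ih w).1, S_trans]
      congr 2
      exact Boundary.ext (funext (ih w).2)
    exact ⟨b, l.trans δ, fun w => ⟨(key w 0).trans (S hf.isCoveringMap _ w).vertex_zero, key w⟩⟩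

theorem exists_cyl (t : M) (n : ℕ) (w : Boundary f t) :
    ∃ v : List (Fin d), v.length = n ∧ ∃ w', cyl hf t v w' = w :=
  (selfSimilar hf t).exists_pre n w

variable [NeZero d]

/-- The vertex of the tree `T_t` with the given address. -/
def cylVertex (t : M) (v : List (Fin d)) : M := (exists_cyl_path hf t v).choose

/-- A path identifying `∂T_t` with the cylinder of a word. -/
def cylPath (t : M) (v : List (Fin d)) : Path t (cylVertex hf t v) :=
  (exists_cyl_path hf t v).choose_spec.choose

theorem cyl_vertex (t : M) (v : List (Fin d)) (w : Boundary f t) :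
    (cyl hf t v w).vertex v.length = cylVertex hf t v :=
  ((exists_cyl_path hf t v).choose_spec.choose_spec w).1

theorem cyl_tail (t : M) (v : List (Fin d)) (w : Boundary f t) {n : ℕ} (hn : v.length = n)
    (h : (cyl hf t v w).vertex n = cylVertex hf t v) :
    (cyl hf t v w).tail n h = S hf.isCoveringMap (cylPath hf t v) w := by
  subst hn
  exact Boundary.ext (funext ((exists_cyl_path hf t v).choose_spec.choose_spec w).2)

theorem exists_cyl_of_vertex (t : M) (v : List (Fin d)) (w : Boundary f t)
    (h : w.vertex v.length = cylVertex hf t v) : ∃ w', cyl hf t v w' = w := by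
  refine ⟨S hf.isCoveringMap (cylPath hf t v).symm (w.tail v.length h),
    Boundary.ext_of_tail v.length fun k => ?_⟩
  have := cyl_tail hf t v (S hf.isCoveringMap (cylPath hf t v).symm (w.tail v.length h)) rfl
    (cyl_vertex hf t v _)
  rw [S_symm] at this
  exact congrArg (fun z => z.vertex k) this

theorem cylVertex_append (t : M) (v : List (Fin d)) (x : Fin d) :
    ∃ h : cylVertex hf t (v ++ [x]) ∈ M₁, f ⟨_, h⟩ = cylVertex hf t v := by
  obtain ⟨w⟩ := nonempty_boundary hf t
  have h₁ := cyl_vertex hf t (v ++ [x]) w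
  have h₂ := cyl_vertex hf t v (cyl hf t [x] w)
  have h₃ : cyl hf t (v ++ [x]) w = cyl hf t v (cyl hf t [x] w) :=
    (selfSimilar hf t).pre_append v [x] w
  rw [← h₃] at h₂
  rw [List.length_append, List.length_singleton] at h₁
  rw [← h₁, ← h₂]
  exact ⟨(cyl hf t (v ++ [x]) w).mem _, (cyl hf t (v ++ [x]) w).map_succ _⟩

/-- König's lemma for cylinders: a property of words that is inherited by extensions and holds for
some initial word of every element of `∂T_t` holds for all words of some length. -/
theorem exists_forall_length (t : M) {good : List (Fin d) → Prop}
    (happ : ∀ v t, good v → good (v ++ t))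
    (h : ∀ w : Boundary f t, ∃ v, good v ∧ ∃ w', cyl hf t v w' = w) :
    ∃ n, ∀ v : List (Fin d), v.length = n → good v := by
  let bad (v : List (Fin d)) : Prop := ∀ n, ∃ u : List (Fin d), u.length = n ∧ ¬ good (v ++ u)
  by_contra hcon
  push Not at hcon
  have hbad₀ : bad [] := hcon
  have hstep : ∀ v, bad v → ∃ x, bad (v ++ [x]) := by
    intro v hv
    by_contra hx
    simp only [bad, not_exists, not_forall, not_and, not_not] at hx
    choose N hN using hx
    obtain ⟨u, hu, hgu⟩ := hv (Finset.univ.sup N + 1)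
    obtain ⟨x, u, rfl⟩ := List.exists_cons_of_length_eq_add_one hu
    refine hgu ?_
    have hle : N x ≤ Finset.univ.sup N := Finset.le_sup (Finset.mem_univ x)
    have := happ _ (u.drop (N x)) (hN x (u.take (N x)) (by simp at hu ⊢; omega))
    simpa using this
  choose! next hnext using hstep
  let v (n : ℕ) : List (Fin d) := Nat.rec [] (fun _ v => v ++ [next v]) n
  have hv_succ (n : ℕ) : v (n + 1) = v n ++ [next (v n)] := rfl
  have hbad (n : ℕ) : bad (v n) := by
    induction n with
    | zero => exact hbad₀
    | succ n ih => exact hnext _ ih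
  have hlen (n : ℕ) : (v n).length = n := by
    induction n with
    | zero => rfl
    | succ n ih => simp [hv_succ, ih]
  have happ' (n : ℕ) := cylVertex_append hf t (v n) (next (v n))
  let w : Boundary f t :=
    { vertex := fun n => cylVertex hf t (v n)
      vertex_zero := by
        obtain ⟨w₀⟩ := nonempty_boundary hf t
        exact (cyl_vertex hf t [] w₀).symm.trans w₀.vertex_zero
      mem := fun n => (happ' n).1
      map_succ := fun n => (happ' n).2 }
  obtain ⟨u, hu, w', hw'⟩ := h w
  obtain ⟨w'', hw''⟩ := exists_cyl_of_vertex hf t (v u.length) w (by rw [hlen])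
  have : u = v u.length := SelfSimilar.eq_of_pre_eq (s := selfSimilar hf t)
    (hw'.trans hw''.symm) (hlen _).symm
  obtain ⟨u', -, hu'⟩ := hbad u.length 0
  rw [← this] at hu'
  exact hu' (happ _ _ hu)

/-! ### Comparison of the two groups of homeomorphisms -/

/-- Local equality with a map `S_γ` amounts to a germ of the self-similar action. -/
theorem IsLocallyS.exists_germ {t : M} {g : Equiv.Perm (Boundary f t)} {w : Boundary f t}
    {n m : ℕ} (h : IsLocallyS hf.isCoveringMap g w n m) {v : List (Fin d)} (hv : v.length = n)
    (hw : ∃ w', cyl hf t v w' = w) :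
    ∃ u γ, (selfSimilar hf t).Germ g v u γ := by
  obtain ⟨δ, hδ⟩ := h
  obtain ⟨w', hw'⟩ := hw
  obtain ⟨u, hu, z, hz⟩ := exists_cyl hf t m (g w)
  have hwv : w.vertex n = cylVertex hf t v := by rw [← hw', ← hv, cyl_vertex]
  have hgu : (g w).vertex m = cylVertex hf t u := by rw [← hz, ← hu, cyl_vertex]
  refine ⟨u, FundamentalGroup.fromPath (.mk (((cylPath hf t v).trans
    (δ.cast hwv.symm hgu.symm)).trans (cylPath hf t u).symm)), fun (w₁ : Boundary f t) => ?_⟩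
  have hn : (cyl hf t v w₁).vertex n = cylVertex hf t v := by rw [← hv, cyl_vertex]
  refine Boundary.ext_of_tail (f := f) m fun k => ?_
  refine (hδ (cyl hf t v w₁) (hn.trans hwv.symm) k).trans ?_
  rw [← S_cast_tail hf.isCoveringMap δ hwv.symm hgu.symm _ hn, cyl_tail hf t v w₁ hv]
  let γ := ((cylPath hf t v).trans (δ.cast hwv.symm hgu.symm)).trans (cylPath hf t u).symm
  have hm : (cyl hf t u (S hf.isCoveringMap γ w₁)).vertex m = cylVertex hf t u := by
    rw [← hu, cyl_vertex]
  have e₂ := congrArg (fun z => z.vertex k) (cyl_tail hf t u (S hf.isCoveringMap γ w₁) hu hm)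
  refine Eq.trans ?_ e₂.symm
  simp only [γ, S_trans, S_symm]

theorem isLocallyS_of_germ {t : M} {g : Boundary f t → Boundary f t} {v u : List (Fin d)}
    {γ : Path t t} (h : ∀ w, g (cyl hf t v w) = cyl hf t u (S hf.isCoveringMap γ w))
    (w₀ : Boundary f t) :
    IsLocallyS hf.isCoveringMap g (cyl hf t v w₀) v.length u.length := by
  have h₁ : (cyl hf t v w₀).vertex v.length = cylVertex hf t v := cyl_vertex hf t v w₀
  have h₂ : (g (cyl hf t v w₀)).vertex u.length = cylVertex hf t u := by rw [h, cyl_vertex]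
  refine ⟨(((cylPath hf t v).symm.trans γ).trans (cylPath hf t u)).cast h₁ h₂,
    fun w' hw' k => ?_⟩
  obtain ⟨w'', rfl⟩ := exists_cyl_of_vertex hf t v w' (hw'.trans h₁)
  have e₁ := cyl_tail hf t v w'' rfl (cyl_vertex hf t v w'')
  have e₂ := congrArg (fun z => z.vertex k) (cyl_tail hf t u (S hf.isCoveringMap γ w'') rfl
    (cyl_vertex hf t u _))
  rw [S_cast_tail hf.isCoveringMap _ h₁ h₂ _ hw' (cyl_vertex hf t v w''), e₁, S_trans,
    S_trans, S_symm', h]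
  exact e₂

/-- The group `V_f` is the group defined by the self-similar action of the fundamental group. -/
theorem nonempty_Vgroup_equiv (t : M) :
    Nonempty (Vgroup hf.isCoveringMap t ≃* (selfSimilar hf t).V) := by
  let ψ : (Boundary f t ≃ₜ Boundary f t) →* Equiv.Perm (Ends hf t) :=
    { toFun := fun g => g.toEquiv
      map_one' := rfl
      map_mul' := fun _ _ => rfl }
  have hψ : Function.Injective ψ := fun g g' h => Homeomorph.toEquiv_injective h
  have hmap : (Vgroup hf.isCoveringMap t).map ψ = (selfSimilar hf t).V := by
    have hcont : ∀ h ∈ (selfSimilar hf t).V, ∀ w : Boundary f t,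
        ∃ n m, IsLocallyS hf.isCoveringMap (h : Boundary f t → Boundary f t) w n m := by
      rintro h ⟨n, hn⟩ w
      obtain ⟨v, hv, w₀, rfl⟩ := exists_cyl hf t n w
      obtain ⟨u, γ, H⟩ := hn v hv
      induction γ using Quotient.inductionOn with | _ γ
      exact ⟨_, _, isLocallyS_of_germ hf (γ := γ) H w₀⟩
    ext h
    constructor
    · rintro ⟨g, hg, rfl⟩
      refine exists_forall_length hf t
        (good := fun v => ∃ u γ, (selfSimilar hf t).Germ (ψ g) v u γ) ?_ fun w => ?_
      · rintro v t' ⟨u, γ, H⟩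
        obtain ⟨t'', γ', -, H'⟩ := H.append t'
        exact ⟨_, _, H'⟩
      · obtain ⟨n, m, hnm⟩ := hg w
        obtain ⟨v, hv, hw⟩ := exists_cyl hf t n w
        exact ⟨v, IsLocallyS.exists_germ hf (g := g.toEquiv) hnm hv hw, hw⟩
    · intro hh
      exact ⟨⟨h, continuous_of_isLocallyS (hcont h hh),
        continuous_of_isLocallyS (hcont h⁻¹ ((selfSimilar hf t).V.inv_mem hh))⟩, hcont h hh, rfl⟩
  exact ⟨((Vgroup hf.isCoveringMap t).equivMapOfInjective ψ hψ).trans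
    (MulEquiv.subgroupCongr hmap)⟩

end Cylinders

/-! ### Contraction of lifts by an expanding map -/

section Expansion

universe u

theorem iter_tower {M : Type u} [TopologicalSpace M] {M₁ : Set M} {f : M₁ → M}
    {Γ : ℕ → C(I, M)} (hΓ : ∀ k, IsLift f (Γ (k + 1)) (Γ k)) (k n : ℕ) (s : I) :
    ∃ h : Γ (k + n) s ∈ iterDomain f n, iter f n ⟨_, h⟩ = Γ k s := by
  induction n with
  | zero => exact ⟨trivial, rfl⟩
  | succ n ih =>
    obtain ⟨h₁, h₂⟩ := hΓ (k + n) s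
    obtain ⟨h₃, h₄⟩ := ih
    refine ⟨⟨h₁, by rw [← h₂] at h₃; exact h₃⟩, ?_⟩
    refine Eq.trans ?_ h₄
    change iter f n ⟨f ⟨Γ (k + (n + 1)) s, h₁⟩, _⟩ = _
    congr 1
    exact Subtype.ext h₂

/-- The iterated lifts of a path are locally contracted at a geometric rate. The locality scale
`r` in the parameter does not change when passing to a lift: a lift that is short near a point of
the interval cannot become longer than `ε` without first being longer than `η / L ^ (j + 1)`. -/
theorem dist_tower_le {M : Type u} [MetricSpace M] {M₁ : Set M} {f : M₁ → M} {L ε η r : ℝ}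
    (hL : 1 < L) (hη : 0 ≤ η) (hηε : η < ε) {n : ℕ}
    (hexp : ∀ x y : iterDomain f n, dist (x : M) y < ε →
      L * dist (x : M) y ≤ dist (iter f n x) (iter f n y))
    {Γ : ℕ → C(I, M)} (hΓ : ∀ k, IsLift f (Γ (k + 1)) (Γ k))
    (h₀ : ∀ s s' : I, dist s s' < r → dist (Γ 0 s) (Γ 0 s') ≤ η) (j : ℕ) (s s' : I)
    (hs : dist s s' < r) : dist (Γ (j * n) s) (Γ (j * n) s') ≤ η / L ^ j := by
  induction j generalizing s s' with
  | zero => simpa using h₀ s s' hs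
  | succ j ih =>
    have hLj : 0 < L ^ (j + 1) := by positivity
    set β := η / L ^ (j + 1) with hβ
    have hβε : β < ε := (div_le_self hη (one_le_pow₀ hL.le)).trans_lt hηε
    by_contra hcon
    push Not at hcon
    let φ : I → ℝ := fun u => dist (Γ ((j + 1) * n) s) (Γ ((j + 1) * n) u)
    have hφ : Continuous φ := by fun_prop
    obtain ⟨c, hβc, hc⟩ := exists_between (lt_min hcon hβε)
    rw [lt_min_iff] at hc
    have hc0 : 0 ≤ c := le_trans (by positivity) hβc.le
    have hmem : c ∈ Set.uIcc (φ s) (φ s') := by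
      rw [Set.mem_uIcc]
      left
      exact ⟨by simpa [φ] using hc0, hc.1.le⟩
    obtain ⟨u, hu, hφu⟩ := intermediate_value_uIcc hφ.continuousOn hmem
    have hsu : dist s u < r := by
      refine lt_of_le_of_lt ?_ hs
      rw [Subtype.dist_eq, Subtype.dist_eq]
      refine Real.dist_left_le_of_mem_uIcc ?_
      rcases Set.mem_uIcc.1 hu with h | h
      · exact Set.mem_uIcc.2 (Or.inl ⟨h.1, h.2⟩)
      · exact Set.mem_uIcc.2 (Or.inr ⟨h.1, h.2⟩)
    have e : (j + 1) * n = j * n + n := by ring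
    obtain ⟨m₁, i₁⟩ := iter_tower hΓ (j * n) n s
    obtain ⟨m₂, i₂⟩ := iter_tower hΓ (j * n) n u
    rw [← e] at m₁ m₂
    have h₁ := hexp ⟨_, m₁⟩ ⟨_, m₂⟩ (lt_of_eq_of_lt hφu hc.2)
    have h₂ : L * c ≤ η / L ^ j := by
      refine le_trans ?_ (ih s u hsu)
      rw [← i₁, ← i₂]
      refine le_trans (le_of_eq ?_) (h₁.trans (le_of_eq ?_))
      · exact congrArg (L * ·) hφu.symm
      · simp only [e]
    have h₃ : β < η / L ^ (j + 1) := by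
      refine hβc.trans_le ?_
      rw [pow_succ, ← div_div, le_div_iff₀ (by linarith), mul_comm]
      exact h₂
    exact lt_irrefl _ h₃

/-- All sufficiently deep iterated lifts of a path that happen to be loops are null-homotopic. -/
theorem exists_forall_tower_homotopic_refl {M : Type u} [T : TopologicalSpace M]
    (hM : IsSemilocallySimplyConnected M) {M₁ : Set M} {f : M₁ → M} (hexp : IsExpanding f)
    (γ : C(I, M)) : ∃ n, ∀ Γ : ℕ → C(I, M), Γ 0 = γ → (∀ k, IsLift f (Γ (k + 1)) (Γ k)) →
      ∀ (a : M) (α : Path a a), (α : C(I, M)) = Γ n → α.Homotopic (Path.refl a) := by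
  obtain ⟨hcomp, μ, rfl, L, hL, ε, hε, n, -, hexp⟩ := hexp
  choose U hU hloop using hM
  obtain ⟨δ, hδ, hball⟩ := lebesgue_number_lemma_of_metric (s := (Set.univ : Set M))
    isCompact_univ (fun x => isOpen_interior (s := U x))
    (fun x _ => Set.mem_iUnion.2 ⟨x, mem_interior_iff_mem_nhds.2 (hU x)⟩)
  have hη : 0 < ε / 2 := by positivity
  obtain ⟨r, hr, hunif⟩ := Metric.uniformContinuous_iff.1
    (CompactSpace.uniformContinuous_of_continuous γ.continuous) (ε / 2) hη
  obtain ⟨N, hN⟩ := exists_nat_one_div_lt hr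
  obtain ⟨j, hj⟩ := pow_unbounded_of_one_lt ((N + 1) * (ε / 2) / δ) hL
  refine ⟨j * n, fun Γ hΓ₀ hΓ a α hα => ?_⟩
  have hcontr := dist_tower_le hL hη.le (by linarith) hexp hΓ
    (fun s s' h => by rw [hΓ₀]; exact (hunif h).le) j
  -- the whole lift has small diameter, as the interval consists of `N + 1` short pieces
  let g (x : ℝ) : M := Γ (j * n) (Set.projIcc 0 1 zero_le_one x)
  have hg (i : ℕ) (s : ℝ) (hs : |s| ≤ 1) :
      dist (g 0) (g (i * (s / (N + 1)))) ≤ i * (ε / 2 / L ^ j) := by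
    induction i with
    | zero => simp
    | succ i ih =>
      refine (dist_triangle _ (g (i * (s / (N + 1)))) _).trans ?_
      push_cast
      rw [add_mul (i : ℝ) 1 (ε / 2 / L ^ j), one_mul]
      refine add_le_add ih (hcontr _ _ ?_)
      refine lt_of_le_of_lt ?_ hN
      rw [Subtype.dist_eq, Real.dist_eq]
      refine (Set.abs_projIcc_sub_projIcc zero_le_one).trans ?_
      have : (i : ℝ) * (s / (N + 1)) - (i + 1) * (s / (N + 1)) = -(s / (N + 1)) := by ring
      rw [this, abs_neg, abs_div, abs_of_pos (by positivity : (0 : ℝ) < N + 1)]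
      gcongr
  have hdist (s : I) : dist (Γ (j * n) 0) (Γ (j * n) s) < δ := by
    have h₁ := hg (N + 1) s (by rw [abs_of_nonneg s.2.1]; exact s.2.2)
    have e : ((N + 1 : ℕ) : ℝ) * (s / (N + 1)) = s := by
      push_cast
      field_simp
    rw [e] at h₁
    simp only [g, Set.projIcc_val, Set.projIcc_left] at h₁
    refine lt_of_le_of_lt h₁ ?_
    push_cast
    rw [div_lt_iff₀ hδ] at hj
    rw [← mul_div_assoc, div_lt_iff₀ (by positivity)]
    linarith
  obtain ⟨x, hx⟩ := hball (Γ (j * n) 0) (Set.mem_univ _)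
  refine hloop x a α fun s => interior_subset (hx ?_)
  have : α s = Γ (j * n) s := congrArg (fun c : C(I, M) => c s) hα
  rw [this, Metric.mem_ball, dist_comm]
  exact hdist s

end Expansion

/-! ### One-dimensional singular chains modulo boundaries -/

section Chains

open CategoryTheory CategoryTheory.Limits AlgebraicTopology Simplicial

universe u

variable {X Y : TopCat.{u}}

/-- The singular simplex given by a map from the standard simplex. -/
def mkSimplex {n : ℕ} (φ : C(stdSimplex ℝ (Fin (n + 1)), X)) : TopCat.toSSet.obj X _⦋n⦌ :=
  ⟨TopCat.ofHom (φ.comp ⟨ULift.down, continuous_uliftDown⟩)⟩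

theorem mkSimplex_surjective {n : ℕ} (s : TopCat.toSSet.obj X _⦋n⦌) :
    ∃ φ, mkSimplex (n := n) φ = s :=
  ⟨(simplexMap s).hom.comp ⟨ULift.up, continuous_uliftUp⟩, rfl⟩

/-- The singular simplex of a map from the unit interval. -/
def arcSimplex (c : C(I, X)) : TopCat.toSSet.obj X _⦋1⦌ :=
  mkSimplex (c.comp (stdSimplexHomeomorphUnitInterval : C(stdSimplex ℝ (Fin 2), I)))

theorem arcSimplex_surjective (s : TopCat.toSSet.obj X _⦋1⦌) : ∃ c, arcSimplex c = s := by
  obtain ⟨φ, rfl⟩ := mkSimplex_surjective s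
  refine ⟨φ.comp (stdSimplexHomeomorphUnitInterval.symm : C(I, stdSimplex ℝ (Fin 2))), ?_⟩
  unfold arcSimplex
  congr 1
  ext x
  simp

theorem arcSimplex_injective : Function.Injective (arcSimplex (X := X)) := by
  intro c c' h
  ext s
  have : c (stdSimplexHomeomorphUnitInterval (stdSimplexHomeomorphUnitInterval.symm s)) =
      c' (stdSimplexHomeomorphUnitInterval (stdSimplexHomeomorphUnitInterval.symm s)) :=
    congrArg (fun z : TopCat.toSSet.obj X _⦋1⦌ =>
      simplexMap z ⟨stdSimplexHomeomorphUnitInterval.symm s⟩) h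
  rwa [Homeomorph.apply_symm_apply] at this

/-- The `i`-th edge of the standard triangle, opposite to the `i`-th vertex. -/
def edgeArc (i : Fin 3) : C(I, stdSimplex ℝ (Fin 3)) :=
  ContinuousMap.comp ⟨stdSimplex.map (SimplexCategory.δ i), stdSimplex.continuous_map _⟩
    (stdSimplexHomeomorphUnitInterval.symm : C(I, stdSimplex ℝ (Fin 2)))

theorem δ_mkSimplex (φ : C(stdSimplex ℝ (Fin 3), X)) (i : Fin 3) :
    (TopCat.toSSet.obj X).δ i (mkSimplex (n := 2) φ) = arcSimplex (φ.comp (edgeArc i)) := by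
  have : (TopCat.toSSet.obj X).δ i (mkSimplex (n := 2) φ) = mkSimplex (n := 1)
      (φ.comp ⟨stdSimplex.map (SimplexCategory.δ i), stdSimplex.continuous_map _⟩) := rfl
  rw [this]
  unfold arcSimplex edgeArc
  congr 1
  ext x
  simp

theorem edgeArc_apply (i : Fin 3) (s : I) (j : Fin 3) :
    edgeArc i s j = ∑ k : Fin 2, if i.succAbove k = j then (![1 - (s : ℝ), s] k) else 0 := by
  change (stdSimplex.map (SimplexCategory.δ i) (stdSimplexHomeomorphUnitInterval.symm s)) j = _
  rw [stdSimplex.map_coe, FunOnFinite.linearMap_apply_apply, Finset.sum_filter]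
  refine Finset.sum_congr rfl fun k _ => ?_
  refine if_congr Iff.rfl ?_ rfl
  fin_cases k <;> rfl

variable (X) in
/-- The group of one-dimensional singular chains modulo boundaries. It contains the first
homology group as the subgroup of the classes of cycles. -/
abbrev OneChains : AddCommGrpCat.{u} := (singularChains X).opcycles 1

/-- The class of a singular one-simplex modulo boundaries. -/
def simplexClass (s : TopCat.toSSet.obj X _⦋1⦌) : OneChains X :=
  ((TopCat.toSSet.obj X).ιChainComplex (R := integers.{u}) s ≫
    (singularChains X).pOpcycles 1) ⟨1⟩

theorem simplexClass_triangle (s : TopCat.toSSet.obj X _⦋2⦌) :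
    simplexClass ((TopCat.toSSet.obj X).δ 1 s) =
      simplexClass ((TopCat.toSSet.obj X).δ 0 s) + simplexClass ((TopCat.toSSet.obj X).δ 2 s) := by
  have h : ((TopCat.toSSet.obj X).ιChainComplex (R := integers.{u}) s ≫
      (singularChains X).d 2 1) ≫ (singularChains X).pOpcycles 1 = 0 := by
    rw [Category.assoc, HomologicalComplex.d_pOpcycles, comp_zero]
  rw [SSet.ιChainComplex_d, Fin.sum_univ_three] at h
  have h := congrArg (fun g => g.hom (⟨1⟩ : ULift ℤ)) h
  simp only [Fin.isValue, Fin.coe_ofNat_eq_mod, Nat.zero_mod, pow_zero, one_smul, Nat.one_mod,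
    pow_one, neg_smul, Nat.mod_succ, even_two, Even.neg_pow, one_pow, Preadditive.add_comp,
    Preadditive.neg_comp, AddCommGrpCat.hom_add, AddCommGrpCat.hom_neg, AddMonoidHom.add_apply,
    AddMonoidHom.neg_apply, AddCommGrpCat.hom_zero, AddMonoidHom.zero_apply] at h
  change simplexClass _ + -simplexClass _ + simplexClass _ = 0 at h
  rw [← sub_eq_zero, ← neg_eq_zero, ← h]
  abel

/-- Homomorphisms out of the integers are determined by the image of `1`. -/
theorem integers_hom_ext {A : AddCommGrpCat.{u}} {g g' : integers.{u} ⟶ A}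
    (h : g ⟨1⟩ = g' ⟨1⟩) : g = g' := by
  ext ⟨n⟩
  have e : (⟨n⟩ : ULift ℤ) = n • ⟨1⟩ := by
    apply ULift.ext
    simp
  rw [e, map_zsmul, map_zsmul]
  exact congrArg (n • ·) h

/-- The homomorphism from the integers with a given image of `1`. -/
def integersHom {A : AddCommGrpCat.{u}} (a : A) : integers.{u} ⟶ A :=
  AddCommGrpCat.ofHom ((zmultiplesHom A a).comp AddEquiv.ulift.toAddMonoidHom)

theorem integersHom_one {A : AddCommGrpCat.{u}} (a : A) : integersHom a ⟨1⟩ = a :=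
  one_zsmul a

theorem oneChains_hom_ext {A : AddCommGrpCat.{u}} {g g' : OneChains X ⟶ A}
    (h : ∀ c : C(I, X), g (simplexClass (arcSimplex c)) = g' (simplexClass (arcSimplex c))) :
    g = g' := by
  rw [← cancel_epi ((singularChains X).pOpcycles 1)]
  apply SSet.chainComplex_hom_ext
  intro s
  obtain ⟨c, rfl⟩ := arcSimplex_surjective s
  exact integers_hom_ext (h c)

/-- The homomorphism on singular chains with given values on the simplices. -/
def chainsDesc {A : AddCommGrpCat.{u}} {n : ℕ} (a : TopCat.toSSet.obj X _⦋n⦌ → A) :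
    (singularChains X).X n ⟶ A :=
  Cofan.IsColimit.desc ((TopCat.toSSet.obj X).isColimitChainComplexXCofan _ n)
    fun s => integersHom (a s)

theorem ι_chainsDesc {A : AddCommGrpCat.{u}} {n : ℕ} (a : TopCat.toSSet.obj X _⦋n⦌ → A)
    (s : TopCat.toSSet.obj X _⦋n⦌) :
    (TopCat.toSSet.obj X).ιChainComplex s ≫ chainsDesc a = integersHom (a s) :=
  Cofan.IsColimit.fac ((TopCat.toSSet.obj X).isColimitChainComplexXCofan _ n) _ s

/-- The homomorphism on one-dimensional chains modulo boundaries with given values on the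
simplices, which are to satisfy the relation defined by the boundary of every triangle. -/
def oneChainsDesc {A : AddCommGrpCat.{u}} (a : C(I, X) → A)
    (ha : ∀ φ : C(stdSimplex ℝ (Fin 3), X),
      a (φ.comp (edgeArc 1)) = a (φ.comp (edgeArc 0)) + a (φ.comp (edgeArc 2))) :
    OneChains X ⟶ A :=
  (singularChains X).descOpcycles
    (chainsDesc fun s => a (arcSimplex_surjective s).choose) 2 (by simp) (by
      have hc (c : C(I, X)) : (arcSimplex_surjective (arcSimplex c)).choose = c :=
        arcSimplex_injective (arcSimplex_surjective _).choose_spec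
      have e (z : A) : (AddCommGrpCat.Hom.hom (integersHom z)) (⟨1⟩ : ULift ℤ) = z :=
        integersHom_one z
      apply SSet.chainComplex_hom_ext
      intro s
      obtain ⟨φ, rfl⟩ := mkSimplex_surjective s
      refine integers_hom_ext ?_
      rw [← Category.assoc, SSet.ιChainComplex_d, Fin.sum_univ_three]
      simp only [Fin.isValue, Fin.coe_ofNat_eq_mod, Nat.zero_mod, pow_zero, one_smul, Nat.one_mod,
        pow_one, neg_smul, Nat.mod_succ, even_two, Even.neg_pow, one_pow, Preadditive.add_comp,
        Preadditive.neg_comp, AddCommGrpCat.hom_add, AddCommGrpCat.hom_neg,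
        AddMonoidHom.add_apply, AddMonoidHom.neg_apply, comp_zero, AddCommGrpCat.hom_zero,
        AddMonoidHom.zero_apply, ι_chainsDesc, e, δ_mkSimplex, hc, ha]
      abel)

theorem oneChainsDesc_simplexClass {A : AddCommGrpCat.{u}} (a : C(I, X) → A)
    (ha : ∀ φ : C(stdSimplex ℝ (Fin 3), X),
      a (φ.comp (edgeArc 1)) = a (φ.comp (edgeArc 0)) + a (φ.comp (edgeArc 2))) (c : C(I, X)) :
    oneChainsDesc a ha (simplexClass (arcSimplex c)) = a c := by
  have h : ((TopCat.toSSet.obj X).ιChainComplex (R := integers.{u}) (arcSimplex c) ≫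
      (singularChains X).pOpcycles 1) ≫ oneChainsDesc a ha = integersHom (a c) := by
    have hc : (arcSimplex_surjective (arcSimplex c)).choose = c := 
      arcSimplex_injective (arcSimplex_surjective _).choose_spec
    rw [Category.assoc, oneChainsDesc, HomologicalComplex.p_descOpcycles, ι_chainsDesc, hc]
  exact (congrArg (fun g => g.hom (⟨1⟩ : ULift ℤ)) h).trans (integersHom_one _)

end Chains

/-! ### The first homology group and the fundamental group -/

section PathClass

open CategoryTheory CategoryTheory.Limits AlgebraicTopology Simplicial

universe u

variable {X Y : TopCat.{u}}

/-- The class modulo boundaries of a path, as a singular chain. -/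
def pathClass {x y : X} (γ : Path x y) : OneChains X :=
  simplexClass (arcSimplex (γ : C(I, X)))

theorem simplexClass_arcSimplex_triangle (φ : C(stdSimplex ℝ (Fin 3), X)) :
    simplexClass (arcSimplex (φ.comp (edgeArc 1))) =
      simplexClass (arcSimplex (φ.comp (edgeArc 0))) +
        simplexClass (arcSimplex (φ.comp (edgeArc 2))) := by
  rw [← δ_mkSimplex, ← δ_mkSimplex, ← δ_mkSimplex]
  exact simplexClass_triangle _

/-- The relation between the classes of three paths that form the boundary of a triangle. -/
theorem pathClass_triangle {x y z x' y' z' : X} (φ : C(stdSimplex ℝ (Fin 3), X)) (α : Path x y)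
    (β : Path x' y') (γ : Path z z') (h₀ : ∀ s, φ (edgeArc 0 s) = α s)
    (h₁ : ∀ s, φ (edgeArc 1 s) = β s) (h₂ : ∀ s, φ (edgeArc 2 s) = γ s) :
    pathClass β = pathClass α + pathClass γ := by
  have e₀ : φ.comp (edgeArc 0) = (α : C(I, X)) := ContinuousMap.ext h₀
  have e₁ : φ.comp (edgeArc 1) = (β : C(I, X)) := ContinuousMap.ext h₁
  have e₂ : φ.comp (edgeArc 2) = (γ : C(I, X)) := ContinuousMap.ext h₂
  have := simplexClass_arcSimplex_triangle φ
  rwa [e₀, e₁, e₂] at this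

@[simp]
theorem pathClass_refl (x : X) : pathClass (Path.refl x) = 0 := by
  have := pathClass_triangle (ContinuousMap.const _ x) (Path.refl x) (Path.refl x) (Path.refl x)
    (fun _ => rfl) (fun _ => rfl) (fun _ => rfl)
  simpa using this

/-- A linear combination of the barycentric coordinates of the triangle, with coefficients in the
unit interval. -/
def triangleCoord (a b c : I) : C(stdSimplex ℝ (Fin 3), I) where
  toFun p := ⟨a * p 0 + b * p 1 + c * p 2, by
    have h := p.2.2
    rw [Fin.sum_univ_three] at h
    have h0 := p.2.1 0
    have h1 := p.2.1 1
    have h2 := p.2.1 2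
    change 0 ≤ p 0 at h0
    change 0 ≤ p 1 at h1
    change 0 ≤ p 2 at h2
    change p 0 + p 1 + p 2 = 1 at h
    have ha := a.2
    have hb := b.2
    have hc := c.2
    constructor
    · have := mul_nonneg ha.1 h0
      have := mul_nonneg hb.1 h1
      have := mul_nonneg hc.1 h2
      linarith
    · have := mul_le_mul_of_nonneg_right ha.2 h0
      have := mul_le_mul_of_nonneg_right hb.2 h1
      have := mul_le_mul_of_nonneg_right hc.2 h2
      linarith⟩
  continuous_toFun := by
    have (i : Fin 3) : Continuous fun p : stdSimplex ℝ (Fin 3) => p i :=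
      (continuous_apply i).comp continuous_subtype_val
    have h0 := this 0
    have h1 := this 1
    have h2 := this 2
    exact (((continuous_const.mul h0).add (continuous_const.mul h1)).add
      (continuous_const.mul h2)).subtype_mk _

theorem triangleCoord_edgeArc_zero (a b c s : I) :
    (triangleCoord a b c (edgeArc 0 s) : ℝ) = b * (1 - s) + c * s := by
  simp [triangleCoord, edgeArc_apply, Fin.sum_univ_two, Fin.succAbove]

theorem triangleCoord_edgeArc_one (a b c s : I) :
    (triangleCoord a b c (edgeArc 1 s) : ℝ) = a * (1 - s) + c * s := by
  simp [triangleCoord, edgeArc_apply, Fin.sum_univ_two, Fin.succAbove]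

theorem triangleCoord_edgeArc_two (a b c s : I) :
    (triangleCoord a b c (edgeArc 2 s) : ℝ) = a * (1 - s) + b * s := by
  simp [triangleCoord, edgeArc_apply, Fin.sum_univ_two, Fin.succAbove]

theorem pathClass_trans {x y z : X} (γ : Path x y) (δ : Path y z) :
    pathClass (γ.trans δ) = pathClass γ + pathClass δ := by
  rw [add_comm]
  let half : I := ⟨1 / 2, by norm_num, by norm_num⟩
  refine pathClass_triangle
    (((γ.trans δ) : C(I, X)).comp (triangleCoord 0 half 1)) δ _ γ ?_ ?_ ?_
  · intro s
    have h := triangleCoord_edgeArc_zero 0 half 1 s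
    change (γ.trans δ) (triangleCoord 0 half 1 (edgeArc 0 s)) = _
    rw [Path.trans_apply]
    have hs := s.2.1
    split_ifs with h'
    · have : s = 0 := by
        apply Subtype.ext
        rw [h] at h'
        simp only [half, Set.Icc.coe_one, Set.Icc.coe_zero] at h' ⊢
        linarith
      subst this
      refine (congrArg γ (Subtype.ext ?_)).trans (γ.target.trans δ.source.symm)
      change 2 * (triangleCoord 0 half 1 (edgeArc 0 0) : ℝ) = 1
      rw [h]
      simp [half]
    · congr 1
      apply Subtype.ext
      simp only [h, half, Set.Icc.coe_one]
      ring
  · intro s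
    change (γ.trans δ) (triangleCoord 0 half 1 (edgeArc 1 s)) = _
    congr 1
    apply Subtype.ext
    simp [triangleCoord_edgeArc_one]
  · intro s
    have h := triangleCoord_edgeArc_two 0 half 1 s
    change (γ.trans δ) (triangleCoord 0 half 1 (edgeArc 2 s)) = _
    rw [Path.trans_apply]
    have hs := s.2.2
    have h' : ((triangleCoord 0 half 1 (edgeArc 2 s) : I) : ℝ) ≤ 1 / 2 := by
      rw [h]
      simp only [half, Set.Icc.coe_zero]
      linarith
    rw [dif_pos h']
    congr 1
    apply Subtype.ext
    simp only [h, half, Set.Icc.coe_zero]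
    ring

/-- The two triangles into which the diagonal divides the square of a homotopy show that
homotopic paths have the same class. -/
theorem pathClass_homotopic {x y : X} {γ δ : Path x y} (h : γ.Homotopic δ) :
    pathClass γ = pathClass δ := by
  obtain ⟨H⟩ := h
  let diag : Path x y :=
    ⟨⟨fun s => H (s, s), by fun_prop⟩, by simp, by simp⟩
  have h₁ : pathClass diag = pathClass (Path.refl y) + pathClass γ := by
    refine pathClass_triangle
      (H.toContinuousMap.comp ((triangleCoord 0 0 1).prodMk (triangleCoord 0 1 1)))
      _ _ _ (fun s => ?_) (fun s => ?_) fun s => ?_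
    · change H (triangleCoord 0 0 1 (edgeArc 0 s), triangleCoord 0 1 1 (edgeArc 0 s)) = _
      rw [show triangleCoord 0 1 1 (edgeArc 0 s) = 1 from
        Subtype.ext (by simp [triangleCoord_edgeArc_zero]), H.target]
      rfl
    · change H (triangleCoord 0 0 1 (edgeArc 1 s), triangleCoord 0 1 1 (edgeArc 1 s)) = _
      rw [show triangleCoord 0 1 1 (edgeArc 1 s) = s from
        Subtype.ext (by simp [triangleCoord_edgeArc_one]),
        show triangleCoord 0 0 1 (edgeArc 1 s) = s from
        Subtype.ext (by simp [triangleCoord_edgeArc_one])]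
      rfl
    · change H (triangleCoord 0 0 1 (edgeArc 2 s), triangleCoord 0 1 1 (edgeArc 2 s)) = _
      rw [show triangleCoord 0 1 1 (edgeArc 2 s) = s from
        Subtype.ext (by simp [triangleCoord_edgeArc_two]),
        show triangleCoord 0 0 1 (edgeArc 2 s) = 0 from
        Subtype.ext (by simp [triangleCoord_edgeArc_two])]
      exact H.apply_zero s
  have h₂ : pathClass diag = pathClass δ + pathClass (Path.refl x) := by
    refine pathClass_triangle
      (H.toContinuousMap.comp ((triangleCoord 0 1 1).prodMk (triangleCoord 0 0 1)))
      _ _ _ (fun s => ?_) (fun s => ?_) fun s => ?_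
    · change H (triangleCoord 0 1 1 (edgeArc 0 s), triangleCoord 0 0 1 (edgeArc 0 s)) = _
      rw [show triangleCoord 0 1 1 (edgeArc 0 s) = 1 from
        Subtype.ext (by simp [triangleCoord_edgeArc_zero]),
        show triangleCoord 0 0 1 (edgeArc 0 s) = s from
        Subtype.ext (by simp [triangleCoord_edgeArc_zero])]
      exact H.apply_one s
    · change H (triangleCoord 0 1 1 (edgeArc 1 s), triangleCoord 0 0 1 (edgeArc 1 s)) = _
      rw [show triangleCoord 0 1 1 (edgeArc 1 s) = s from
        Subtype.ext (by simp [triangleCoord_edgeArc_one]),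
        show triangleCoord 0 0 1 (edgeArc 1 s) = s from
        Subtype.ext (by simp [triangleCoord_edgeArc_one])]
      rfl
    · change H (triangleCoord 0 1 1 (edgeArc 2 s), triangleCoord 0 0 1 (edgeArc 2 s)) = _
      rw [show triangleCoord 0 0 1 (edgeArc 2 s) = 0 from
        Subtype.ext (by simp [triangleCoord_edgeArc_two]), H.source]
      rfl
  simpa using h₁.symm.trans h₂

theorem pathClass_symm {x y : X} (γ : Path x y) : pathClass γ.symm = -pathClass γ := by
  rw [eq_neg_iff_add_eq_zero, ← pathClass_trans, pathClass_homotopic (Path.Homotopic.symm_trans γ),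
    pathClass_refl]

variable (X) in
/-- The embedding of the homology group into the group of chains modulo boundaries. -/
def cycleClass : H1 X →+ OneChains X := ((singularChains X).homologyι 1).hom

theorem cycleClass_injective : Function.Injective (cycleClass X) :=
  (AddCommGrpCat.mono_iff_injective ((singularChains X).homologyι 1)).1 inferInstance

theorem cycleClass_loopClass {x : X} (γ : Path x x) : cycleClass X (loopClass γ) = pathClass γ := by
  change (singularChains X).homologyι 1 (loopClass γ) = pathClass γ
  unfold loopClass pathClass simplexClass
  rw [← ConcreteCategory.comp_apply, Category.assoc, HomologicalComplex.homology_π_ι,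
    ← Category.assoc, HomologicalComplex.liftCycles_i]
  rfl

theorem loopClass_homotopic {x : X} {γ δ : Path x x} (h : γ.Homotopic δ) :
    loopClass γ = loopClass δ :=
  cycleClass_injective (by rw [cycleClass_loopClass, cycleClass_loopClass, pathClass_homotopic h])

theorem loopClass_refl (x : X) : loopClass (Path.refl x) = 0 :=
  cycleClass_injective (by rw [cycleClass_loopClass, pathClass_refl, map_zero])

theorem loopClass_trans {x : X} (γ δ : Path x x) :
    loopClass (γ.trans δ) = loopClass γ + loopClass δ :=
  cycleClass_injective (by
    rw [map_add, cycleClass_loopClass, cycleClass_loopClass, cycleClass_loopClass, pathClass_trans])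

/-- The Hurewicz homomorphism, in multiplicative notation. -/
def loopHom (t : X) : FundamentalGroup X t →* Multiplicative (H1 X) where
  toFun := Quotient.lift (s := Path.Homotopic.setoid t t)
    (fun γ => Multiplicative.ofAdd (loopClass γ))
    fun _ _ h => congrArg Multiplicative.ofAdd (loopClass_homotopic h)
  map_one' := congrArg Multiplicative.ofAdd (loopClass_refl t)
  map_mul' g h := by
    induction g using Quotient.inductionOn with | _ γ
    induction h using Quotient.inductionOn with | _ δ
    exact congrArg Multiplicative.ofAdd ((loopClass_trans δ γ).trans (add_comm _ _))

section Hurewicz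

variable [PathConnectedSpace X] (t : X)

/-- The class in the abelianized fundamental group at `t` of a path, closed up by the chosen paths
from `t` to its ends. -/
def closedPath {x y : X} (γ : Path x y) : Additive (Abelianization (FundamentalGroup X t)) :=
  .ofMul (.of (FundamentalGroup.fromPath (.mk
    (((PathConnectedSpace.somePath t x).trans γ).trans (PathConnectedSpace.somePath t y).symm))))

theorem closedPath_homotopic {x y : X} {γ δ : Path x y} (h : γ.Homotopic δ) :
    closedPath t γ = closedPath t δ := by
  unfold closedPath
  have : Path.Homotopic.Quotient.mk
      (((PathConnectedSpace.somePath t x).trans γ).trans (PathConnectedSpace.somePath t y).symm) =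
    .mk (((PathConnectedSpace.somePath t x).trans δ).trans
      (PathConnectedSpace.somePath t y).symm) :=
    Path.Homotopic.Quotient.eq.2 (((Path.Homotopic.refl _).hcomp h).hcomp (Path.Homotopic.refl _))
  rw [this]

theorem closedPath_trans {x y z : X} (γ : Path x y) (δ : Path y z) :
    closedPath t (γ.trans δ) = closedPath t γ + closedPath t δ := by
  rw [add_comm]
  unfold closedPath
  rw [← ofMul_mul, ← map_mul]
  congr 2
  change _ = Path.Homotopic.Quotient.trans _ _
  simp only [Path.Homotopic.Quotient.mk_trans, Path.Homotopic.Quotient.mk_symm,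
    Path.Homotopic.Quotient.trans_assoc]
  rw [← Path.Homotopic.Quotient.trans_assoc (Path.Homotopic.Quotient.symm _) _,
    Path.Homotopic.Quotient.symm_trans, Path.Homotopic.Quotient.refl_trans]

theorem closedPath_cast {x y x' y' : X} (γ : Path x y) (hx : x' = x) (hy : y' = y) :
    closedPath t (γ.cast hx hy) = closedPath t γ := by
  subst hx hy
  rfl

theorem closedPath_loop (γ : Path t t) :
    closedPath t γ = .ofMul (.of (FundamentalGroup.fromPath (.mk γ))) := by
  unfold closedPath
  have : FundamentalGroup.fromPath (.mk (((PathConnectedSpace.somePath t t).trans γ).trans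
      (PathConnectedSpace.somePath t t).symm)) =
    (FundamentalGroup.fromPath (.mk (PathConnectedSpace.somePath t t)))⁻¹ *
      (FundamentalGroup.fromPath (.mk γ)) *
        (FundamentalGroup.fromPath (.mk (PathConnectedSpace.somePath t t))) := by
    change _ = Path.Homotopic.Quotient.trans (.mk (PathConnectedSpace.somePath t t))
      (.trans (.mk γ) (.symm (.mk (PathConnectedSpace.somePath t t))))
    simp only [Path.Homotopic.Quotient.mk_trans, Path.Homotopic.Quotient.mk_symm,
      Path.Homotopic.Quotient.trans_assoc]
  rw [this]
  refine congrArg (fun g => Additive.ofMul g) ?_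
  rw [map_mul, map_mul, map_inv, mul_right_comm, inv_mul_cancel, one_mul]

/-- A map from the unit interval as a path between its end points. -/
def arcPath (c : C(I, X)) : Path (c 0) (c 1) := ⟨c, rfl, rfl⟩

theorem closedPath_arcPath {x y : X} (γ : Path x y) :
    closedPath t (arcPath (γ : C(I, X))) = closedPath t γ :=
  closedPath_cast t γ γ.source γ.target

/-- The edges of the standard triangle as paths: the edge from the first vertex to the last is
homotopic to the concatenation of the other two. -/
theorem edgeArc_homotopic : ∃ (v₀ v₁ v₂ : stdSimplex ℝ (Fin 3)) (α : Path v₁ v₂) (β : Path v₀ v₂)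
    (γ : Path v₀ v₁), (α : C(I, _)) = edgeArc 0 ∧ (β : C(I, _)) = edgeArc 1 ∧
      (γ : C(I, _)) = edgeArc 2 ∧ β.Homotopic (γ.trans α) := by
  have : ContractibleSpace (stdSimplex ℝ (Fin 3)) :=
    (convex_stdSimplex ℝ (Fin 3)).contractibleSpace ⟨_, (stdSimplex.vertex 0).2⟩
  refine ⟨edgeArc 1 0, edgeArc 0 0, edgeArc 0 1, ⟨edgeArc 0, rfl, rfl⟩,
    ⟨edgeArc 1, rfl, ?_⟩, ⟨edgeArc 2, ?_, ?_⟩, rfl, rfl, rfl,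
    SimplyConnectedSpace.paths_homotopic _ _⟩
  all_goals
    apply Subtype.ext
    funext j
    refine (edgeArc_apply _ _ j).trans ((edgeArc_apply _ _ j).trans ?_).symm
    fin_cases j <;> simp [Fin.sum_univ_two, Fin.succAbove]

/-- The inverse of the Hurewicz homomorphism, defined on all one-dimensional chains. -/
def closedPathHom : OneChains X ⟶
    AddCommGrpCat.of (Additive (Abelianization (FundamentalGroup X t))) :=
  oneChainsDesc (fun c => closedPath t (arcPath c)) (by
    intro φ
    obtain ⟨v₀, v₁, v₂, α, β, γ, hα, hβ, hγ, h⟩ := edgeArc_homotopic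
    rw [← hα, ← hβ, ← hγ]
    have e {a b : stdSimplex ℝ (Fin 3)} (p : Path a b) :
        closedPath t (arcPath (φ.comp (p : C(I, _)))) = closedPath t (p.map φ.continuous) :=
      closedPath_arcPath t (p.map φ.continuous)
    refine (e β).trans (Eq.trans ?_ (congrArg₂ (· + ·) (e α) (e γ)).symm)
    rw [closedPath_homotopic t (h.map φ), Path.map_trans, closedPath_trans, add_comm])

theorem closedPathHom_pathClass {x y : X} (γ : Path x y) :
    closedPathHom t (pathClass γ) = closedPath t γ :=
  (oneChainsDesc_simplexClass _ _ _).trans (closedPath_arcPath t γ)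

/-- The Hurewicz homomorphism, with values in the chains modulo boundaries. -/
def loopChainHom : AddCommGrpCat.of (Additive (Abelianization (FundamentalGroup X t))) ⟶
    OneChains X :=
  AddCommGrpCat.ofHom ((cycleClass X).comp (Abelianization.lift (loopHom t)).toAdditiveLeft)

theorem loopChainHom_closedPath {x y : X} (γ : Path x y) :
    loopChainHom t (closedPath t γ) = pathClass (PathConnectedSpace.somePath t x) + pathClass γ -
      pathClass (PathConnectedSpace.somePath t y) := by
  refine (cycleClass_loopClass _).trans ?_
  rw [pathClass_trans, pathClass_trans, pathClass_symm, sub_eq_add_neg]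

/-- The difference between a chain and the loops that it makes with the chosen paths
depends only on the boundary of the chain. -/
theorem loopChainHom_closedPathHom_of_cycle (z : OneChains X)
    (hz : (singularChains X).fromOpcycles 1 0 z = 0) :
    loopChainHom t (closedPathHom t z) = z := by
  let b : (singularChains X).X 0 ⟶ OneChains X := chainsDesc fun s =>
    pathClass (PathConnectedSpace.somePath t (simplexMap s (ULift.up (stdSimplex.vertex 0))))
  have key : closedPathHom t ≫ loopChainHom t =
      𝟙 _ - (singularChains X).fromOpcycles 1 0 ≫ b := by
    refine oneChains_hom_ext fun c => ?_
    have h₁ : (closedPathHom t ≫ loopChainHom t) (simplexClass (arcSimplex c)) =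
        pathClass (PathConnectedSpace.somePath t (c 0)) + pathClass (arcPath c) -
          pathClass (PathConnectedSpace.somePath t (c 1)) :=
      (congrArg (loopChainHom t) (closedPathHom_pathClass t (arcPath c))).trans
        (loopChainHom_closedPath t _)
    have h₂ : ((singularChains X).fromOpcycles 1 0 ≫ b) (simplexClass (arcSimplex c)) =
        pathClass (PathConnectedSpace.somePath t (c 1)) -
          pathClass (PathConnectedSpace.somePath t (c 0)) := by
      have e : ((TopCat.toSSet.obj X).ιChainComplex (R := integers.{u}) (arcSimplex c) ≫
          (singularChains X).pOpcycles 1) ≫ (singularChains X).fromOpcycles 1 0 ≫ b =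
          integersHom (pathClass (PathConnectedSpace.somePath t (c 1)) -
            pathClass (PathConnectedSpace.somePath t (c 0))) := by
        rw [Category.assoc, HomologicalComplex.p_fromOpcycles_assoc, ← Category.assoc,
          SSet.ιChainComplex_d, Fin.sum_univ_two]
        have e₀ : simplexMap ((TopCat.toSSet.obj X).δ 0 (arcSimplex c))
            (ULift.up (stdSimplex.vertex 0)) = c 1 := by
          change c (stdSimplexHomeomorphUnitInterval
            (stdSimplex.map (SimplexCategory.δ 0) (stdSimplex.vertex 0))) = c 1
          rw [stdSimplex.map_vertex]
          rfl
        have e₁ : simplexMap ((TopCat.toSSet.obj X).δ 1 (arcSimplex c))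
            (ULift.up (stdSimplex.vertex 0)) = c 0 := by
          change c (stdSimplexHomeomorphUnitInterval
            (stdSimplex.map (SimplexCategory.δ 1) (stdSimplex.vertex 0))) = c 0
          rw [stdSimplex.map_vertex]
          rfl
        refine integers_hom_ext ?_
        rw [integersHom_one, ← e₀, ← e₁]
        simp only [Fin.isValue, Fin.coe_ofNat_eq_mod, Nat.zero_mod, pow_zero, one_smul, Nat.one_mod,
          pow_one, neg_smul, Preadditive.add_comp, Preadditive.neg_comp, AddCommGrpCat.hom_add,
          AddCommGrpCat.hom_neg, AddMonoidHom.add_apply, AddMonoidHom.neg_apply, ι_chainsDesc, b]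
        exact (congrArg₂ (fun y z => y + -z) (integersHom_one _) (integersHom_one _)).trans
          (sub_eq_add_neg _ _).symm
      exact (congrArg (fun g => g.hom (⟨1⟩ : ULift ℤ)) e).trans (integersHom_one _)
    rw [h₁]
    refine Eq.trans ?_ (congrArg (fun z => simplexClass (arcSimplex c) - z) h₂).symm
    change _ = pathClass (arcPath c) - _
    abel
  have := congrArg (fun g => g.hom z) key
  refine this.trans ?_
  refine (congrArg (fun y => z - b y) hz).trans ?_
  rw [map_zero, sub_zero]

/-- In a path connected space every class of degree one is the class of a loop. -/
theorem loopHom_surjective : Function.Surjective (loopHom t) := by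
  intro z
  have hz : (singularChains X).fromOpcycles 1 0 (cycleClass X (Multiplicative.toAdd z)) = 0 :=
    congrArg (fun g => g.hom (Multiplicative.toAdd z))
      ((singularChains X).homologyι_comp_fromOpcycles 1 0)
  have h := loopChainHom_closedPathHom_of_cycle t _ hz
  obtain ⟨g, hg⟩ := QuotientGroup.mk_surjective
    (Additive.toMul (closedPathHom t (cycleClass X (Multiplicative.toAdd z))))
  refine ⟨g, cycleClass_injective (Eq.trans ?_ h)⟩
  exact congrArg (fun y => loopChainHom t (Additive.ofMul y)) hg

theorem exists_loopClass (z : H1 X) : ∃ γ : Path t t, loopClass γ = z := by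
  obtain ⟨g, hg⟩ := loopHom_surjective t (Multiplicative.ofAdd z)
  induction g using Quotient.inductionOn with | _ γ
  exact ⟨γ, hg⟩

/-- Every homomorphism from the fundamental group to a commutative group factors through the
first homology group. -/
theorem exists_comp_loopHom {B : Type*} [CommGroup B] (ψ : FundamentalGroup X t →* B) :
    ∃ φ : Multiplicative (H1 X) →* B, φ.comp (loopHom t) = ψ := by
  let κ : H1 X →+ Additive (Abelianization (FundamentalGroup X t)) :=
    (closedPathHom t).hom.comp (cycleClass X)
  refine ⟨(Abelianization.lift ψ).comp κ.toMultiplicativeLeft, ?_⟩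
  ext g
  induction g using Quotient.inductionOn with | _ γ
  have : closedPathHom t (cycleClass X (loopClass γ)) =
      .ofMul (.of (FundamentalGroup.fromPath (.mk γ))) := by
    rw [cycleClass_loopClass, closedPathHom_pathClass]
    exact closedPath_loop t γ
  exact congrArg (fun z => Abelianization.lift ψ (Additive.toMul z)) this

end Hurewicz

end PathClass

/-! ### The transfer of the class of a loop -/

section Transfer

open CategoryTheory CategoryTheory.Limits AlgebraicTopology Simplicial

universe u

/-- The transfer of the class of a loop, followed by the homomorphism induced by a map, is the sum
of the images of the lifts of the loop. -/
theorem cycleClass_map_transfer {E X Y : TopCat.{u}} {p : E ⟶ X} (hp : IsCoveringMap p)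
    (hfin : ∀ x, Finite (p ⁻¹' {x})) (g : E ⟶ Y) {x : X} (γ : Path x x)
    [Fintype (SimplexLift p (pathSimplex γ))] :
    cycleClass Y (H1map g (H1transfer hp hfin (loopClass γ))) =
      ∑ s : SimplexLift p (pathSimplex γ), simplexClass ((TopCat.toSSet.map g).app _ s.1) := by
  let T := transferChain hp hfin
  let G := SSet.chainComplexMap (TopCat.toSSet.map g) integers.{u}
  have h₁ : cycleClass Y (H1map g (H1transfer hp hfin (loopClass γ))) =
      HomologicalComplex.opcyclesMap G 1 (HomologicalComplex.opcyclesMap T 1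
        (cycleClass X (loopClass γ))) := by
    have h := HomologicalComplex.homologyι_naturality (T ≫ G) 1
    rw [HomologicalComplex.homologyMap_comp, HomologicalComplex.opcyclesMap_comp] at h
    exact congrArg (fun k => k.hom (loopClass γ)) h
  have h₂ : ((TopCat.toSSet.obj X).ιChainComplex (R := integers.{u}) (pathSimplex γ) ≫
      (singularChains X).pOpcycles 1) ≫ HomologicalComplex.opcyclesMap T 1 ≫
        HomologicalComplex.opcyclesMap G 1 =
      ∑ s : SimplexLift p (pathSimplex γ), (TopCat.toSSet.obj Y).ιChainComplex
        ((TopCat.toSSet.map g).app _ s.1) ≫ (singularChains Y).pOpcycles 1 := by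
    rw [Category.assoc, HomologicalComplex.p_opcyclesMap_assoc,
      HomologicalComplex.p_opcyclesMap, ← Category.assoc]
    change ((TopCat.toSSet.obj X).ιChainComplex (R := integers.{u}) (pathSimplex γ) ≫
      transferX hp hfin 1) ≫ _ = _
    rw [ι_transferX, Preadditive.sum_comp]
    refine Finset.sum_congr rfl fun s _ => ?_
    rw [← Category.assoc, SSet.ι_chainComplexMap_f]
  rw [h₁, cycleClass_loopClass]
  refine (congrArg (fun k => k.hom (⟨1⟩ : ULift ℤ)) h₂).trans ?_
  let ev : (integers.{u} ⟶ OneChains Y) →+ OneChains Y :=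
    { toFun := fun k => k.hom (⟨1⟩ : ULift ℤ), map_zero' := rfl, map_add' := fun _ _ => rfl }
  exact map_sum ev _ _

variable {M : Type u} [TopologicalSpace M] {M₁ : Set M} {f : M₁ → M} {d : ℕ}
  (hf : IsPartialSelfCovering f d)

/-- On chains modulo boundaries, `ι_* ∘ f^!` sends a loop to the sum of its lifts, which need not
be loops. -/
theorem cycleClass_sigma {t : M} (γ : Path t t) :
    cycleClass (TopCat.of M) (sigma hf (loopClass (X := TopCat.of M) γ)) =
      ∑ x, pathClass (X := TopCat.of M) (fibLift hf γ x) := by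
  let c (x : Fin d) : C(I, TopCat.of M₁) :=
    ⟨fun s => ⟨fibLift hf γ x s, (fibLift_isLift hf γ x s).1⟩, by fun_prop⟩
  have hc (x : Fin d) : (TopCat.toSSet.map hf.hom).app _ (arcSimplex (c x)) =
      pathSimplex (X := TopCat.of M) γ := by
    refine congrArg arcSimplex (a₁ := ContinuousMap.comp hf.hom.hom (c x)) ?_
    ext s
    exact (fibLift_isLift hf γ x s).2
  let L (x : Fin d) : SimplexLift hf.hom (pathSimplex (X := TopCat.of M) γ) :=
    ⟨arcSimplex (c x), hc x⟩
  have := finite_simplexLift (p := hf.hom) hf.isCoveringMap hf.finite_fiber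
    (pathSimplex (X := TopCat.of M) γ)
  let := Fintype.ofFinite (SimplexLift hf.hom (pathSimplex (X := TopCat.of M) γ))
  let a : SimplexCategory.toTop.{u}.obj ⦋1⦌ := ULift.up (stdSimplexHomeomorphUnitInterval.symm 0)
  have ha (c : C(I, TopCat.of M₁)) : simplexMap (arcSimplex c) a = c 0 := by
    change c (stdSimplexHomeomorphUnitInterval (stdSimplexHomeomorphUnitInterval.symm 0)) = c 0
    rw [Homeomorph.apply_symm_apply]
  have hc0 (x : Fin d) : c x 0 = (fib hf t x : M₁) := Subtype.ext (fibLift hf γ x).source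
  have hL : Function.Bijective L := by
    constructor
    · intro x y h
      have h' := congrArg (fun s : SimplexLift hf.hom (pathSimplex (X := TopCat.of M) γ) =>
        simplexMap s.1 a) h
      simp only [L, ha, hc0] at h'
      exact (fib hf t).injective (Subtype.ext h')
    · intro s
      obtain ⟨b, hb⟩ := arcSimplex_surjective s.1
      have hs : arcSimplex (ContinuousMap.comp hf.hom.hom b) =
          arcSimplex (γ : C(I, TopCat.of M)) := by
        have := s.2
        rw [← hb] at this
        exact this
      have hb0 : f (b 0) = t := (congrArg (fun k : C(I, TopCat.of M) => k 0)
        (arcSimplex_injective hs)).trans γ.source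
      obtain ⟨x, hx⟩ := (fib hf t).surjective ⟨b 0, hb0⟩
      refine ⟨x,
        (existsUnique_simplexLift (p := hf.hom) hf.isCoveringMap _ a (b 0) ?_).unique ?_ ?_⟩
      · refine hb0.trans ?_
        change t = γ (stdSimplexHomeomorphUnitInterval (stdSimplexHomeomorphUnitInterval.symm 0))
        rw [Homeomorph.apply_symm_apply, γ.source]
      · rw [ha, hc0, hx]
      · rw [← hb, ha]
  refine (cycleClass_map_transfer (p := hf.hom) hf.isCoveringMap hf.finite_fiber
    (inclusion M₁) (X := TopCat.of M) γ).trans ?_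
  exact (hL.sum_comp fun s => simplexClass ((TopCat.toSSet.map (inclusion M₁)).app _ s.1)).symm

/-- The endomorphism `ι_* ∘ f^!` sends the class of a loop all of whose lifts are loops to the sum
of the classes of its lifts. -/
theorem sigma_loopClass_of_fibPerm_eq {t : M} (γ : Path t t)
    (h : ∀ x, fibPerm hf t (FundamentalGroup.fromPath (.mk γ)) x = x) :
    sigma hf (loopClass (X := TopCat.of M) γ) =
      ∑ x, loopClass (X := TopCat.of M) ((fibLift hf γ x).cast rfl (by rw [h x])) := by
  apply cycleClass_injective
  rw [cycleClass_sigma, map_sum]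
  refine Finset.sum_congr rfl fun x _ => ?_
  rw [cycleClass_loopClass]
  rfl

/-- The lifts of a loop differ from its sections by the connecting paths, and these cancel, as each
point of the fibre is the beginning of one lift and the end of one lift. -/
theorem sigma_loopClass [PathConnectedSpace M] {t : M} (γ : Path t t) :
    sigma hf (loopClass (X := TopCat.of M) γ) =
      ∑ x, loopClass (X := TopCat.of M) (sectionPath hf γ x) := by
  apply cycleClass_injective
  rw [cycleClass_sigma, map_sum]
  have h (x : Fin d) : cycleClass (TopCat.of M)
      (loopClass (X := TopCat.of M) (sectionPath hf γ x)) =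
      pathClass (X := TopCat.of M) (connecting hf t x) + pathClass (fibLift hf γ x) -
        pathClass (X := TopCat.of M)
          (connecting hf t (fibPerm hf t (FundamentalGroup.fromPath (.mk γ)) x)) := by
    rw [cycleClass_loopClass, sectionPath]
    refine (pathClass_trans (X := TopCat.of M) _ _).trans ?_
    rw [pathClass_symm (X := TopCat.of M), sub_eq_add_neg]
    congr 1
    exact pathClass_trans (X := TopCat.of M) _ _
  simp_rw [h]
  rw [Finset.sum_sub_distrib, Finset.sum_add_distrib, Equiv.sum_comp
    (fibPerm hf t (FundamentalGroup.fromPath (.mk γ)))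
    (fun x => pathClass (X := TopCat.of M) (connecting hf t x)), add_sub_cancel_left]

end Transfer

/-! ### The sign homomorphism -/

section Sign

universe u

theorem map_sgn {A B : Type*} [CommGroup A] [CommGroup B] {X : Type*} [Fintype X] [DecidableEq X]
    (φ : A →* B) (τ : A) (π : Equiv.Perm X) : φ (sgn τ π) = sgn (φ τ) π := by
  unfold sgn
  split_ifs <;> simp

theorem sgn_permCongr {A : Type*} [CommGroup A] {X Y : Type*} [Fintype X] [DecidableEq X]
    [Fintype Y] [DecidableEq Y] (τ : A) (e : X ≃ Y) (π : Equiv.Perm X) :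
    sgn τ (e.permCongr π) = sgn τ π := by
  unfold sgn
  rw [Equiv.Perm.sign_permCongr]

variable {M : Type u} [TopologicalSpace M] {M₁ : Set M} {f : M₁ → M} {d : ℕ}
  (hf : IsPartialSelfCovering f d)

/-- The generator of `ℤ/2`, written multiplicatively. -/
def generator : Multiplicative (ZMod 2) := Multiplicative.ofAdd 1

theorem generator_mul_self : generator * generator = 1 := by decide

/-- The parity of the monodromy permutation, computed in an enumeration of the fibre. -/
theorem ofAdd_monodromyParity {x : M} (γ : Path x x) :
    Multiplicative.ofAdd (monodromyParity (p := hf.hom) hf.isCoveringMap hf.finite_fiber γ) =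
      sgn generator (fibPerm hf x (FundamentalGroup.fromPath (.mk γ))) := by
  have := hf.finite_fiber x
  let := Fintype.ofFinite (f ⁻¹' {x})
  let := Classical.decEq (f ⁻¹' {x})
  rw [fibPerm, sgn_permCongr]
  unfold sgn monodromyParity
  exact apply_ite Multiplicative.ofAdd _ _ _

/-- Conjugation by a path does not change the sign of the monodromy. -/
theorem sgn_fibPerm_conj {A : Type*} [CommGroup A] (τ : A) {x y : M} (ℓ : Path y x)
    (γ : Path x x) :
    sgn τ (fibPerm hf y (FundamentalGroup.fromPath (.mk ((ℓ.trans γ).trans ℓ.symm)))) =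
      sgn τ (fibPerm hf x (FundamentalGroup.fromPath (.mk γ))) := by
  have := hf.finite_fiber x
  have := hf.finite_fiber y
  let := Fintype.ofFinite (f ⁻¹' {x})
  let := Fintype.ofFinite (f ⁻¹' {y})
  let := Classical.decEq (f ⁻¹' {x})
  let := Classical.decEq (f ⁻¹' {y})
  rw [fibPerm, fibPerm, sgn_permCongr, sgn_permCongr]
  let e : f ⁻¹' {y} ≃ f ⁻¹' {x} :=
    Equiv.ofBijective _ (hf.isCoveringMap.monodromy_bijective (.mk ℓ))
  rw [← sgn_permCongr τ e]
  congr 1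
  ext q : 1
  obtain ⟨p, rfl⟩ := e.surjective q
  rw [Equiv.permCongr_apply, Equiv.symm_apply_apply]
  change hf.isCoveringMap.monodromy (.mk ℓ)
    (hf.isCoveringMap.monodromy (.mk ((ℓ.trans γ).trans ℓ.symm)) p) =
      hf.isCoveringMap.monodromy (.mk γ) (hf.isCoveringMap.monodromy (.mk ℓ) p)
  rw [← IsCoveringMap.monodromy_trans_apply, ← IsCoveringMap.monodromy_trans_apply,
    Path.Homotopic.Quotient.mk_trans, Path.Homotopic.Quotient.mk_symm,
    Path.Homotopic.Quotient.trans_assoc, Path.Homotopic.Quotient.symm_trans,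
    Path.Homotopic.Quotient.trans_refl, Path.Homotopic.Quotient.mk_trans]

theorem loopClass_conj {X : TopCat.{u}} {x y : X} (ℓ : Path y x) (γ : Path x x) :
    loopClass ((ℓ.trans γ).trans ℓ.symm) = loopClass γ := by
  apply cycleClass_injective
  rw [cycleClass_loopClass, cycleClass_loopClass, pathClass_trans, pathClass_trans, pathClass_symm]
  abel

/-- The sign of the monodromy permutation as a character of the fundamental group. -/
def sgnHom (t : M) : FundamentalGroup M t →* Multiplicative (ZMod 2) where
  toFun g := sgn generator (fibPerm hf t g)
  map_one' := by
    have : fibPerm hf t 1 = 1 := by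
      unfold fibPerm
      rw [map_one]
      ext
      simp
    rw [this]
    simp [sgn]
  map_mul' g h := by
    have : fibPerm hf t (g * h) = fibPerm hf t g * fibPerm hf t h := by
      unfold fibPerm
      rw [map_mul]
      ext
      simp
    rw [this, SelfSimilar.sgn_mul generator_mul_self]

variable [PathConnectedSpace M]

theorem exists_isMonodromySign (t : M) : ∃ sign : H1 (TopCat.of M) →+ ZMod 2,
    IsMonodromySign (p := hf.hom) hf.isCoveringMap hf.finite_fiber sign := by
  have : PathConnectedSpace (TopCat.of M) := ‹PathConnectedSpace M›
  obtain ⟨φ, hφ⟩ := exists_comp_loopHom (X := TopCat.of M) t (sgnHom hf t)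
  refine ⟨AddMonoidHom.toMultiplicative.symm φ, fun x γ => ?_⟩
  have : PathConnectedSpace (TopCat.of M) := ‹PathConnectedSpace M›
  let ℓ : Path t x := PathConnectedSpace.somePath t x
  apply Multiplicative.ofAdd.injective
  rw [ofAdd_monodromyParity hf γ, ← sgn_fibPerm_conj hf _ ℓ γ]
  rw [← loopClass_conj (X := TopCat.of M) ℓ γ]
  exact DFunLike.congr_fun hφ (FundamentalGroup.fromPath (.mk ((ℓ.trans γ).trans ℓ.symm)))

theorem IsMonodromySign.unique (t : M) {sign sign' : H1 (TopCat.of M) →+ ZMod 2}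
    (h : IsMonodromySign (p := hf.hom) hf.isCoveringMap hf.finite_fiber sign)
    (h' : IsMonodromySign (p := hf.hom) hf.isCoveringMap hf.finite_fiber sign') :
    sign' = sign := by
  have : PathConnectedSpace (TopCat.of M) := ‹PathConnectedSpace M›
  ext z
  obtain ⟨γ, rfl⟩ := exists_loopClass (X := TopCat.of M) t z
  rw [h, h']

end Sign

/-! ### Cocycles on the fundamental group of an expanding covering -/

section Expanding

universe u

variable {M : Type u} [TopologicalSpace M] {M₁ : Set M} {f : M₁ → M} {d : ℕ}
  (hf : IsPartialSelfCovering f d) {A : Type*} [CommGroup A]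

/-- The compatibility of a homomorphism on `H₁(M)` with the transfer: the value on the class of a
loop is the value on its transfer, times `τ` if the monodromy of the loop is odd. -/
def IsTransferInvariant (q : Multiplicative (H1 (TopCat.of M)) →* A) (τ : A) : Prop :=
  ∀ (x : M) (γ : Path x x), q (.ofAdd (loopClass (X := TopCat.of M) γ)) =
    q (.ofAdd (sigma hf (loopClass (X := TopCat.of M) γ))) *
      sgn τ (fibPerm hf x (FundamentalGroup.fromPath (.mk γ)))

variable {hf}

/-- A transfer invariant homomorphism vanishes on a loop that acts trivially on the tree of
preimages and all of whose lifts of some level are null-homotopic: the class of the loop is the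
sum of the classes of its lifts, and these have the same property with the level one less. -/
theorem IsTransferInvariant.map_eq_one [NeZero d] {q : Multiplicative (H1 (TopCat.of M)) →* A}
    {τ : A} (hq : IsTransferInvariant hf q τ) (n : ℕ) : ∀ {x : M} (α : Path x x),
    (∀ w, S hf.isCoveringMap α w = w) →
    (∀ Γ : ℕ → C(I, M), Γ 0 = α → (∀ k, IsLift f (Γ (k + 1)) (Γ k)) →
      ∀ (a : M) (β : Path a a), (β : C(I, M)) = Γ n → β.Homotopic (Path.refl a)) →
    q (.ofAdd (loopClass (X := TopCat.of M) α)) = 1 := by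
  induction n with
  | zero =>
    intro x α _ h
    obtain ⟨w⟩ := nonempty_boundary hf x
    have := h (fun k => (liftTower hf.isCoveringMap α w k).1) rfl
      (fun k => liftTower_isLift hf.isCoveringMap α w k) x α rfl
    rw [loopClass_homotopic (X := TopCat.of M) this, loopClass_refl, ofAdd_zero, map_one]
  | succ n ih =>
    intro x α hS h
    have hperm (i : Fin d) :
        fibPerm hf x (FundamentalGroup.fromPath (.mk α)) i = i := by
      obtain ⟨z⟩ := nonempty_boundary hf (fib hf x i : M₁)
      have h₁ := hS (Boundary.cons (fib hf x i : M₁) (f_fib hf x i) z)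
      rw [S_cons hf.isCoveringMap α _ _ (f_fib hf x i) (f_fib hf x _) (fibLift hf α i)
        (fibLift_isLift hf α i)] at h₁
      have h₂ := congrArg (fun z : Boundary f x => z.vertex 1) h₁
      simp only [Boundary.cons_vertex_succ, Boundary.vertex_zero] at h₂
      exact (fib hf x).injective (Subtype.ext (Subtype.ext h₂))
    have hsgn : sgn τ (fibPerm hf x (FundamentalGroup.fromPath (.mk α))) = 1 := by
      rw [show fibPerm hf x (FundamentalGroup.fromPath (.mk α)) = 1 from Equiv.ext hperm]
      simp [sgn]
    rw [hq, hsgn, mul_one, sigma_loopClass_of_fibPerm_eq hf α hperm, ofAdd_sum, map_prod]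
    refine Finset.prod_eq_one fun i _ => ih _ (fun w => ?_) fun Γ h₀ hΓ => ?_
    · have h₁ := hS (Boundary.cons (fib hf x i : M₁) (f_fib hf x i) w)
      rw [S_cons hf.isCoveringMap α _ (fib hf x i) (f_fib hf x i) (f_fib hf x i)
        ((fibLift hf α i).cast rfl (by rw [hperm i])) (fibLift_isLift hf α i)] at h₁
      exact Boundary.cons_injective _ _ h₁
    · refine h (fun k => Nat.casesOn k α Γ) rfl ?_
      rintro (_ | k)
      · change IsLift f (Γ 0) α
        rw [h₀]
        exact fibLift_isLift hf α i
      · exact hΓ k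

variable [PathConnectedSpace M] (t : M)

/-- The cocycle on the fundamental group defined by a transfer invariant homomorphism. -/
def IsTransferInvariant.cocycle {q : Multiplicative (H1 (TopCat.of M)) →* A}
    {τ : A} (hq : IsTransferInvariant hf q τ) (h₂ : τ * τ = 1) (hd : τ ^ d = τ) :
    (selfSimilar hf t).Cocycle A where
  c := q.comp (loopHom (X := TopCat.of M) t)
  τ := τ
  τ_mul := h₂
  τ_pow := hd
  c_eq g := by
    have hg : FundamentalGroup.fromPath
        (.mk (Quotient.out (s := Path.Homotopic.setoid t t) g)) = g := Quotient.out_eq _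
    change q (loopHom (X := TopCat.of M) t g) = (∏ x, q (loopHom (X := TopCat.of M) t
      (FundamentalGroup.fromPath (.mk (sectionPath hf
        (Quotient.out (s := Path.Homotopic.setoid t t) g) x))))) * sgn τ (fibPerm hf t g)
    generalize Quotient.out (s := Path.Homotopic.setoid t t) g = γ at hg ⊢
    subst hg
    refine (hq t γ).trans ?_
    rw [sigma_loopClass, ofAdd_sum, map_prod]
    rfl

theorem IsTransferInvariant.cocycle_isFaithful [NeZero d]
    {q : Multiplicative (H1 (TopCat.of M)) →* A} {τ : A} (hq : IsTransferInvariant hf q τ)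
    (h₂ : τ * τ = 1) (hd : τ ^ d = τ) (hM : IsSemilocallySimplyConnected M)
    (hexp : IsExpanding f) : (hq.cocycle t h₂ hd).IsFaithful := by
  intro g hg
  induction g using Quotient.inductionOn with | _ γ
  obtain ⟨n, hn⟩ := exists_forall_tower_homotopic_refl hM hexp (γ : C(I, M))
  exact hq.map_eq_one n γ hg hn

/-- Every cocycle on the fundamental group comes from a transfer invariant homomorphism. -/
theorem exists_transferInvariant (D : (selfSimilar hf t).Cocycle A) :
    ∃ q : Multiplicative (H1 (TopCat.of M)) →* A, IsTransferInvariant hf q D.τ ∧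
      q.comp (loopHom (X := TopCat.of M) t) = D.c := by
  have : PathConnectedSpace (TopCat.of M) := ‹PathConnectedSpace M›
  obtain ⟨q, hq⟩ := exists_comp_loopHom (X := TopCat.of M) t D.c
  refine ⟨q, fun x γ => ?_, hq⟩
  let ℓ : Path t x := PathConnectedSpace.somePath t x
  rw [← sgn_fibPerm_conj hf _ ℓ γ, ← loopClass_conj (X := TopCat.of M) ℓ γ]
  let g : FundamentalGroup M t := FundamentalGroup.fromPath (.mk ((ℓ.trans γ).trans ℓ.symm))
  have h (γ : Path t t) : q (.ofAdd (loopClass (X := TopCat.of M) γ)) =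
    D.c (FundamentalGroup.fromPath (.mk γ)) :=
    DFunLike.congr_fun hq (FundamentalGroup.fromPath (.mk γ))
  have hg : FundamentalGroup.fromPath
      (.mk (Quotient.out (s := Path.Homotopic.setoid t t) g)) = g := Quotient.out_eq _
  have e : loopClass (X := TopCat.of M) ((ℓ.trans γ).trans ℓ.symm) =
      loopClass (X := TopCat.of M) (Quotient.out (s := Path.Homotopic.setoid t t) g) :=
    congrArg (fun k => Multiplicative.toAdd (loopHom (X := TopCat.of M) t k)) hg.symm
  rw [h, D.c_eq, e, sigma_loopClass, ofAdd_sum, map_prod]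
  simp_rw [h]
  rfl

/-- The homomorphism of `ℤ/2` that sends the generator to an element of order at most two. -/
theorem exists_hom_zmod_two {B : Type*} [CommGroup B] {τ : B} (hτ : τ * τ = 1) :
    ∃ φ : Multiplicative (ZMod 2) →* B, φ (.ofAdd 1) = τ := by
  refine ⟨AddMonoidHom.toMultiplicativeLeft
    (ZMod.lift 2 ⟨zmultiplesHom _ (Additive.ofMul τ), ?_⟩), ?_⟩
  · change (2 : ℤ) • Additive.ofMul τ = 0
    rw [two_zsmul, ← ofMul_mul, hτ, ofMul_one]
  · change Additive.toMul (ZMod.lift 2 _ ((1 : ℤ) : ZMod 2)) = τ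
    rw [ZMod.lift_coe]
    simp

end Expanding

/-! ### The abelianization -/

section Abelianization

universe u

variable {M : Type u} [TopologicalSpace M] [PathConnectedSpace M] {M₁ : Set M} {f : M₁ → M} {d : ℕ}
  {hf : IsPartialSelfCovering f d}

/-- The abelianization of `V_f` carries the universal transfer invariant homomorphism. -/
theorem IsTransferInvariant.nonempty_abelianization_equiv {A : Type u} [CommGroup A]
    {q : Multiplicative (H1 (TopCat.of M)) →* A} {τ : A} (hq : IsTransferInvariant hf q τ)
    (h₂ : τ * τ = 1) (hτ : τ ^ d = τ) (hd : 2 ≤ d) (hM : IsSemilocallySimplyConnected M)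
    (hexp : IsExpanding f) (t : M)
    (huniv : ∀ (B : Type u) [CommGroup B] (q' : Multiplicative (H1 (TopCat.of M)) →* B) (τ' : B),
      τ' * τ' = 1 → τ' ^ d = τ' → IsTransferInvariant hf q' τ' →
        ∃ φ : A →* B, φ.comp q = q' ∧ φ τ = τ')
    (hext : ∀ φ φ' : A →* A, φ.comp q = φ'.comp q → φ τ = φ' τ → φ = φ') :
    Nonempty (Abelianization (Vgroup hf.isCoveringMap t) ≃* A) := by
  have : NeZero d := ⟨by omega⟩
  have : PathConnectedSpace (TopCat.of M) := ‹PathConnectedSpace M›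
  have : Nonempty (Ends hf t) := nonempty_boundary hf t
  obtain ⟨e⟩ := nonempty_Vgroup_equiv hf t
  obtain ⟨e'⟩ := SelfSimilar.Cocycle.nonempty_abelianization_equiv
    (C := hq.cocycle t h₂ hτ) hd (hq.cocycle_isFaithful t h₂ hτ hM hexp) (fun D => by
      obtain ⟨q', hq', hc⟩ := exists_transferInvariant t D
      obtain ⟨φ, hφ, hφτ⟩ := huniv _ q' D.τ D.τ_mul D.τ_pow hq'
      refine ⟨φ, ?_, hφτ⟩
      rw [← hc, ← hφ]
      rfl) (fun φ φ' h hτ => by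
      refine hext φ φ' ?_ hτ
      refine MonoidHom.ext fun z => ?_
      obtain ⟨g, rfl⟩ := loopHom_surjective (X := TopCat.of M) t z
      exact DFunLike.congr_fun h g)
  exact ⟨e.abelianizationCongr.trans e'⟩

/-- Transfer invariance in terms of homology classes instead of loops, of which they are the
classes. -/
theorem IsTransferInvariant.map_eq (t : M) {A : Type*} [CommGroup A]
    {q : Multiplicative (H1 (TopCat.of M)) →* A} {τ : A} (hq : IsTransferInvariant hf q τ)
    (z : H1 (TopCat.of M)) : ∃ π : Equiv.Perm (Fin d),
      q (.ofAdd z) = q (.ofAdd (sigma hf z)) * sgn τ π ∧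
      ∀ sign, IsMonodromySign (p := hf.hom) hf.isCoveringMap hf.finite_fiber sign →
        Multiplicative.ofAdd (sign z) = sgn generator π := by
  have : PathConnectedSpace (TopCat.of M) := ‹PathConnectedSpace M›
  obtain ⟨γ, rfl⟩ := exists_loopClass (X := TopCat.of M) t z
  refine ⟨_, hq t γ, fun sign hs => ?_⟩
  rw [← ofAdd_monodromyParity hf γ, hs]

theorem sgn_one {A : Type*} [CommGroup A] {X : Type*} [Fintype X] [DecidableEq X]
    (π : Equiv.Perm X) : sgn (1 : A) π = 1 := by
  simp [sgn]

variable (hf)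

theorem nonempty_abelianization_equiv_of_even (hd : 2 ≤ d) (hM : IsSemilocallySimplyConnected M)
    (hexp : IsExpanding f) (t : M) (he : Even d) :
    Nonempty (Additive (Abelianization (Vgroup hf.isCoveringMap t)) ≃+
      H1 (TopCat.of M) ⧸ (AddMonoidHom.id (H1 (TopCat.of M)) - sigma hf).range) := by
  let mk := QuotientAddGroup.mk' (AddMonoidHom.id (H1 (TopCat.of M)) - sigma hf).range
  have hmk (z : H1 (TopCat.of M)) : mk z = mk (sigma hf z) := by
    refine (QuotientAddGroup.eq.2 ?_).symm
    exact ⟨z, by simp [sub_eq_neg_add]⟩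
  have hq : IsTransferInvariant hf (AddMonoidHom.toMultiplicative mk) 1 := fun x γ => by
    rw [sgn_one, mul_one]
    exact congrArg Multiplicative.ofAdd (hmk _)
  obtain ⟨e⟩ := hq.nonempty_abelianization_equiv (one_mul 1) (one_pow d) hd hM hexp t
    (fun B _ q' τ' h₂ hτ hq' => by
      -- An element of order at most two with an even power equal to itself is trivial.
      have hτ1 : τ' = 1 := by
        obtain ⟨k, rfl⟩ := he
        rw [← hτ, pow_add, ← mul_pow, h₂, one_pow]
      subst hτ1
      refine ⟨AddMonoidHom.toMultiplicativeLeft (QuotientAddGroup.lift _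
        (MonoidHom.toAdditiveRight q') ?_), ?_, map_one _⟩
      · rintro _ ⟨z, rfl⟩
        obtain ⟨π, h, -⟩ := hq'.map_eq t z
        rw [sgn_one, mul_one] at h
        rw [AddMonoidHom.mem_ker, AddMonoidHom.sub_apply, map_sub, sub_eq_zero]
        exact h
      · rfl)
    (fun φ φ' h _ => by
      refine MonoidHom.ext fun z => ?_
      obtain ⟨z, rfl⟩ := QuotientAddGroup.mk'_surjective _ z
      exact DFunLike.congr_fun h (Multiplicative.ofAdd z))
  exact ⟨MulEquiv.toAdditiveLeft e⟩

theorem nonempty_abelianization_equiv_of_odd (hd : 2 ≤ d) (hM : IsSemilocallySimplyConnected M)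
    (hexp : IsExpanding f) (t : M) (ho : Odd d) (sign : H1 (TopCat.of M) →+ ZMod 2)
    (hs : IsMonodromySign (p := hf.hom) hf.isCoveringMap hf.finite_fiber sign) :
    Nonempty (Additive (Abelianization (Vgroup hf.isCoveringMap t)) ≃+
      (ZMod 2 × H1 (TopCat.of M)) ⧸
        (AddMonoidHom.id (ZMod 2 × H1 (TopCat.of M)) - sigma₁ hf sign).range) := by
  let mk := QuotientAddGroup.mk' (AddMonoidHom.id (ZMod 2 × H1 (TopCat.of M)) -
    sigma₁ hf sign).range
  have hmk (z : H1 (TopCat.of M)) : mk (0, z) = mk (0, sigma hf z) + mk (sign z, 0) := by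
    rw [← map_add]
    refine (QuotientAddGroup.eq.2 ?_).symm
    exact ⟨(0, z), by simp [sigma₁, sub_eq_neg_add]⟩
  let q := AddMonoidHom.toMultiplicative (mk.comp (AddMonoidHom.inr (ZMod 2) (H1 (TopCat.of M))))
  let j := AddMonoidHom.toMultiplicative (mk.comp (AddMonoidHom.inl (ZMod 2) (H1 (TopCat.of M))))
  have h₂ : j generator * j generator = 1 := by
    rw [← map_mul, generator_mul_self, map_one]
  have hτ : j generator ^ d = j generator := by
    obtain ⟨k, rfl⟩ := ho
    rw [pow_succ, pow_mul, pow_two, h₂, one_pow, one_mul]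
  have hq : IsTransferInvariant hf q (j generator) := fun x γ => by
    rw [← map_sgn, ← ofAdd_monodromyParity hf γ, ← hs x γ]
    exact congrArg Multiplicative.ofAdd (hmk _)
  obtain ⟨e⟩ := hq.nonempty_abelianization_equiv h₂ hτ hd hM hexp t
    (fun B _ q' τ' h₂ hτ hq' => by
      obtain ⟨ψ, hψ⟩ := exists_hom_zmod_two h₂
      refine ⟨AddMonoidHom.toMultiplicativeLeft (QuotientAddGroup.lift _
        (AddMonoidHom.coprod (MonoidHom.toAdditiveRight ψ) (MonoidHom.toAdditiveRight q')) ?_),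
          ?_, ?_⟩
      · rintro _ ⟨⟨s, z⟩, rfl⟩
        obtain ⟨π, h, h'⟩ := hq'.map_eq t z
        have h' : ψ (.ofAdd (sign z)) = sgn τ' π := by rw [h' sign hs, map_sgn, generator, hψ]
        change Additive.ofMul (ψ (.ofAdd (s - (s + sign z))) * q' (.ofAdd (z - sigma hf z))) = 0
        rw [sub_add_cancel_left, ofAdd_neg, map_inv, h', ofAdd_sub, map_div, h,
          mul_div_cancel_left, inv_mul_cancel, ofMul_one]
      · refine MonoidHom.ext fun z => ?_
        change ψ 1 * q' z = q' z
        rw [map_one, one_mul]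
      · exact (congrArg (ψ (.ofAdd 1) * ·) (map_one q')).trans ((mul_one _).trans hψ))
    (fun φ φ' h hτ => by
      refine MonoidHom.ext fun z => ?_
      obtain ⟨⟨s, z⟩, rfl⟩ := QuotientAddGroup.mk'_surjective _ z
      have hz : Multiplicative.ofAdd (mk (s, z)) = j (.ofAdd s) * q (.ofAdd z) := by
        refine congrArg Multiplicative.ofAdd ((congrArg mk ?_).trans (map_add mk (s, 0) (0, z)))
        simp
      have hj : φ (j (.ofAdd s)) = φ' (j (.ofAdd s)) := by
        fin_cases s
        · exact (map_one (φ.comp j)).trans (map_one (φ'.comp j)).symm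
        · exact hτ
      change φ (.ofAdd (mk (s, z))) = φ' (.ofAdd (mk (s, z)))
      rw [hz, map_mul, map_mul, hj]
      exact congrArg _ (DFunLike.congr_fun h (.ofAdd z)))
  exact ⟨MulEquiv.toAdditiveLeft e⟩

end Abelianization

end ExpandingMaps

end

theorem mainTheorem4 {M : Type*} [TopologicalSpace M] [PathConnectedSpace M]
    (hM : ExpandingMaps.IsSemilocallySimplyConnected M)
    {M₁ : Set M} (f : M₁ → M) (d : ℕ) (hd : 2 ≤ d)
    (hf : ExpandingMaps.IsPartialSelfCovering f d)
    (hexp : ExpandingMaps.IsExpanding f) (t : M) :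
    (Even d →
      Nonempty (Additive (Abelianization (ExpandingMaps.Vgroup hf.isCoveringMap t)) ≃+
        ExpandingMaps.H1 (TopCat.of M) ⧸
          (AddMonoidHom.id (ExpandingMaps.H1 (TopCat.of M)) - ExpandingMaps.sigma hf).range)) ∧
    (Odd d →
      ∃ sign : ExpandingMaps.H1 (TopCat.of M) →+ ZMod 2,
        ExpandingMaps.IsMonodromySign (p := hf.hom) hf.isCoveringMap hf.finite_fiber sign ∧
        (∀ sign' : ExpandingMaps.H1 (TopCat.of M) →+ ZMod 2,
          ExpandingMaps.IsMonodromySign (p := hf.hom) hf.isCoveringMap hf.finite_fiber sign' →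
            sign' = sign) ∧
        Nonempty (Additive (Abelianization (ExpandingMaps.Vgroup hf.isCoveringMap t)) ≃+
          (ZMod 2 × ExpandingMaps.H1 (TopCat.of M)) ⧸
            (AddMonoidHom.id (ZMod 2 × ExpandingMaps.H1 (TopCat.of M)) -
              ExpandingMaps.sigma₁ hf sign).range)) := by
  refine ⟨ExpandingMaps.nonempty_abelianization_equiv_of_even hf hd hM hexp t, fun ho => ?_⟩
  obtain ⟨sign, hs⟩ := ExpandingMaps.exists_isMonodromySign hf t
  exact ⟨sign, hs, fun _ hs' => ExpandingMaps.IsMonodromySign.unique hf t hs hs',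
    ExpandingMaps.nonempty_abelianization_equiv_of_odd hf hd hM hexp t ho sign hs⟩
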